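/- Let $\mathbb{S}=\{|z|=1\}$ and $\mathbb{D}=\{|z|<1\}$ in $\mathbb{C}$. Let $\varphi:\mathbb{S}\to\mathbb{S}$ be a homeomorphism and let $h=P[\varphi]$ be its harmonic Poisson extension, $$h(z)=\frac1{2\pi}\int_{\mathbb{S}}\frac{1-|z|^2}{|z-\zeta|^2}\,\varphi(\zeta)\,|d\zeta|,\qquad z\in\mathbb{D},$$ where $|d\zeta|$ is arc length on $\mathbb{S}$. Let $|Dh|$ be the operator norm of the differential of $h$ and, for $j\ge1$ and $1\le k\le 2^j$, let $$\Gamma_{j,k}=\{e^{i\theta}:2\pi(k-1)/2^j\le\theta\le2\pi k/2^j\}$$ be the dyadic arcs of $\mathbb{S}$. Denote by $\ell(\varphi(\Gamma_{j,k}))$ the arc length of the image arc. Then for every real $\lambda>-1$ the following are equivalent: (i) $\displaystyle\int_{\mathbb{D}}|Dh(z)|^2\log^\lambda(e+|Dh(z)|)\,dz<+\infty$; (ii) $\displaystyle\int_{\mathbb{D}}|Dh(z)|^2\log^\lambda\Big(\frac{2}{1-|z|}\Big)\,dz<+\infty$; (iii) $\displaystyle\int_{\mathbb{S}}\int_{\mathbb{S}}\big|\log|\varphi^{-1}(\eta)-\varphi^{-1}(\xi)|\big|^{\lambda+1}\,|d\eta|\,|d\xi|<+\infty$;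 (iv) $\displaystyle\sum_{j=1}^\infty j^\lambda\sum_{k=1}^{2^j}\ell(\varphi(\Gamma_{j,k}))^2<+\infty$; (v) $\displaystyle\sum_{j=1}^\infty\sum_{k=1}^{2^j}\ell(\varphi(\Gamma_{j,k}))^2\log^\lambda\Big(e+\frac{\ell(\varphi(\Gamma_{j,k}))}{2^{-j}}\Big)<+\infty$. -/

import Mathlib

open MeasureTheory Set
open scoped ENNReal

noncomputable section

namespace PoissonEnergy

instance instMeasurableSpaceCircle : MeasurableSpace Circle := borel Circle

instance instBorelSpaceCircle : BorelSpace Circle := ⟨rfl⟩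

/-- Arc length `|dζ|` on the unit circle: the image of Lebesgue measure on `(0, 2π]` under
`θ ↦ e^{iθ}`. Its total mass is `2π`. -/
def arcLength : Measure Circle :=
  (volume.restrict (Ioc (0 : ℝ) (2 * Real.pi))).map Circle.exp

/-- The (complex-valued) Poisson integral
`P[φ](z) = (1 / 2π) ∫_𝕊 (1 - |z|²) / |z - ζ|² φ(ζ) |dζ|`; only its values for `|z| < 1` matter. -/
def poissonExtension (φ : Circle → Circle) (z : ℂ) : ℂ :=
  (2 * Real.pi)⁻¹ • ∫ ζ : Circle, poissonKernel 0 z (ζ : ℂ) • (φ ζ : ℂ) ∂arcLength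

/-- The closed dyadic arc `Γ_{j,k} = {e^{iθ} : 2π(k-1)/2^j ≤ θ ≤ 2πk/2^j}`, for `j ≥ 1` and
`1 ≤ k ≤ 2^j`. -/
def dyadicArc (j k : ℕ) : Set Circle :=
  Circle.exp '' Icc (2 * Real.pi * ((k : ℝ) - 1) / 2 ^ j) (2 * Real.pi * (k : ℝ) / 2 ^ j)

/-- The length `ℓ(φ(Γ_{j,k}))` of the image of a dyadic arc. -/
def imageLength (φ : Circle → Circle) (j k : ℕ) : ℝ :=
  arcLength.real (φ '' dyadicArc j k)

/-- `∫_𝔻 |Dh|² log^l(e + |Dh|) dz`, with the operator norm `|Dh|` of the real differential. -/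
def orliczEnergy (h : ℂ → ℂ) (l : ℝ) : ℝ≥0∞ :=
  ∫⁻ z in Metric.ball (0 : ℂ) 1,
    ENNReal.ofReal (‖fderiv ℝ h z‖ ^ 2 * Real.log (Real.exp 1 + ‖fderiv ℝ h z‖) ^ l)

/-- `∫_𝔻 |Dh|² log^l(2 / (1 - |z|)) dz`. -/
def weightedEnergy (h : ℂ → ℂ) (l : ℝ) : ℝ≥0∞ :=
  ∫⁻ z in Metric.ball (0 : ℂ) 1,
    ENNReal.ofReal (‖fderiv ℝ h z‖ ^ 2 * Real.log (2 / (1 - ‖z‖)) ^ l)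

/-- `∫_𝕊 ∫_𝕊 |log |ψ(η) - ψ(ξ)||^(l+1) |dη| |dξ|`, to be used with `ψ = φ⁻¹`. The modulus is the
Euclidean one of `ℂ`. -/
def logEnergy (ψ : Circle → Circle) (l : ℝ) : ℝ≥0∞ :=
  ∫⁻ ξ : Circle, ∫⁻ η : Circle,
    ENNReal.ofReal (|Real.log ‖(ψ η : ℂ) - (ψ ξ : ℂ)‖| ^ (l + 1)) ∂arcLength ∂arcLength

/-- `∑_{j ≥ 1} j^l ∑_{k = 1}^{2^j} ℓ(φ(Γ_{j,k}))²`. -/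
def dyadicEnergy (φ : Circle → Circle) (l : ℝ) : ℝ≥0∞ :=
  ∑' j : ℕ+, ENNReal.ofReal
    (((j : ℕ) : ℝ) ^ l * ∑ k ∈ Finset.Icc 1 (2 ^ (j : ℕ)), imageLength φ j k ^ 2)

/-- `∑_{j ≥ 1} ∑_{k = 1}^{2^j} ℓ(φ(Γ_{j,k}))² log^l(e + ℓ(φ(Γ_{j,k})) / 2^{-j})`. -/
def dyadicOrliczEnergy (φ : Circle → Circle) (l : ℝ) : ℝ≥0∞ :=
  ∑' j : ℕ+, ENNReal.ofReal
    (∑ k ∈ Finset.Icc 1 (2 ^ (j : ℕ)), imageLength φ j k ^ 2 *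
      Real.log (Real.exp 1 + imageLength φ j k / ((2 : ℝ) ^ (j : ℕ))⁻¹) ^ l)

end PoissonEnergy

end

/-!
Write `h` for the Poisson extension of the homeomorphism `φ`, and `ν` for the measure
`A ↦ ℓ(φ(A))` (`imageMeasure`), a finite measure without atoms. The five conditions all measure
how `ν × ν` concentrates near the diagonal, with the logarithm of the distance of two points
counting the dyadic scales at which they are still close to each other. They are connected by a
cycle (weighted Dirichlet energy ⟹ dyadic sums ⟹ logarithmic energy ⟹ weighted Dirichlet energy)
and by two equivalences that exchange the geometric weights for Orlicz weights.

*From the dyadic sums to the logarithmic energy.* After the change of variables by `φ`, the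
logarithmic energy is `∬ |log |u - v||^(l+1) dν dν`. Since `l > -1`, the power `N^(l+1)` is at most
a constant times `∑_{j ≤ N} j^l`, so the integrand is bounded by the sum of `j^l` over the scales
with `|u - v| ≤ 2^{-j}` (`exists_abs_log_rpow_le`). The set of such pairs has `ν × ν`-measure at
most `5 ∑_k ν(Γ_{j,k})²`, as the points lie in equal or adjacent arcs
(`lintegral_imageMeasure_ball_le`).

*From the logarithmic energy to the weighted Dirichlet energy.* The gradient of the Poisson kernel
is `O(|ζ - z|^{-2})` and annihilates constants, and the oscillation of `φ` is bounded by `ν`;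
Fubini's theorem gives `|Dh(z)| ≤ C ∫ |u - z|⁻¹ dν(u)` (`enorm_fderiv_le_potential`). Squared and
integrated over the circle of radius `1 - s` this is at most a constant times
`∬ (s (s + |u - v|))^{-1/2} dν dν` (`circleEnergy_le`). Integrating this kernel against
`log^l(2/s) ds` costs one more logarithm and produces `1 + |log |u - v||^(l+1)`
(`exists_lintegral_kernel_le`); here `l > -1` is used again.

*From the weighted Dirichlet energy to the dyadic sums.* On short arcs `φ` is monotone in the
angle, so `ν` of the arc is comparable with the chord between the images of the endpoints
(`exists_imageMeasure_arc_le`). That chord is bounded by the integral of `|Dh|` along a radius, an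
arc at distance `s` from the boundary, and another radius. The Cauchy–Schwarz inequality, with
weight `s^{1/2}` on the radii, and averaging over `s` and over rotations bound `∑_k ν(Γ_{j,k})²` by
`2^{j/2} ∫_{s < 2^{-j}} s^{1/2} ∫ |Dh|² dζ ds` (`exists_dyadicSquareSum_le`). Multiplied by `j^l`
and summed over `j` this is the weighted Dirichlet energy, because the sum of `j^l 2^{j/2}` over
`2^{-j} > s` is of the order of `s^{-1/2} log^l(2/s)` (`exists_tsum_weight_le`).

*Orlicz weights.* Both `|Dh(z)|` and `2^j ℓ(φ(Γ_{j,k}))` are bounded by `2π / s` with `s = 1 - |z|`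
or `s = 2^{-j}`. For `x ≤ 2π / s`, either `x > s^{-1/4}`, and `log(e + x)` is comparable with
`log(2/s)`, or `x²` times either weight is at most a constant times `s^{-3/4}`
(`exists_sq_mul_log_comparison`). These errors are integrable over the disc, respectively summable
over the dyadic arcs.
-/

namespace PoissonEnergy

/-! ### Arc length and rotations -/

/-- Arc length can be computed with any interval of angles of length `2π`. -/
theorem lintegral_arcLength {f : Circle → ℝ≥0∞} (hf : Measurable f) (a : ℝ) :
    ∫⁻ ζ, f ζ ∂arcLength = ∫⁻ t in Ioc a (a + 2 * Real.pi), f (Circle.exp t) := by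
  rw [arcLength, lintegral_map hf Circle.exp.continuous.measurable]
  have h0 := isAddFundamentalDomain_Ioc Real.two_pi_pos 0
  have ha := isAddFundamentalDomain_Ioc Real.two_pi_pos a
  rw [zero_add] at h0
  refine h0.setLIntegral_eq ha _ ?_
  rintro ⟨g, hg⟩ x
  obtain ⟨n, rfl⟩ := AddSubgroup.mem_zmultiples_iff.1 hg
  congr 1
  change Circle.exp (n • (2 * Real.pi) + x) = _
  rw [add_comm]
  exact Circle.periodic_exp.zsmul n x

instance : IsFiniteMeasure arcLength := by
  unfold arcLength
  infer_instance

theorem arcLength_univ : arcLength univ = ENNReal.ofReal (2 * Real.pi) := by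
  have := lintegral_arcLength (f := fun _ => 1) measurable_const 0
  simpa using this

theorem lintegral_arcLength_mul_left {f : Circle → ℝ≥0∞} (hf : Measurable f) (c : Circle) :
    ∫⁻ ζ, f (c * ζ) ∂arcLength = ∫⁻ ζ, f ζ ∂arcLength := by
  have hc : Circle.exp (Complex.arg c) = c := Circle.exp_arg c
  have hf' : Measurable fun ζ => f (c * ζ) := hf.comp (continuous_const.mul continuous_id).measurable
  rw [lintegral_arcLength hf' 0, lintegral_arcLength hf (0 + Complex.arg c)]
  have hmp := measurePreserving_add_left (volume : Measure ℝ) (Complex.arg c)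
  rw [← hmp.setLIntegral_comp_preimage_emb (measurableEmbedding_addLeft _)
    (fun t => f (Circle.exp t))]
  simp only [Circle.exp_add, hc, preimage_const_add_Ioc]
  ring_nf

theorem arcLength_mul_left_image (c : Circle) {A : Set Circle} (hA : MeasurableSet A) :
    arcLength ((fun ζ => c * ζ) '' A) = arcLength A := by
  have hm : MeasurableSet ((fun ζ => c * ζ) '' A) :=
    (Homeomorph.mulLeft c).measurableEmbedding.measurableSet_image.2 hA
  rw [← lintegral_indicator_one hm, ← lintegral_indicator_one hA,
    ← lintegral_arcLength_mul_left (measurable_one.indicator hm) c]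
  congr 1 with ζ
  simp only [indicator, Pi.one_apply]
  congr 1
  simp

theorem measurableSet_exp_image_Icc (p q : ℝ) : MeasurableSet (Circle.exp '' Icc p q) :=
  (isCompact_Icc.image Circle.exp.continuous).measurableSet

theorem arcLength_exp_image_Icc_le (p q : ℝ) :
    arcLength (Circle.exp '' Icc p q) ≤ ENNReal.ofReal (q - p) := by
  rcases le_or_gt (2 * Real.pi) (q - p) with h | h
  · calc _ ≤ arcLength univ := measure_mono (subset_univ _)
      _ ≤ _ := by rw [arcLength_univ]; exact ENNReal.ofReal_le_ofReal h
  · have hm := measurableSet_exp_image_Icc p q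
    rw [← lintegral_indicator_one hm, lintegral_arcLength (measurable_one.indicator hm) p]
    have hsub : ∀ t ∈ Ioc p (p + 2 * Real.pi), t ≠ p + 2 * Real.pi →
        Circle.exp t ∈ Circle.exp '' Icc p q → t ∈ Icc p q := by
      rintro t ht hne ⟨u, hu, hut⟩
      have : u = t := by
        refine Circle.exp_injOn_Ico (a := p) (b := p + 2 * Real.pi) (by linarith) ?_ ?_ hut
        · exact ⟨hu.1, by linarith [hu.2]⟩
        · exact ⟨ht.1.le, lt_of_le_of_ne ht.2 hne⟩
      rwa [← this]
    calc _ ≤ ∫⁻ t in Ioc p (p + 2 * Real.pi), (Icc p q).indicator 1 t := by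
          refine lintegral_mono_ae ?_
          have h1 : ∀ᵐ t ∂(volume.restrict (Ioc p (p + 2 * Real.pi))), t ≠ p + 2 * Real.pi :=
            ae_restrict_of_ae (Measure.ae_ne volume _)
          filter_upwards [h1, ae_restrict_mem measurableSet_Ioc] with t ht1 ht2
          by_cases ht : Circle.exp t ∈ Circle.exp '' Icc p q
          · simp [indicator, hsub t ht2 ht1 ht, ht]
          · rw [indicator_of_notMem ht]; exact zero_le
      _ ≤ ∫⁻ t, (Icc p q).indicator 1 t := setLIntegral_le_lintegral _ _
      _ = _ := by rw [lintegral_indicator_one measurableSet_Icc, Real.volume_Icc]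

theorem norm_exp_sub_one (t : ℝ) : ‖(Circle.exp t : ℂ) - 1‖ = 2 * |Real.sin (t / 2)| := by
  rw [Circle.coe_exp, mul_comm, Complex.norm_exp_I_mul_ofReal_sub_one]
  simp

theorem norm_exp_sub_exp (s t : ℝ) :
    ‖(Circle.exp s : ℂ) - Circle.exp t‖ = ‖(Circle.exp (s - t) : ℂ) - 1‖ := by
  have : (Circle.exp s : ℂ) - Circle.exp t = Circle.exp t * (Circle.exp (s - t) - 1) := by
    rw [mul_sub, ← Circle.coe_mul, ← Circle.exp_add]; simp
  rw [this, norm_mul, Circle.norm_coe, one_mul]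

theorem norm_exp_sub_one_le (t : ℝ) : ‖(Circle.exp t : ℂ) - 1‖ ≤ |t| := by
  rw [norm_exp_sub_one]
  have := Real.abs_sin_le_abs (x := t / 2)
  rw [abs_div] at this
  norm_num at this
  linarith

theorem abs_sin_half {t : ℝ} (ht : |t| ≤ Real.pi) : |Real.sin (t / 2)| = Real.sin (|t| / 2) := by
  rcases le_total 0 t with h | h
  · rw [abs_of_nonneg h] at *
    exact abs_of_nonneg (Real.sin_nonneg_of_nonneg_of_le_pi (by linarith) (by linarith))
  · rw [abs_of_nonpos h] at *
    rw [neg_div, Real.sin_neg]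
    exact abs_of_nonpos (Real.sin_nonpos_of_nonpos_of_neg_pi_le (by linarith) (by linarith))

theorem le_norm_exp_sub_one {t : ℝ} (ht : |t| ≤ Real.pi) :
    2 / Real.pi * |t| ≤ ‖(Circle.exp t : ℂ) - 1‖ := by
  rw [norm_exp_sub_one, abs_sin_half ht]
  have := Real.mul_le_sin (x := |t| / 2) (by positivity) (by linarith)
  linarith

theorem norm_exp_sub_one_mono {s t : ℝ} (hst : |s| ≤ |t|) (ht : |t| ≤ Real.pi) :
    ‖(Circle.exp s : ℂ) - 1‖ ≤ ‖(Circle.exp t : ℂ) - 1‖ := by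
  rw [norm_exp_sub_one, norm_exp_sub_one, abs_sin_half ht, abs_sin_half (hst.trans ht)]
  have := Real.sin_le_sin_of_le_of_le_pi_div_two (x := |s| / 2) (y := |t| / 2)
    (by linarith [abs_nonneg s, Real.pi_pos]) (by linarith) (by linarith)
  linarith

/-- The chord between two points of a connected subset of the circle is at most the length of that
subset: the distance to one of the points, as a function of the angle, is `1`-Lipschitz, and it
takes all intermediate values on the subset. -/
theorem ofReal_norm_sub_le_arcLength {A : Set Circle} (hA : IsPreconnected A) {x y : Circle}
    (hx : x ∈ A) (hy : y ∈ A) : ENNReal.ofReal ‖(y : ℂ) - x‖ ≤ arcLength A := by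
  set g : ℝ → ℝ := fun θ => ‖(Circle.exp θ : ℂ) - x‖ with hg
  have hlip : LipschitzWith 1 g := by
    refine LipschitzWith.of_dist_le_mul fun s t => ?_
    rw [Real.dist_eq, Real.dist_eq, NNReal.coe_one, one_mul]
    calc |g s - g t| ≤ ‖((Circle.exp s : ℂ) - x) - (Circle.exp t - x)‖ :=
          abs_norm_sub_norm_le _ _
      _ = ‖(Circle.exp (s - t) : ℂ) - 1‖ := by rw [sub_sub_sub_cancel_right, norm_exp_sub_exp]
      _ ≤ _ := norm_exp_sub_one_le _
  set K := Circle.exp ⁻¹' A ∩ Ioc 0 (2 * Real.pi) with hK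
  have hsub : Icc 0 ‖(y : ℂ) - x‖ ⊆ g '' K := by
    have himg : IsPreconnected ((fun ζ : Circle => ‖(ζ : ℂ) - x‖) '' A) :=
      hA.image _ (by fun_prop)
    have h1 := himg.Icc_subset (a := 0) (b := ‖(y : ℂ) - x‖) ⟨x, hx, by simp⟩ ⟨y, hy, rfl⟩
    intro r hr
    obtain ⟨ζ, hζ, rfl⟩ := h1 hr
    have hmem : ζ ∈ Circle.exp '' Ioc 0 (2 * Real.pi) := by
      obtain ⟨t, ht, hte⟩ := Circle.periodic_exp.exists_mem_Ioc Real.two_pi_pos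
        (Complex.arg ζ) 0
      rw [zero_add] at ht
      exact ⟨t, ht, by rw [← hte, Circle.exp_arg]⟩
    obtain ⟨t, ht, rfl⟩ := hmem
    exact ⟨t, ⟨hζ, ht⟩, rfl⟩
  calc ENNReal.ofReal ‖(y : ℂ) - x‖ = volume (Icc 0 ‖(y : ℂ) - x‖) := by simp
    _ ≤ volume (g '' K) := measure_mono hsub
    _ ≤ volume K := by
      have := hlip.hausdorffMeasure_image_le zero_le_one K
      simpa [hausdorffMeasure_real] using this
    _ = (volume.restrict (Ioc 0 (2 * Real.pi))) (Circle.exp ⁻¹' A) :=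
      (Measure.restrict_apply' measurableSet_Ioc).symm
    _ ≤ arcLength A := Measure.le_map_apply Circle.exp.continuous.measurable.aemeasurable A

theorem arcLength_singleton (x : Circle) : arcLength {x} = 0 := by
  have := arcLength_exp_image_Icc_le (Complex.arg x) (Complex.arg x)
  simpa [Circle.exp_arg] using this

/-! ### The length of image arcs as a measure -/

/-- The measure `A ↦ ℓ(φ(A))` on the circle. -/
noncomputable def imageMeasure (φ : Circle ≃ₜ Circle) : Measure Circle := arcLength.map φ.symm

variable (φ : Circle ≃ₜ Circle)

instance : IsFiniteMeasure (imageMeasure φ) := by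
  unfold imageMeasure
  infer_instance

theorem imageMeasure_apply (A : Set Circle) : imageMeasure φ A = arcLength (φ '' A) := by
  rw [imageMeasure, φ.symm.measurableEmbedding.map_apply, φ.image_eq_preimage_symm]

instance : NullSingletonClass (imageMeasure φ) := ⟨fun x => by
  rw [imageMeasure_apply, image_singleton, arcLength_singleton]⟩

theorem lintegral_imageMeasure {f : Circle → ℝ≥0∞} (hf : Measurable f) :
    ∫⁻ u, f u ∂imageMeasure φ = ∫⁻ ζ, f (φ.symm ζ) ∂arcLength :=
  lintegral_map hf φ.symm.continuous.measurable

theorem imageMeasure_univ : imageMeasure φ univ = ENNReal.ofReal (2 * Real.pi) := by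
  rw [imageMeasure_apply, image_univ, φ.surjective.range_eq, arcLength_univ]

theorem ofReal_norm_sub_le_imageMeasure {A : Set Circle} (hA : IsPreconnected A) {x y : Circle}
    (hx : x ∈ A) (hy : y ∈ A) : ENNReal.ofReal ‖(φ y : ℂ) - φ x‖ ≤ imageMeasure φ A := by
  rw [imageMeasure_apply]
  exact ofReal_norm_sub_le_arcLength (hA.image _ φ.continuous.continuousOn)
    (mem_image_of_mem _ hx) (mem_image_of_mem _ hy)

/-- The oscillation of `φ` between two points is controlled by the length of the image of the
chordal disc around one of them. -/
theorem ofReal_norm_sub_le_imageMeasure_ball (x y : Circle) :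
    ENNReal.ofReal ‖(φ y : ℂ) - φ x‖ ≤ imageMeasure φ {u | ‖(u : ℂ) - x‖ ≤ ‖(y : ℂ) - x‖} := by
  set t := Complex.arg ((y / x : Circle) : ℂ) with ht
  have hexp : Circle.exp t = y / x := Circle.exp_arg _
  have htpi : |t| ≤ Real.pi := Complex.abs_arg_le_pi _
  have hA : IsPreconnected ((fun s => x * Circle.exp s) '' uIcc 0 t) :=
    isPreconnected_uIcc.image _ (by fun_prop)
  have hmul : ∀ s, ‖((x * Circle.exp s : Circle) : ℂ) - x‖ = ‖(Circle.exp s : ℂ) - 1‖ := by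
    intro s
    rw [Circle.coe_mul, ← mul_sub_one, norm_mul, Circle.norm_coe, one_mul]
  refine (ofReal_norm_sub_le_imageMeasure φ hA (x := x) (y := y) ⟨0, left_mem_uIcc, by simp⟩
    ⟨t, right_mem_uIcc, by simp [hexp]⟩).trans (measure_mono ?_)
  rintro _ ⟨s, hs, rfl⟩
  have hy : y = x * Circle.exp t := by simp [hexp]
  simp only [mem_ofPred_eq]
  rw [hmul, hy, hmul]
  refine norm_exp_sub_one_mono ?_ htpi
  rcases le_total 0 t with h | h
  · rw [uIcc_of_le h] at hs
    rw [abs_of_nonneg h, abs_of_nonneg hs.1]; exact hs.2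
  · rw [uIcc_of_ge h] at hs
    rw [abs_of_nonpos h, abs_of_nonpos hs.2]; linarith [hs.1]

/-- On short arcs the length of the image is comparable with the chord between the images of the
endpoints, since `arg` of `φ` is then an injective continuous, hence monotone, function. -/
theorem exists_imageMeasure_arc_le : ∃ δ > 0, ∀ α β : ℝ, α ≤ β → β - α ≤ δ →
    imageMeasure φ (Circle.exp '' Icc α β) ≤
      ENNReal.ofReal (Real.pi / 2 * ‖(φ (Circle.exp β) : ℂ) - φ (Circle.exp α)‖) := by
  have huc : UniformContinuous φ := CompactSpace.uniformContinuous_of_continuous φ.continuous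
  obtain ⟨δ, hδ, h⟩ := Metric.uniformContinuous_iff.1 huc 1 one_pos
  refine ⟨min (δ / 2) Real.pi, lt_min (by positivity) Real.pi_pos, fun α β hαβ hd => ?_⟩
  have hd1 : β - α ≤ δ / 2 := hd.trans (min_le_left _ _)
  have hd2 : β - α ≤ Real.pi := hd.trans (min_le_right _ _)
  set c := φ (Circle.exp α) with hc
  set v : ℝ → Circle := fun t => φ (Circle.exp t) / c with hv
  have hclose : ∀ t ∈ Icc α β, ‖((v t : Circle) : ℂ) - 1‖ < 1 := by
    intro t ht
    have h1 : dist (Circle.exp t) (Circle.exp α) < δ := by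
      change dist (Circle.exp t : ℂ) (Circle.exp α) < δ
      rw [dist_eq_norm, norm_exp_sub_exp]
      refine (norm_exp_sub_one_le _).trans_lt ?_
      rw [abs_of_nonneg (by linarith [ht.1])]
      linarith [ht.2]
    have h2 : dist (φ (Circle.exp t) : ℂ) c < 1 := h h1
    rw [dist_eq_norm] at h2
    rw [hv, Circle.coe_div, div_sub_one c.coe_ne_zero, norm_div, Circle.norm_coe, div_one]
    exact h2
  have hslit : ∀ t ∈ Icc α β, ((v t : Circle) : ℂ) ∈ Complex.slitPlane := by
    intro t ht
    have := Complex.mem_slitPlane_of_norm_lt_one (z := (v t : ℂ) - 1) (hclose t ht)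
    rwa [add_sub_cancel] at this
  set u : ℝ → ℝ := fun t => Complex.arg (v t) with hu
  have hvcont : Continuous v := by
    have := φ.continuous
    fun_prop
  have hucont : ContinuousOn u (Icc α β) := fun t ht =>
    ((Complex.continuousAt_arg (hslit t ht)).comp
      (f := fun t => ((v t : Circle) : ℂ)) (by fun_prop)).continuousWithinAt
  have hvexp : ∀ t, Circle.exp (u t) = v t := fun t => Circle.exp_arg _
  have huinj : InjOn u (Icc α β) := by
    intro s hs t ht hst
    have h1 : v s = v t := by rw [← hvexp, ← hvexp, hst]
    have h2 : Circle.exp s = Circle.exp t := φ.injective (div_left_injective h1)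
    exact Circle.exp_injOn_Icc (by linarith [Real.pi_pos]) hs ht h2
  have hu0 : u α = 0 := by simp [hu, hv, hc]
  have hmem : ∀ t ∈ Icc α β, u t ∈ uIcc 0 (u β) := by
    intro t ht
    have hα : α ∈ Icc α β := left_mem_Icc.2 hαβ
    have hβ : β ∈ Icc α β := right_mem_Icc.2 hαβ
    rw [← hu0]
    rcases hucont.strictMonoOn_of_injOn_Icc' hαβ huinj with hm | hm
    · exact Icc_subset_uIcc ⟨hm.monotoneOn hα ht ht.1, hm.monotoneOn ht hβ ht.2⟩
    · exact Icc_subset_uIcc' ⟨hm.antitoneOn ht hβ ht.2, hm.antitoneOn hα ht ht.1⟩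
  have hsub : φ '' (Circle.exp '' Icc α β) ⊆
      (fun ζ => c * ζ) '' (Circle.exp '' uIcc 0 (u β)) := by
    rintro _ ⟨_, ⟨t, ht, rfl⟩, rfl⟩
    refine ⟨Circle.exp (u t), ⟨u t, hmem t ht, rfl⟩, ?_⟩
    simp [hvexp, hv]
  rw [imageMeasure_apply]
  refine (measure_mono hsub).trans ?_
  rw [uIcc, arcLength_mul_left_image _ (measurableSet_exp_image_Icc _ _)]
  refine (arcLength_exp_image_Icc_le _ _).trans (ENNReal.ofReal_le_ofReal ?_)
  have h1 := le_norm_exp_sub_one (t := u β) (Complex.abs_arg_le_pi _)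
  have h2 : ‖(Circle.exp (u β) : ℂ) - 1‖ = ‖(φ (Circle.exp β) : ℂ) - c‖ := by
    rw [hvexp, hv, Circle.coe_div, div_sub_one c.coe_ne_zero, norm_div, Circle.norm_coe, div_one]
  rw [h2] at h1
  have h3 : max 0 (u β) - min 0 (u β) = |u β| := by
    rw [max_sub_min_eq_abs', zero_sub, abs_neg]
  rw [h3]
  calc |u β| = Real.pi / 2 * (2 / Real.pi * |u β|) := by field_simp
    _ ≤ _ := by gcongr

/-- Polar coordinates in the unit disc. -/
theorem lintegral_ball_eq {f : ℂ → ℝ≥0∞} (hf : Measurable f) :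
    ∫⁻ z in Metric.ball (0 : ℂ) 1, f z =
      ∫⁻ r in Ioo (0 : ℝ) 1, ENNReal.ofReal r * ∫⁻ ζ : Circle, f (r * ζ) ∂arcLength := by
  rw [← lintegral_indicator Metric.isOpen_ball.measurableSet,
    ← Complex.lintegral_comp_polarCoord_symm, polarCoord_target]
  have hm : Measurable fun p : ℝ × ℝ => ENNReal.ofReal p.1 •
      (Metric.ball (0 : ℂ) 1).indicator f (Complex.polarCoord.symm p) := by
    have h1 : Measurable fun p : ℝ × ℝ => Complex.polarCoord.symm p := by
      simp only [Complex.polarCoord_symm_apply]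
      fun_prop
    exact (ENNReal.measurable_ofReal.comp measurable_fst).smul
      ((hf.indicator Metric.isOpen_ball.measurableSet).comp h1)
  rw [Measure.volume_eq_prod, ← Measure.prod_restrict, lintegral_prod _ hm.aemeasurable,
    ← lintegral_indicator measurableSet_Ioi, ← lintegral_indicator measurableSet_Ioo]
  congr 1 with r
  by_cases hr : r ∈ Ioo (0 : ℝ) 1
  · rw [indicator_of_mem hr, indicator_of_mem (mem_Ioi.2 hr.1)]
    have hfr : Measurable fun ζ : Circle => f (r * ζ) := hf.comp (by fun_prop)
    rw [lintegral_arcLength hfr (-Real.pi), ← lintegral_const_mul _ (by fun_prop)]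
    have : -Real.pi + 2 * Real.pi = Real.pi := by ring
    rw [this, ← restrict_Ioo_eq_restrict_Ioc]
    refine lintegral_congr fun t => ?_
    have hz : Complex.polarCoord.symm (r, t) = r * Circle.exp t := by
      rw [Complex.polarCoord_symm_apply, Circle.coe_exp, Complex.exp_mul_I]
      simp
    rw [smul_eq_mul, hz, indicator_of_mem]
    simp [abs_of_pos hr.1, hr.2]
  · rw [indicator_of_notMem hr]
    by_cases hr0 : 0 < r
    · rw [indicator_of_mem (mem_Ioi.2 hr0)]
      have : ∀ t : ℝ, (Metric.ball (0 : ℂ) 1).indicator f (Complex.polarCoord.symm (r, t)) = 0 := by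
        intro t
        rw [indicator_of_notMem]
        simp only [Metric.mem_ball, dist_zero_right, Complex.norm_polarCoord_symm, not_lt]
        rw [abs_of_pos hr0]
        by_contra h
        exact hr ⟨hr0, not_le.1 h⟩
      simp only [this, smul_zero, lintegral_zero]
    · rw [indicator_of_notMem (by simpa using hr0)]

/-! ### The Poisson extension and its gradient -/

theorem integrable_of_continuous {E : Type*} [NormedAddCommGroup E] {g : Circle → E}
    (hg : Continuous g) : Integrable g arcLength :=
  hg.integrable_of_hasCompactSupport (HasCompactSupport.of_compactSpace g)

theorem one_sub_norm_le (z : ℂ) (ζ : Circle) : 1 - ‖z‖ ≤ ‖(ζ : ℂ) - z‖ := by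
  have := norm_sub_norm_le (ζ : ℂ) z
  rwa [Circle.norm_coe] at this

theorem coe_sub_ne_zero {z : ℂ} (hz : ‖z‖ < 1) (ζ : Circle) : (ζ : ℂ) - z ≠ 0 := by
  have := one_sub_norm_le z ζ
  exact norm_pos_iff.1 (by linarith)

theorem poissonKernel_circle (z : ℂ) (ζ : Circle) :
    poissonKernel 0 z ζ = (1 - ‖z‖ ^ 2) / ‖(ζ : ℂ) - z‖ ^ 2 := by
  simp [poissonKernel_def, Circle.norm_coe]

theorem poissonKernel_eq_re {z : ℂ} (hz : ‖z‖ < 1) (ζ : Circle) :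
    poissonKernel 0 z ζ = (2 * (ζ : ℂ) / (ζ - z) - 1).re := by
  rw [poissonKernel_eq_re_herglotzRieszKernel, Function.comp_apply, herglotzRieszKernel_def]
  congr 1
  have := coe_sub_ne_zero hz ζ
  simp only [sub_zero]
  field_simp
  ring

theorem continuous_poissonKernel {z : ℂ} (hz : ‖z‖ < 1) :
    Continuous fun ζ : Circle => poissonKernel 0 z ζ := by
  simp only [poissonKernel_circle]
  refine continuous_const.div (by fun_prop) fun ζ => ?_
  exact pow_ne_zero _ (norm_ne_zero_iff.2 (coe_sub_ne_zero hz ζ))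

theorem poissonKernel_nonneg {z : ℂ} (hz : ‖z‖ < 1) (ζ : Circle) : 0 ≤ poissonKernel 0 z ζ := by
  rw [poissonKernel_circle]
  have : 0 ≤ 1 - ‖z‖ ^ 2 := by nlinarith [norm_nonneg z]
  positivity

theorem integral_poissonKernel {z : ℂ} (hz : ‖z‖ < 1) :
    ∫ ζ : Circle, poissonKernel 0 z ζ ∂arcLength = 2 * Real.pi := by
  have h := InnerProductSpace.HarmonicContOnCl.circleAverage_poissonKernel_smul (R := 1)
    (w := z) (c := 0) (InnerProductSpace.harmonicContOnCl_const (c := (1 : ℝ))) (by simpa using hz)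
  rw [Real.circleAverage_def, intervalIntegral.integral_of_le Real.two_pi_pos.le] at h
  have h3 : ∀ θ : ℝ, circleMap 0 1 θ = Circle.exp θ := by
    intro θ; simp [circleMap, Circle.coe_exp]
  simp only [Pi.smul_apply', h3, smul_eq_mul, mul_one] at h
  have h4 : ∫ ζ : Circle, poissonKernel 0 z ζ ∂arcLength =
      ∫ θ in Ioc 0 (2 * Real.pi), poissonKernel 0 z (Circle.exp θ) :=
    integral_map Circle.exp.continuous.measurable.aemeasurable
      (continuous_poissonKernel hz).aestronglyMeasurable
  rw [h4]
  field_simp at h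
  linarith

/-- The differential of `z ↦ poissonKernel 0 z ζ`, which is the real part of multiplication by
`2ζ / (ζ - z)²`. -/
noncomputable def poissonKernelDeriv (z : ℂ) (ζ : Circle) : ℂ →L[ℝ] ℝ :=
  Complex.reCLM ∘L ContinuousLinearMap.mul ℝ ℂ (2 * (ζ : ℂ) / (ζ - z) ^ 2)

theorem norm_poissonKernelDeriv_le (z : ℂ) (ζ : Circle) :
    ‖poissonKernelDeriv z ζ‖ ≤ 2 / ‖(ζ : ℂ) - z‖ ^ 2 := by
  refine ContinuousLinearMap.opNorm_le_bound _ (by positivity) fun w => ?_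
  refine (Complex.abs_re_le_norm _).trans (le_of_eq ?_)
  simp [Circle.norm_coe]

theorem hasFDerivAt_poissonKernel {z : ℂ} (hz : ‖z‖ < 1) (ζ : Circle) :
    HasFDerivAt (fun w => poissonKernel 0 w ζ) (poissonKernelDeriv z ζ) z := by
  have h1 : HasDerivAt (fun w : ℂ => 2 * (ζ : ℂ) / (ζ - w) - 1)
      (2 * (ζ : ℂ) / (ζ - z) ^ 2) z := by
    have := ((hasDerivAt_id' z).const_sub (ζ : ℂ)).fun_inv (coe_sub_ne_zero hz ζ)
    have h2 := (this.const_mul (2 * (ζ : ℂ))).sub_const 1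
    simpa [div_eq_mul_inv] using h2
  have h3 := Complex.reCLM.hasFDerivAt.comp z (h1.hasFDerivAt.restrictScalars ℝ)
  have h4 : HasFDerivAt (fun w : ℂ => (2 * (ζ : ℂ) / (ζ - w) - 1).re)
      (poissonKernelDeriv z ζ) z := by
    refine h3.congr_fderiv ?_
    ext w
    simp [poissonKernelDeriv, mul_comm]
  refine h4.congr_of_eventuallyEq ?_
  filter_upwards [Metric.isOpen_ball.mem_nhds (show z ∈ Metric.ball (0 : ℂ) 1 by simpa using hz)]
    with w hw
  exact poissonKernel_eq_re (by simpa using hw) ζ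

theorem continuous_poissonKernelDeriv {z : ℂ} (hz : ‖z‖ < 1) :
    Continuous (poissonKernelDeriv z) := by
  have h1 : Continuous fun ζ : Circle => 2 * (ζ : ℂ) / (ζ - z) ^ 2 := by
    refine Continuous.div (by fun_prop) (by fun_prop) fun ζ => ?_
    exact pow_ne_zero _ (coe_sub_ne_zero hz ζ)
  have h2 := (ContinuousLinearMap.mul ℝ ℂ).continuous.comp h1
  exact ((ContinuousLinearMap.compL ℝ ℂ ℂ ℝ) Complex.reCLM).continuous.comp h2

theorem hasFDerivAt_integral_poissonKernel {g : Circle → ℂ} (hg : Continuous g) {z : ℂ}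
    (hz : ‖z‖ < 1) :
    HasFDerivAt (fun w => ∫ ζ : Circle, poissonKernel 0 w ζ • g ζ ∂arcLength)
      (∫ ζ : Circle, (poissonKernelDeriv z ζ).smulRight (g ζ) ∂arcLength) z := by
  set ε := (1 - ‖z‖) / 2 with hε
  have hε0 : 0 < ε := by rw [hε]; linarith
  have hball : ∀ w ∈ Metric.ball z ε, ‖w‖ < 1 - ε := by
    intro w hw
    have h1 := norm_sub_norm_le w z
    rw [Metric.mem_ball, dist_eq_norm] at hw
    linarith
  have hint : ∀ w : ℂ, ‖w‖ < 1 → Continuous fun ζ : Circle => poissonKernel 0 w ζ • g ζ :=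
    fun w hw => (continuous_poissonKernel hw).smul hg
  refine hasFDerivAt_integral_of_dominated_of_fderiv_le (𝕜 := ℝ)
    (F := fun w (ζ : Circle) => poissonKernel 0 w ζ • g ζ)
    (F' := fun w (ζ : Circle) => (poissonKernelDeriv w ζ).smulRight (g ζ))
    (bound := fun ζ => 2 / ε ^ 2 * ‖g ζ‖) (Metric.ball_mem_nhds z hε0) ?_
    (integrable_of_continuous (hint z hz)) ?_ ?_ ?_ ?_
  · filter_upwards [Metric.ball_mem_nhds z hε0] with w hw
    exact (hint w (by linarith [hball w hw])).aestronglyMeasurable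
  · have : Continuous fun ζ : Circle => (poissonKernelDeriv z ζ).smulRight (g ζ) := by
      have := continuous_poissonKernelDeriv hz
      fun_prop
    exact this.aestronglyMeasurable
  · refine Filter.Eventually.of_forall fun ζ w hw => ?_
    rw [ContinuousLinearMap.norm_smulRight_apply]
    gcongr
    refine (norm_poissonKernelDeriv_le w ζ).trans ?_
    gcongr
    linarith [one_sub_norm_le w ζ, hball w hw]
  · exact (integrable_of_continuous hg).norm.const_mul _
  · refine Filter.Eventually.of_forall fun ζ w hw => ?_
    exact (hasFDerivAt_poissonKernel (by linarith [hball w hw]) ζ).smul_const (g ζ)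

variable {φ}

theorem continuous_coe_homeo (φ : Circle ≃ₜ Circle) : Continuous fun ζ => (φ ζ : ℂ) :=
  continuous_subtype_val.comp φ.continuous

/-- The Poisson extension reproduces constants, so a constant may be subtracted. -/
theorem poissonExtension_eq (c : ℂ) {z : ℂ} (hz : ‖z‖ < 1) : poissonExtension φ z =
    c + (2 * Real.pi)⁻¹ • ∫ ζ : Circle, poissonKernel 0 z ζ • ((φ ζ : ℂ) - c) ∂arcLength := by
  have hc := continuous_poissonKernel hz
  have h1 : Integrable (fun ζ : Circle => poissonKernel 0 z ζ • (φ ζ : ℂ)) arcLength :=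
    integrable_of_continuous (hc.smul (continuous_coe_homeo φ))
  have h2 : Integrable (fun ζ : Circle => poissonKernel 0 z ζ • c) arcLength :=
    integrable_of_continuous (hc.smul continuous_const)
  simp only [smul_sub]
  rw [integral_sub h1 h2, integral_smul_const, integral_poissonKernel hz, smul_sub,
    inv_smul_smul₀ Real.two_pi_pos.ne', poissonExtension]
  ring

/-- Differentiation under the integral sign. The constant `c` is arbitrary because the mass of the
Poisson kernel does not depend on `z`. -/
theorem hasFDerivAt_poissonExtension (c : ℂ) {z : ℂ} (hz : ‖z‖ < 1) :
    HasFDerivAt (poissonExtension φ) ((2 * Real.pi)⁻¹ •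
      ∫ ζ : Circle, (poissonKernelDeriv z ζ).smulRight ((φ ζ : ℂ) - c) ∂arcLength) z := by
  have h1 := hasFDerivAt_integral_poissonKernel (g := fun ζ => (φ ζ : ℂ) - c)
    ((continuous_coe_homeo φ).sub continuous_const) hz
  refine ((h1.const_smul ((2 * Real.pi)⁻¹)).const_add c).congr_of_eventuallyEq ?_
  filter_upwards [Metric.isOpen_ball.mem_nhds (show z ∈ Metric.ball (0 : ℂ) 1 by simpa using hz)]
    with w hw
  exact poissonExtension_eq c (by simpa using hw)

/-- With `c = φ ζ₀` for the point `ζ₀` nearest to `z`, the numerator compensates the singularity of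
the kernel. -/
theorem enorm_fderiv_poissonExtension_le (c : ℂ) {z : ℂ} (hz : ‖z‖ < 1) :
    ‖fderiv ℝ (poissonExtension φ) z‖ₑ ≤
      ∫⁻ ζ : Circle, ENNReal.ofReal (‖(φ ζ : ℂ) - c‖ / ‖(ζ : ℂ) - z‖ ^ 2) ∂arcLength := by
  rw [(hasFDerivAt_poissonExtension c hz).fderiv, ← integral_smul]
  refine (enorm_integral_le_lintegral_enorm _).trans (lintegral_mono fun ζ => ?_)
  rw [← ofReal_norm]
  refine ENNReal.ofReal_le_ofReal ?_
  rw [norm_smul, ContinuousLinearMap.norm_smulRight_apply, Real.norm_eq_abs,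
    abs_of_pos (by positivity)]
  have h1 := norm_poissonKernelDeriv_le z ζ
  calc (2 * Real.pi)⁻¹ * (‖poissonKernelDeriv z ζ‖ * ‖(φ ζ : ℂ) - c‖)
      ≤ (2 * Real.pi)⁻¹ * (2 / ‖(ζ : ℂ) - z‖ ^ 2 * ‖(φ ζ : ℂ) - c‖) := by gcongr
    _ = Real.pi⁻¹ * (‖(φ ζ : ℂ) - c‖ / ‖(ζ : ℂ) - z‖ ^ 2) := by field_simp
    _ ≤ 1 * (‖(φ ζ : ℂ) - c‖ / ‖(ζ : ℂ) - z‖ ^ 2) := by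
      gcongr
      exact inv_le_one_of_one_le₀ (by linarith [Real.pi_gt_three])
    _ = _ := one_mul _

/-- The a priori bound for bounded harmonic functions, from the mass of the Poisson kernel. -/
theorem norm_fderiv_poissonExtension_le {z : ℂ} (hz : ‖z‖ < 1) :
    ‖fderiv ℝ (poissonExtension φ) z‖ ≤ 2 * Real.pi / (1 - ‖z‖) := by
  have hz' : 0 < 1 - ‖z‖ := by linarith
  have hz2 : 0 < 1 - ‖z‖ ^ 2 := by nlinarith [norm_nonneg z]
  have h1 : ‖fderiv ℝ (poissonExtension φ) z‖ₑ ≤ ENNReal.ofReal (2 * Real.pi / (1 - ‖z‖)) := by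
    refine (enorm_fderiv_poissonExtension_le 0 hz).trans ?_
    have h2 : ∀ ζ : Circle, ‖(φ ζ : ℂ) - 0‖ / ‖(ζ : ℂ) - z‖ ^ 2 =
        (1 - ‖z‖ ^ 2)⁻¹ * poissonKernel 0 z ζ := by
      intro ζ
      rw [poissonKernel_circle, sub_zero, Circle.norm_coe]
      field_simp
    simp only [h2]
    rw [← ofReal_integral_eq_lintegral_ofReal
      ((integrable_of_continuous (continuous_poissonKernel hz)).const_mul _)
      (Filter.Eventually.of_forall fun ζ => mul_nonneg (by positivity) (poissonKernel_nonneg hz ζ)),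
      integral_const_mul, integral_poissonKernel hz]
    refine ENNReal.ofReal_le_ofReal ?_
    rw [inv_mul_eq_div]
    gcongr
    nlinarith [norm_nonneg z]
  rw [← ofReal_norm] at h1
  exact (ENNReal.ofReal_le_ofReal_iff (by positivity)).1 h1

/-- The Poisson extension has the radial limit `φ ζ₀` at `ζ₀`. -/
theorem tendsto_poissonExtension (ζ₀ : Circle) :
    Filter.Tendsto (fun r : ℝ => poissonExtension φ (r * ζ₀)) (nhdsWithin 1 (Iio 1))
      (nhds (φ ζ₀ : ℂ)) := by
  rw [Metric.tendsto_nhds]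
  intro ε hε
  obtain ⟨δ, hδ, hφ⟩ := Metric.continuous_iff.1 (continuous_coe_homeo φ) ζ₀ (ε / 2) (by positivity)
  have hlim : Filter.Tendsto (fun r : ℝ => ε / 2 + 8 / δ ^ 2 * (1 - r ^ 2))
      (nhdsWithin 1 (Iio 1)) (nhds (ε / 2)) := by
    have : Continuous fun r : ℝ => ε / 2 + 8 / δ ^ 2 * (1 - r ^ 2) := by fun_prop
    have := (this.tendsto 1).mono_left (nhdsWithin_le_nhds (s := Iio 1))
    simpa using this
  have hev := hlim.eventually (gt_mem_nhds (show ε / 2 < ε by linarith))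
  have h0 : ∀ᶠ r : ℝ in nhdsWithin 1 (Iio 1), max 0 (1 - δ / 2) < r ∧ r < 1 := by
    have := Ioo_mem_nhdsLT (show max 0 (1 - δ / 2) < 1 by simp; linarith)
    exact this
  filter_upwards [hev, h0] with r hr1 hr2
  have hr0 : 0 < r := (le_max_left _ _).trans_lt hr2.1
  have hrδ : 1 - δ / 2 < r := (le_max_right _ _).trans_lt hr2.1
  have hz : ‖(r : ℂ) * ζ₀‖ = r := by simp [abs_of_pos hr0, Circle.norm_coe]
  have hz1 : ‖(r : ℂ) * ζ₀‖ < 1 := by rw [hz]; exact hr2.2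
  have hr3 : 0 < 1 - r ^ 2 := by nlinarith
  refine lt_of_le_of_lt ?_ hr1
  rw [dist_eq_norm, poissonExtension_eq (φ ζ₀ : ℂ) hz1, add_sub_cancel_left, norm_smul]
  have hpk := integrable_of_continuous (continuous_poissonKernel hz1)
  have hbound : ‖∫ ζ : Circle, poissonKernel 0 (r * ζ₀) ζ • ((φ ζ : ℂ) - φ ζ₀) ∂arcLength‖ ≤
      ∫ ζ : Circle, (ε / 2 * poissonKernel 0 (r * ζ₀) ζ + 8 / δ ^ 2 * (1 - r ^ 2)) ∂arcLength := by
    refine norm_integral_le_of_norm_le ((hpk.const_mul _).add (integrable_const _)) ?_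
    refine Filter.Eventually.of_forall fun ζ => ?_
    have hP := poissonKernel_nonneg hz1 ζ
    rw [norm_smul, Real.norm_eq_abs, abs_of_nonneg hP]
    rcases lt_or_ge (dist ζ ζ₀) δ with hd | hd
    · have := hφ ζ hd
      rw [dist_eq_norm] at this
      have h3 : 0 ≤ 8 / δ ^ 2 * (1 - r ^ 2) := by positivity
      nlinarith
    · have hd' : δ ≤ dist (ζ : ℂ) ζ₀ := hd
      rw [dist_eq_norm] at hd'
      have h4 : δ / 2 ≤ ‖(ζ : ℂ) - r * ζ₀‖ := by
        have h5 : ‖(ζ : ℂ) - ζ₀‖ ≤ ‖(ζ : ℂ) - r * ζ₀‖ + ‖(r : ℂ) * ζ₀ - ζ₀‖ :=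
          norm_sub_le_norm_sub_add_norm_sub _ _ _
        have h6 : ‖(r : ℂ) * ζ₀ - ζ₀‖ = 1 - r := by
          rw [← sub_one_mul, norm_mul, Circle.norm_coe, mul_one, ← Complex.ofReal_one,
            ← Complex.ofReal_sub, Complex.norm_real, Real.norm_eq_abs, abs_of_neg (by linarith)]
          ring
        linarith
      have h7 : poissonKernel 0 (r * ζ₀) ζ ≤ 4 / δ ^ 2 * (1 - r ^ 2) := by
        rw [poissonKernel_circle, hz]
        calc (1 - r ^ 2) / ‖(ζ : ℂ) - r * ζ₀‖ ^ 2 ≤ (1 - r ^ 2) / (δ / 2) ^ 2 := by gcongr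
          _ = _ := by field_simp; norm_num
      have h8 : ‖(φ ζ : ℂ) - φ ζ₀‖ ≤ 2 := by
        refine (norm_sub_le _ _).trans ?_
        rw [Circle.norm_coe, Circle.norm_coe]; norm_num
      calc _ ≤ 4 / δ ^ 2 * (1 - r ^ 2) * 2 := by gcongr
        _ = 8 / δ ^ 2 * (1 - r ^ 2) := by ring
        _ ≤ _ := by
          have : 0 ≤ ε / 2 * poissonKernel 0 (r * ζ₀) ζ := by positivity
          linarith
  rw [integral_add (hpk.const_mul _) (integrable_const _), integral_const_mul,
    integral_poissonKernel hz1, integral_const, measureReal_def, arcLength_univ,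
    ENNReal.toReal_ofReal Real.two_pi_pos.le] at hbound
  rw [Real.norm_eq_abs, abs_of_pos (by positivity)]
  calc _ ≤ (2 * Real.pi)⁻¹ * (ε / 2 * (2 * Real.pi) +
        (2 * Real.pi) • (8 / δ ^ 2 * (1 - r ^ 2))) := by gcongr
    _ = _ := by
      rw [smul_eq_mul]
      field_simp

/-! ### Increments of the Poisson extension -/

theorem measurable_enorm_fderiv (φ : Circle → Circle) :
    Measurable fun z => ‖fderiv ℝ (poissonExtension φ) z‖ₑ :=
  (measurable_fderiv ℝ _).enorm

/-- The increment of the Poisson extension along a path of speed at most one in a smaller disc is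
at most the integral of the norm of the differential. -/
theorem enorm_poissonExtension_sub_le {γ γ' : ℝ → ℂ} {a b R : ℝ} (hab : a ≤ b) (hR : R < 1)
    (hγ : ∀ t, HasDerivAt γ (γ' t) t) (hγ' : Continuous γ') (hspeed : ∀ t, ‖γ' t‖ ≤ 1)
    (hmem : ∀ t ∈ Icc a b, ‖γ t‖ ≤ R) :
    ‖poissonExtension φ (γ b) - poissonExtension φ (γ a)‖ₑ ≤
      ∫⁻ t in Ioc a b, ‖fderiv ℝ (poissonExtension φ) (γ t)‖ₑ := by
  set H := poissonExtension φ with hH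
  have hγc : Continuous γ := continuous_iff_continuousAt.2 fun t => (hγ t).continuousAt
  have hder : ∀ t ∈ uIcc a b, HasDerivAt (fun t => H (γ t)) (fderiv ℝ H (γ t) (γ' t)) t := by
    intro t ht
    rw [uIcc_of_le hab] at ht
    have h1 : DifferentiableAt ℝ H (γ t) :=
      (hasFDerivAt_poissonExtension 0 ((hmem t ht).trans_lt hR)).differentiableAt
    exact h1.hasFDerivAt.comp_hasDerivAt t (hγ t)
  have hle : ∀ t, ‖fderiv ℝ H (γ t) (γ' t)‖ ≤ ‖fderiv ℝ H (γ t)‖ := fun t =>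
    (ContinuousLinearMap.le_opNorm _ _).trans
      (mul_le_of_le_one_right (norm_nonneg _) (hspeed t))
  have hmeas : Measurable fun t => fderiv ℝ H (γ t) (γ' t) := by
    have h1 : Measurable fun t => fderiv ℝ H (γ t) := (measurable_fderiv ℝ H).comp hγc.measurable
    exact (ContinuousLinearMap.apply ℝ ℂ).continuous₂.measurable.comp
      (hγ'.measurable.prodMk h1)
  have hint : IntervalIntegrable (fun t => fderiv ℝ H (γ t) (γ' t)) volume a b := by
    rw [intervalIntegrable_iff_integrableOn_Ioc_of_le hab]
    refine Measure.integrableOn_of_bounded (M := 2 * Real.pi / (1 - R)) (by simp)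
      hmeas.aestronglyMeasurable ?_
    filter_upwards [ae_restrict_mem measurableSet_Ioc] with t ht
    have h2 := hmem t (Ioc_subset_Icc_self ht)
    refine (hle t).trans ((norm_fderiv_poissonExtension_le (h2.trans_lt hR)).trans ?_)
    have : 0 < 1 - R := by linarith
    gcongr
  rw [← intervalIntegral.integral_eq_sub_of_hasDerivAt hder hint,
    intervalIntegral.integral_of_le hab]
  refine (enorm_integral_le_lintegral_enorm _).trans (lintegral_mono fun t => ?_)
  rw [← ofReal_norm, ← ofReal_norm]
  exact ENNReal.ofReal_le_ofReal (hle t)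

/-- The increment along a radius up to the boundary, where the radial limit is the value of `φ`. -/
theorem enorm_poissonExtension_radial_le (ζ : Circle) {R : ℝ} (hR0 : 0 ≤ R) (hR : R < 1) :
    ‖(φ ζ : ℂ) - poissonExtension φ (R * ζ)‖ₑ ≤
      ∫⁻ r in Ioo R 1, ‖fderiv ℝ (poissonExtension φ) (r * ζ)‖ₑ := by
  have hlim : Filter.Tendsto
      (fun r : ℝ => ‖poissonExtension φ (r * ζ) - poissonExtension φ (R * ζ)‖ₑ)
      (nhdsWithin 1 (Iio 1)) (nhds ‖(φ ζ : ℂ) - poissonExtension φ (R * ζ)‖ₑ) :=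
    ((tendsto_poissonExtension ζ).sub_const _).enorm
  refine le_of_tendsto hlim ?_
  filter_upwards [Ioo_mem_nhdsLT hR] with r hr
  have hd : ∀ t : ℝ, HasDerivAt (fun t : ℝ => (t : ℂ) * ζ) (ζ : ℂ) t := fun t => by
    simpa using (Complex.ofRealCLM.hasDerivAt (x := t)).mul_const (ζ : ℂ)
  refine (enorm_poissonExtension_sub_le (γ := fun t : ℝ => (t : ℂ) * ζ) (γ' := fun _ => (ζ : ℂ))
    hr.1.le hr.2 hd continuous_const (fun t => by simp [Circle.norm_coe]) fun t ht => ?_).trans ?_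
  · simpa [abs_of_nonneg (hR0.trans ht.1), Circle.norm_coe] using ht.2
  · exact lintegral_mono_set fun t ht => ⟨ht.1, ht.2.trans_lt hr.2⟩

theorem enorm_poissonExtension_arc_le (ζ : Circle) {R t : ℝ} (hR0 : 0 ≤ R) (hR : R < 1)
    (ht : 0 ≤ t) :
    ‖poissonExtension φ (R * (Circle.exp t * ζ : Circle)) - poissonExtension φ (R * ζ)‖ₑ ≤
      ∫⁻ τ in Ioc 0 t, ‖fderiv ℝ (poissonExtension φ) (R * (Circle.exp τ * ζ : Circle))‖ₑ := by
  have hd : ∀ τ : ℝ, HasDerivAt (fun τ : ℝ => (R : ℂ) * (Circle.exp τ * ζ : Circle))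
      ((R : ℂ) * (Circle.exp τ * Complex.I * ζ)) τ := by
    intro τ
    have h1 : HasDerivAt (fun τ : ℝ => Complex.exp (τ * Complex.I))
        (Complex.exp (τ * Complex.I) * (1 * Complex.I)) τ :=
      ((Complex.ofRealCLM.hasDerivAt (x := τ)).mul_const Complex.I).cexp
    simpa [Circle.coe_exp] using (h1.mul_const (ζ : ℂ)).const_mul (R : ℂ)
  have := enorm_poissonExtension_sub_le (φ := φ)
    (γ := fun τ : ℝ => (R : ℂ) * (Circle.exp τ * ζ : Circle))
    (γ' := fun τ => (R : ℂ) * (Circle.exp τ * Complex.I * ζ)) ht hR hd (by fun_prop)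
    (fun τ => by simp [abs_of_nonneg hR0, hR.le, Circle.norm_coe])
    (fun τ _ => by simp [abs_of_nonneg hR0, Circle.norm_coe])
  simpa using this

/-! ### Logarithmic weights -/

/-- Comparable quantities have comparable powers, whatever the sign of the exponent. -/
theorem rpow_le_of_comparable {P L A : ℝ} (l : ℝ) (hP : 0 < P) (hL : 0 < L) (hA : 1 ≤ A)
    (h1 : P ≤ A * L) (h2 : L ≤ A * P) : P ^ l ≤ A ^ |l| * L ^ l := by
  have hA0 : 0 < A := by linarith
  rcases le_total 0 l with hl | hl
  · rw [abs_of_nonneg hl, ← Real.mul_rpow hA0.le hL.le]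
    exact Real.rpow_le_rpow hP.le h1 hl
  · rw [abs_of_nonpos hl, Real.rpow_neg hA0.le, ← Real.inv_rpow hA0.le,
      ← Real.mul_rpow (by positivity) hL.le]
    refine Real.rpow_le_rpow_of_nonpos (by positivity) ?_ hl
    rw [inv_mul_le_iff₀ hA0]
    exact h2

theorem log_two_le_log_two_div {s : ℝ} (h0 : 0 < s) (h1 : s ≤ 1) :
    Real.log 2 ≤ Real.log (2 / s) := by
  refine Real.log_le_log (by norm_num) ?_
  rw [le_div_iff₀ h0]
  linarith

theorem log_two_div_pos {s : ℝ} (h0 : 0 < s) (h1 : s ≤ 1) : 0 < Real.log (2 / s) :=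
  (Real.log_pos (by norm_num)).trans_le (log_two_le_log_two_div h0 h1)

/-- The weight `log^l(2 / s)` varies more slowly than the power `s^{1/8}`, in both directions. -/
theorem exists_log_rpow_comparison (l : ℝ) : ∃ C : ℝ, 0 < C ∧ ∀ s t : ℝ, 0 < s → s ≤ t → t ≤ 1 →
    Real.log (2 / s) ^ l ≤ C * Real.log (2 / t) ^ l * (t / s) ^ (1 / 8 : ℝ) ∧
    Real.log (2 / t) ^ l ≤ C * Real.log (2 / s) ^ l * (t / s) ^ (1 / 8 : ℝ) := by
  set m := |l| with hm
  have hm0 : 0 ≤ m := abs_nonneg l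
  set ε : ℝ := 1 / (8 * (m + 1)) with hε
  have hε0 : 0 < ε := by positivity
  refine ⟨(1 + 2 / ε) ^ m, by positivity, fun s t hs hst ht => ?_⟩
  have ht0 : 0 < t := hs.trans_le hst
  set a := Real.log (2 / s) with ha
  set b := Real.log (2 / t) with hb
  set y := t / s with hy
  have hy1 : 1 ≤ y := (one_le_div hs).2 hst
  have hb0 : 0 < b := log_two_div_pos ht0 ht
  have hb2 : 1 / 2 ≤ b := by
    have := log_two_le_log_two_div ht0 ht
    linarith [Real.log_two_gt_d9]
  have hab : a = b + Real.log y := by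
    rw [ha, hb, hy, Real.log_div two_ne_zero hs.ne', Real.log_div two_ne_zero ht0.ne',
      Real.log_div ht0.ne' hs.ne']
    ring
  have hlog0 : 0 ≤ Real.log y := Real.log_nonneg hy1
  have ha0 : 0 < a := by rw [hab]; positivity
  have hA : (1 : ℝ) ≤ 1 + 2 * Real.log y := by linarith
  have h1 : a ≤ (1 + 2 * Real.log y) * b := by rw [hab]; nlinarith
  have h2 : b ≤ (1 + 2 * Real.log y) * a := by nlinarith
  have hkey : (1 + 2 * Real.log y) ^ m ≤ (1 + 2 / ε) ^ m * y ^ (1 / 8 : ℝ) := by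
    have h3 : 1 + 2 * Real.log y ≤ (1 + 2 / ε) * y ^ ε := by
      have h4 : Real.log y ≤ y ^ ε / ε := Real.log_le_rpow_div (by linarith) hε0
      have h5 : 1 ≤ y ^ ε := Real.one_le_rpow hy1 hε0.le
      calc 1 + 2 * Real.log y ≤ y ^ ε + 2 * (y ^ ε / ε) := by gcongr
        _ = _ := by ring
    calc (1 + 2 * Real.log y) ^ m ≤ ((1 + 2 / ε) * y ^ ε) ^ m :=
          Real.rpow_le_rpow (by linarith) h3 hm0
      _ = (1 + 2 / ε) ^ m * y ^ (ε * m) := by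
          rw [Real.mul_rpow (by positivity) (by positivity), ← Real.rpow_mul (by linarith)]
      _ ≤ _ := by
          gcongr
          rw [hε, one_div_mul_eq_div, div_le_div_iff₀ (by positivity) (by norm_num)]
          linarith
  constructor
  · calc a ^ l ≤ (1 + 2 * Real.log y) ^ m * b ^ l := rpow_le_of_comparable l ha0 hb0 hA h1 h2
      _ ≤ (1 + 2 / ε) ^ m * y ^ (1 / 8 : ℝ) * b ^ l := by gcongr
      _ = _ := by ring
  · calc b ^ l ≤ (1 + 2 * Real.log y) ^ m * a ^ l := rpow_le_of_comparable l hb0 ha0 hA h2 h1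
      _ ≤ (1 + 2 / ε) ^ m * y ^ (1 / 8 : ℝ) * a ^ l := by gcongr
      _ = _ := by ring

theorem exists_log_rpow_le (l : ℝ) : ∃ C : ℝ, 0 < C ∧ ∀ s : ℝ, 0 < s → s ≤ 1 →
    Real.log (2 / s) ^ l ≤ C * s ^ (-(1 / 8) : ℝ) := by
  obtain ⟨C, hC, h⟩ := exists_log_rpow_comparison l
  have h2 : 0 < Real.log 2 := Real.log_pos (by norm_num)
  refine ⟨C * Real.log 2 ^ l, by positivity, fun s hs hs1 => ?_⟩
  have := (h s 1 hs hs1 le_rfl).1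
  rwa [div_one, one_div s, Real.inv_rpow hs.le, ← Real.rpow_neg hs.le] at this

/-- For quantities `x = O(1 / s)` the weights `log^l(e + x)` and `log^l(2 / s)` against `x²` differ
by at most `s^{-3/4}`: either `x ≥ s^{-1/4}`, and the two logarithms are comparable, or `x²` is so
small that the weights do not matter. -/
theorem exists_sq_mul_log_comparison (l : ℝ) {B : ℝ} (hB : 0 < B) : ∃ C : ℝ, 0 < C ∧
    ∀ s x : ℝ, 0 < s → s ≤ 1 → 0 ≤ x → x ≤ B / s →
    x ^ 2 * Real.log (Real.exp 1 + x) ^ l ≤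
      C * (x ^ 2 * Real.log (2 / s) ^ l + s ^ (-(3 / 4) : ℝ)) ∧
    x ^ 2 * Real.log (2 / s) ^ l ≤
      C * (x ^ 2 * Real.log (Real.exp 1 + x) ^ l + s ^ (-(3 / 4) : ℝ)) := by
  obtain ⟨C₁, hC₁, h₁⟩ := exists_log_rpow_le |l|
  obtain ⟨C₂, hC₂, h₂⟩ := exists_log_rpow_le l
  have he : (1 : ℝ) ≤ Real.exp 1 := Real.one_le_exp (by norm_num)
  set A : ℝ := 5 + 2 * Real.log (Real.exp 1 + B) with hA
  have hlogB : 0 ≤ Real.log (Real.exp 1 + B) := Real.log_nonneg (by linarith)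
  have hA1 : 1 ≤ A := by linarith
  have hA0 : 0 < A := by linarith
  set C : ℝ := A ^ |l| + A ^ |l| * C₁ + C₂ with hC
  have hC0 : 0 < C := by positivity
  refine ⟨C, hC0, fun s x hs hs1 hx hxB => ?_⟩
  set P := Real.log (Real.exp 1 + x) with hP
  set L := Real.log (2 / s) with hL
  have hL0 : 0 < L := log_two_div_pos hs hs1
  have hL2 : 1 / 2 ≤ L := by
    have := log_two_le_log_two_div hs hs1
    linarith [Real.log_two_gt_d9]
  have hLs : L = Real.log 2 + Real.log s⁻¹ := by
    rw [hL, div_eq_mul_inv, Real.log_mul two_ne_zero (by positivity)]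
  have hls : 0 ≤ Real.log s⁻¹ := Real.log_nonneg (by rw [one_le_inv₀ hs]; exact hs1)
  have hP1 : 1 ≤ P := by
    rw [hP, Real.le_log_iff_exp_le (by positivity)]; linarith
  have hPL : P ≤ A * L := by
    have h3 : P ≤ Real.log (Real.exp 1 + B) + Real.log s⁻¹ := by
      rw [← Real.log_mul (by positivity) (by positivity)]
      refine Real.log_le_log (by positivity) ?_
      rw [div_eq_mul_inv] at hxB
      have : 1 ≤ s⁻¹ := (one_le_inv₀ hs).2 hs1
      nlinarith [Real.exp_pos 1]
    have : Real.log 2 ≥ 0 := Real.log_nonneg (by norm_num)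
    nlinarith
  have hs34 : 0 < s ^ (-(3 / 4) : ℝ) := by positivity
  have hLl : 0 < L ^ l := by positivity
  have hPl : 0 < P ^ l := by positivity
  rcases le_or_gt x (s ^ (-(1 / 4) : ℝ)) with hsmall | hbig
  · have hx2 : x ^ 2 ≤ s ^ (-(1 / 2) : ℝ) := by
      calc x ^ 2 ≤ (s ^ (-(1 / 4) : ℝ)) ^ 2 := by gcongr
        _ = _ := by rw [← Real.rpow_natCast, ← Real.rpow_mul hs.le]; norm_num
    have hmul : s ^ (-(1 / 2) : ℝ) * s ^ (-(1 / 8) : ℝ) ≤ s ^ (-(3 / 4) : ℝ) := by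
      rw [← Real.rpow_add hs]
      exact Real.rpow_le_rpow_of_exponent_ge hs hs1 (by norm_num)
    have hbound : ∀ W D : ℝ, 0 ≤ W → 0 ≤ D → W ≤ D * s ^ (-(1 / 8) : ℝ) → D ≤ C →
        x ^ 2 * W ≤ C * s ^ (-(3 / 4) : ℝ) := by
      intro W D hW hD hWD hDC
      calc x ^ 2 * W ≤ s ^ (-(1 / 2) : ℝ) * (D * s ^ (-(1 / 8) : ℝ)) := by gcongr
        _ = D * (s ^ (-(1 / 2) : ℝ) * s ^ (-(1 / 8) : ℝ)) := by ring
        _ ≤ C * s ^ (-(3 / 4) : ℝ) := by gcongr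
    have hPle : P ^ l ≤ A ^ |l| * C₁ * s ^ (-(1 / 8) : ℝ) := by
      calc P ^ l ≤ P ^ |l| := Real.rpow_le_rpow_of_exponent_le hP1 (le_abs_self l)
        _ ≤ (A * L) ^ |l| := Real.rpow_le_rpow (by linarith) hPL (abs_nonneg l)
        _ = A ^ |l| * L ^ |l| := Real.mul_rpow hA0.le hL0.le
        _ ≤ A ^ |l| * (C₁ * s ^ (-(1 / 8) : ℝ)) := by gcongr; exact h₁ s hs hs1
        _ = _ := by ring
    constructor
    · refine (hbound _ _ hPl.le (by positivity) hPle ?_).trans ?_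
      · rw [hC]; linarith [Real.rpow_nonneg hA0.le |l|]
      · gcongr
        have : 0 ≤ x ^ 2 * L ^ l := by positivity
        linarith
    · refine (hbound _ _ hLl.le hC₂.le (h₂ s hs hs1) ?_).trans ?_
      · rw [hC]
        have : 0 ≤ A ^ |l| + A ^ |l| * C₁ := by positivity
        linarith
      · gcongr
        have : 0 ≤ x ^ 2 * P ^ l := by positivity
        linarith
  · have hLP : L ≤ A * P := by
      have h3 : 1 / 4 * Real.log s⁻¹ ≤ P := by
        have h4 : Real.log (s ^ (-(1 / 4) : ℝ)) ≤ P :=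
          Real.log_le_log (by positivity) (by linarith)
        rw [Real.log_rpow hs] at h4
        rw [Real.log_inv]
        linarith
      have h5 : Real.log 2 ≤ 1 := by linarith [Real.log_two_lt_d9]
      nlinarith
    have h6 := rpow_le_of_comparable l (by linarith) hL0 hA1 hPL hLP
    have h7 := rpow_le_of_comparable l hL0 (by linarith) hA1 hLP hPL
    have hAC : A ^ |l| ≤ C := by
      rw [hC]
      have : 0 ≤ A ^ |l| * C₁ := by positivity
      linarith
    constructor
    · calc x ^ 2 * P ^ l ≤ x ^ 2 * (A ^ |l| * L ^ l) := by gcongr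
        _ = A ^ |l| * (x ^ 2 * L ^ l) := by ring
        _ ≤ C * (x ^ 2 * L ^ l + s ^ (-(3 / 4) : ℝ)) := by gcongr; linarith
    · calc x ^ 2 * L ^ l ≤ x ^ 2 * (A ^ |l| * P ^ l) := by gcongr
        _ = A ^ |l| * (x ^ 2 * P ^ l) := by ring
        _ ≤ C * (x ^ 2 * P ^ l + s ^ (-(3 / 4) : ℝ)) := by gcongr; linarith

/-- A discrete form of `N^{l+1} / (l+1) = ∫_0^N x^l dx`, up to the constant. For `l ≤ 0` every term
of the sum is at least `N^l`. -/
theorem rpow_add_one_le_sum {l : ℝ} (hl : -1 < l) {N : ℕ} (hN : 1 ≤ N) :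
    (N : ℝ) ^ (l + 1) ≤ (|l| + 1) * ∑ j ∈ Finset.Icc 1 N, (j : ℝ) ^ l := by
  rcases le_total 0 l with h0 | h0
  · rw [abs_of_nonneg h0]
    clear hN
    induction N with
    | zero => simp [Real.zero_rpow (by linarith : l + 1 ≠ 0)]
    | succ N ih =>
      rw [Finset.sum_Icc_succ_top (by omega), mul_add]
      refine le_trans ?_ (add_le_add_left ih _)
      push_cast
      -- Bernoulli's inequality in the form `N^{l+1} ≥ (N+1)^{l+1} (1 - (l+1)/(N+1))`
      have hb := one_add_mul_self_le_rpow_one_add (s := -1 / ((N : ℝ) + 1)) (p := l + 1)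
        (by rw [le_div_iff₀ (by positivity)]; linarith [Nat.cast_nonneg (α := ℝ) N]) (by linarith)
      have h1 : 1 + -1 / ((N : ℝ) + 1) = N / (N + 1) := by field_simp; ring
      rw [h1, Real.div_rpow (by positivity) (by positivity), le_div_iff₀ (by positivity)] at hb
      have h2 : ((N : ℝ) + 1) ^ (l + 1) = ((N : ℝ) + 1) ^ l * (N + 1) :=
        Real.rpow_add_one (by positivity) l
      rw [h2] at hb ⊢
      have h3 : (1 + (l + 1) * (-1 / ((N : ℝ) + 1))) * (((N : ℝ) + 1) ^ l * (N + 1)) =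
          ((N : ℝ) + 1) ^ l * (N + 1) - (l + 1) * ((N : ℝ) + 1) ^ l := by
        field_simp
        ring
      linarith
  · have hN0 : (0 : ℝ) < N := by exact_mod_cast hN
    have h1 : ∑ j ∈ Finset.Icc 1 N, (N : ℝ) ^ l ≤ ∑ j ∈ Finset.Icc 1 N, (j : ℝ) ^ l := by
      refine Finset.sum_le_sum fun j hj => ?_
      rw [Finset.mem_Icc] at hj
      exact Real.rpow_le_rpow_of_nonpos (by exact_mod_cast hj.1) (by exact_mod_cast hj.2) h0
    simp only [Finset.sum_const, Nat.card_Icc, Nat.add_sub_cancel, nsmul_eq_mul] at h1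
    rw [Real.rpow_add_one hN0.ne', mul_comm]
    have h2 : 0 ≤ (N : ℝ) * (N : ℝ) ^ l := by positivity
    nlinarith [abs_nonneg l]

theorem sum_Icc_le_tsum_pnat (f : ℕ → ℝ≥0∞) (N : ℕ) :
    ∑ j ∈ Finset.Icc 1 N, f j ≤ ∑' j : ℕ+, f j := by
  rw [tsum_pnat_eq_tsum_succ (f := f)]
  refine le_trans (le_of_eq ?_) (ENNReal.sum_le_tsum (Finset.range N))
  induction N with
  | zero => simp
  | succ N ih => rw [Finset.sum_Icc_succ_top (by omega), ih, Finset.sum_range_succ]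

/-- The power `|log d|^{l+1}` is controlled by the dyadic sum of `j^l` over the scales
`2^{-j} ≥ d`. -/
theorem exists_abs_log_rpow_le {l : ℝ} (hl : -1 < l) : ∃ C : ℝ, 0 < C ∧ ∀ d : ℝ, 0 ≤ d → d ≤ 2 →
    ENNReal.ofReal (|Real.log d| ^ (l + 1)) ≤ ENNReal.ofReal C * (1 + ∑' j : ℕ+,
      (Iic ((2 : ℝ) ^ (j : ℕ))⁻¹).indicator (fun _ => ENNReal.ofReal (((j : ℕ) : ℝ) ^ l)) d) := by
  set C : ℝ := 1 + 2 ^ (l + 1) * (|l| + 1) with hC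
  have hC1 : 1 ≤ C := by
    rw [hC]
    have : (0 : ℝ) ≤ 2 ^ (l + 1) * (|l| + 1) := by positivity
    linarith
  refine ⟨C, by linarith, fun d hd0 hd2 => ?_⟩
  have hsmall : |Real.log d| ≤ 1 → ENNReal.ofReal (|Real.log d| ^ (l + 1)) ≤
      ENNReal.ofReal C * (1 + ∑' j : ℕ+, (Iic ((2 : ℝ) ^ (j : ℕ))⁻¹).indicator
        (fun _ => ENNReal.ofReal (((j : ℕ) : ℝ) ^ l)) d) := by
    intro h
    calc ENNReal.ofReal (|Real.log d| ^ (l + 1)) ≤ ENNReal.ofReal C * 1 := by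
          rw [mul_one]
          exact ENNReal.ofReal_le_ofReal
            ((Real.rpow_le_one (abs_nonneg _) h (by linarith)).trans hC1)
      _ ≤ _ := by gcongr; exact le_self_add
  -- `d = 0` is harmless because of the convention `Real.log 0 = 0`
  rcases hd0.eq_or_lt with rfl | hd
  · exact hsmall (by simp)
  rcases le_or_gt 1 d with hd1 | hd1
  · refine hsmall ?_
    rw [abs_of_nonneg (Real.log_nonneg hd1)]
    have := Real.log_le_log hd hd2
    linarith [Real.log_two_lt_d9]
  obtain ⟨N, hN1, hN2⟩ := exists_nat_pow_near_of_lt_one hd hd1.le (y := (2⁻¹ : ℝ)) (by norm_num)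
    (by norm_num)
  have hlog : |Real.log d| ≤ N + 1 := by
    rw [abs_of_nonpos (Real.log_nonpos hd.le hd1.le)]
    have h1 := Real.log_le_log (by positivity) hN1.le
    rw [Real.log_pow, Real.log_inv] at h1
    push_cast at h1
    have h2 : Real.log 2 ≤ 1 := by linarith [Real.log_two_lt_d9]
    nlinarith [Nat.cast_nonneg (α := ℝ) N]
  rcases Nat.eq_zero_or_pos N with rfl | hN
  · exact hsmall (by simpa using hlog)
  have hN' : (1 : ℝ) ≤ N := by exact_mod_cast hN
  calc ENNReal.ofReal (|Real.log d| ^ (l + 1))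
      ≤ ENNReal.ofReal (C * ∑ j ∈ Finset.Icc 1 N, (j : ℝ) ^ l) := by
        refine ENNReal.ofReal_le_ofReal ?_
        calc |Real.log d| ^ (l + 1) ≤ (2 * N) ^ (l + 1) :=
              Real.rpow_le_rpow (abs_nonneg _) (by linarith) (by linarith)
          _ = 2 ^ (l + 1) * (N : ℝ) ^ (l + 1) := Real.mul_rpow (by norm_num) (by positivity)
          _ ≤ 2 ^ (l + 1) * ((|l| + 1) * ∑ j ∈ Finset.Icc 1 N, (j : ℝ) ^ l) := by
            gcongr; exact rpow_add_one_le_sum hl hN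
          _ = 2 ^ (l + 1) * (|l| + 1) * ∑ j ∈ Finset.Icc 1 N, (j : ℝ) ^ l := by ring
          _ ≤ _ := by
            gcongr
            rw [hC]; linarith
    _ = ENNReal.ofReal C * ∑ j ∈ Finset.Icc 1 N, ENNReal.ofReal ((j : ℝ) ^ l) := by
        rw [ENNReal.ofReal_mul (by linarith), ENNReal.ofReal_sum_of_nonneg fun j _ => by positivity]
    _ ≤ _ := by
        gcongr
        refine le_trans ?_ le_add_self
        refine le_trans (Finset.sum_le_sum fun j hj => ?_) (sum_Icc_le_tsum_pnat (fun j =>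
          (Iic ((2 : ℝ) ^ j)⁻¹).indicator (fun _ => ENNReal.ofReal ((j : ℝ) ^ l)) d) N)
        rw [Finset.mem_Icc] at hj
        have hmem : d ∈ Iic ((2 : ℝ) ^ j)⁻¹ := by
          refine mem_Iic.2 (hN2.trans ?_)
          rw [← inv_pow]
          exact pow_le_pow_of_le_one (by norm_num) (by norm_num) hj.2
        exact (indicator_of_mem hmem (fun _ => ENNReal.ofReal ((j : ℝ) ^ l))).ge

theorem exists_dyadic_weight_comparison (l : ℝ) : ∃ C : ℝ, 0 < C ∧ ∀ j : ℕ, 1 ≤ j →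
    (j : ℝ) ^ l ≤ C * Real.log (2 / ((2 : ℝ) ^ j)⁻¹) ^ l ∧
    Real.log (2 / ((2 : ℝ) ^ j)⁻¹) ^ l ≤ C * (j : ℝ) ^ l := by
  refine ⟨2 ^ |l|, by positivity, fun j hj => ?_⟩
  have hj' : (1 : ℝ) ≤ j := by exact_mod_cast hj
  have h1 : Real.log (2 / ((2 : ℝ) ^ j)⁻¹) = (j + 1) * Real.log 2 := by
    rw [div_inv_eq_mul, ← pow_succ', Real.log_pow]
    push_cast
    ring
  have h2 : 1 / 2 ≤ Real.log 2 := by linarith [Real.log_two_gt_d9]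
  have h3 : Real.log 2 ≤ 1 := by linarith [Real.log_two_lt_d9]
  rw [h1]
  have h4 : (j : ℝ) ≤ 2 * ((j + 1) * Real.log 2) := by nlinarith
  have h5 : (j + 1) * Real.log 2 ≤ 2 * (j : ℝ) := by nlinarith
  exact ⟨rpow_le_of_comparable l (by linarith) (by positivity) one_le_two h4 h5,
    rpow_le_of_comparable l (by positivity) (by linarith) one_le_two h5 h4⟩

/-- The dyadic sum of `j^l 2^{j/2}` over the scales `2^{-j} > s` is dominated by its largest
terms. -/
theorem exists_tsum_weight_le (l : ℝ) : ∃ C : ℝ, 0 < C ∧ ∀ s : ℝ, 0 < s → s < 1 →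
    ∑' j : ℕ+, (Ioo 0 ((2 : ℝ) ^ (j : ℕ))⁻¹).indicator
      (fun _ => ENNReal.ofReal (((j : ℕ) : ℝ) ^ l * (2 : ℝ) ^ (((j : ℕ) : ℝ) / 2))) s ≤
    ENNReal.ofReal (C * (s ^ (-(1 / 2) : ℝ) * Real.log (2 / s) ^ l)) := by
  obtain ⟨C₁, hC₁, h₁⟩ := exists_dyadic_weight_comparison l
  obtain ⟨C₂, hC₂, h₂⟩ := exists_log_rpow_comparison l
  set q : ℝ := 2 ^ (3 / 8 : ℝ) with hq
  have hq1 : 1 < q := Real.one_lt_rpow (by norm_num) (by norm_num)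
  have hq0 : 0 < q - 1 := by linarith
  refine ⟨C₁ * C₂ * (q / (q - 1)), by positivity, fun s hs hs1 => ?_⟩
  obtain ⟨n, hn1, hn2⟩ := exists_nat_pow_near (x := s⁻¹) (y := (2 : ℝ))
    ((one_le_inv₀ hs).2 hs1.le) one_lt_two
  have hL0 := log_two_div_pos hs hs1.le
  set W := C₁ * C₂ * Real.log (2 / s) ^ l * s ^ (-(1 / 8) : ℝ) with hW
  have hW0 : 0 ≤ W := by positivity
  have hterm : ∀ j : ℕ+, (Ioo 0 ((2 : ℝ) ^ (j : ℕ))⁻¹).indicator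
      (fun _ => ENNReal.ofReal (((j : ℕ) : ℝ) ^ l * (2 : ℝ) ^ (((j : ℕ) : ℝ) / 2))) s ≤
      (fun j : ℕ => if j ∈ Finset.range (n + 1) then ENNReal.ofReal (W * q ^ j) else 0) j := by
    intro j
    by_cases hj : s ∈ Ioo 0 ((2 : ℝ) ^ (j : ℕ))⁻¹
    · have hjn : (j : ℕ) ∈ Finset.range (n + 1) := by
        rw [Finset.mem_range]
        have h3 : (2 : ℝ) ^ (j : ℕ) < 2 ^ (n + 1) := by
          refine lt_trans ?_ hn2
          rw [lt_inv_comm₀ (by positivity) hs]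
          exact hj.2
        exact (pow_lt_pow_iff_right₀ one_lt_two).1 h3
      rw [indicator_of_mem hj]
      simp only [hjn, if_true]
      refine ENNReal.ofReal_le_ofReal ?_
      have h4 := (h₁ j j.pos).1
      have h5 := (h₂ s _ hs hj.2.le (inv_le_one_of_one_le₀ (one_le_pow₀ one_le_two))).2
      have h6 : (((2 : ℝ) ^ (j : ℕ))⁻¹ / s) ^ (1 / 8 : ℝ) =
          2 ^ (-((j : ℕ) : ℝ) / 8) * s ^ (-(1 / 8) : ℝ) := by
        rw [Real.div_rpow (by positivity) hs.le, Real.rpow_neg hs.le, div_eq_mul_inv,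
          ← Real.rpow_natCast, ← Real.rpow_neg (by norm_num), ← Real.rpow_mul (by norm_num)]
        congr 2
        ring
      have h7 : q ^ (j : ℕ) = 2 ^ (-((j : ℕ) : ℝ) / 8) * 2 ^ (((j : ℕ) : ℝ) / 2) := by
        rw [hq, ← Real.rpow_natCast, ← Real.rpow_mul (by norm_num), ← Real.rpow_add (by norm_num)]
        congr 1
        ring
      rw [h6] at h5
      calc (((j : ℕ) : ℝ) ^ l * (2 : ℝ) ^ (((j : ℕ) : ℝ) / 2))
          ≤ (C₁ * (C₂ * Real.log (2 / s) ^ l * (2 ^ (-((j : ℕ) : ℝ) / 8) *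
            s ^ (-(1 / 8) : ℝ)))) * (2 : ℝ) ^ (((j : ℕ) : ℝ) / 2) := by
              gcongr
              exact h4.trans (by gcongr)
        _ = W * q ^ (j : ℕ) := by rw [h7, hW]; ring
    · rw [indicator_of_notMem hj]; exact zero_le
  calc _ ≤ ∑' j : ℕ+, (fun j : ℕ => if j ∈ Finset.range (n + 1) then
        ENNReal.ofReal (W * q ^ j) else 0) j := ENNReal.tsum_le_tsum hterm
    _ ≤ ∑' j : ℕ, if j ∈ Finset.range (n + 1) then ENNReal.ofReal (W * q ^ j) else 0 :=
      ENNReal.tsum_comp_le_tsum_of_injective PNat.coe_injective _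
    _ = ∑ j ∈ Finset.range (n + 1), ENNReal.ofReal (W * q ^ j) := by
      rw [tsum_eq_sum (s := Finset.range (n + 1)) fun j hj => if_neg hj]
      exact Finset.sum_congr rfl fun j hj => if_pos hj
    _ = ENNReal.ofReal (W * ∑ j ∈ Finset.range (n + 1), q ^ j) := by
      rw [Finset.mul_sum, ENNReal.ofReal_sum_of_nonneg fun j _ => by positivity]
    _ ≤ _ := by
      refine ENNReal.ofReal_le_ofReal ?_
      have h8 : ∑ j ∈ Finset.range (n + 1), q ^ j ≤ q / (q - 1) * s ^ (-(3 / 8) : ℝ) := by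
        rw [geom_sum_eq hq1.ne', div_mul_eq_mul_div]
        gcongr
        have h9 : q ^ n ≤ s ^ (-(3 / 8) : ℝ) := by
          calc q ^ n = ((2 : ℝ) ^ n) ^ (3 / 8 : ℝ) := by
                rw [hq, ← Real.rpow_natCast, ← Real.rpow_natCast, ← Real.rpow_mul (by norm_num),
                  ← Real.rpow_mul (by norm_num), mul_comm]
            _ ≤ (s⁻¹) ^ (3 / 8 : ℝ) := by gcongr
            _ = _ := by rw [Real.inv_rpow hs.le, Real.rpow_neg hs.le]
        rw [pow_succ']
        have : q * q ^ n ≤ q * s ^ (-(3 / 8) : ℝ) := by gcongr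
        linarith
      have h10 : s ^ (-(1 / 2) : ℝ) = s ^ (-(1 / 8) : ℝ) * s ^ (-(3 / 8) : ℝ) := by
        rw [← Real.rpow_add hs]; norm_num
      calc W * ∑ j ∈ Finset.range (n + 1), q ^ j ≤ W * (q / (q - 1) * s ^ (-(3 / 8) : ℝ)) := by
            gcongr
        _ = _ := by rw [h10, hW]; ring

theorem lintegral_rpow_Ioo {p d : ℝ} (hp : -1 < p) (hd : 0 ≤ d) :
    ∫⁻ s in Ioo 0 d, ENNReal.ofReal (s ^ p) = ENNReal.ofReal (d ^ (p + 1) / (p + 1)) := by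
  have hint := (intervalIntegral.intervalIntegrable_rpow' (a := 0) (b := d) hp)
  rw [intervalIntegrable_iff_integrableOn_Ioo_of_le hd] at hint
  rw [← ofReal_integral_eq_lintegral_ofReal hint]
  · rw [← integral_Ioc_eq_integral_Ioo, ← intervalIntegral.integral_of_le hd,
      integral_rpow (Or.inl hp), Real.zero_rpow (by linarith), sub_zero]
  · filter_upwards [ae_restrict_mem measurableSet_Ioo] with s hs
    exact Real.rpow_nonneg hs.1.le p

/-- A primitive of `log^l(2/s) / s` is `-log^{l+1}(2/s) / (l+1)`. -/
theorem lintegral_log_rpow_div_Ico {l d : ℝ} (hl : -1 < l) (hd : 0 < d) (hd1 : d ≤ 1) :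
    ∫⁻ s in Ico d 1, ENNReal.ofReal (Real.log (2 / s) ^ l / s) ≤
      ENNReal.ofReal (Real.log (2 / d) ^ (l + 1) / (l + 1)) := by
  have hpos : ∀ s ∈ Icc d 1, 0 < Real.log (2 / s) := fun s hs =>
    log_two_div_pos (hd.trans_le hs.1) hs.2
  have hder : ∀ s ∈ uIcc d 1, HasDerivAt (fun s => -(Real.log (2 / s) ^ (l + 1) / (l + 1)))
      (Real.log (2 / s) ^ l / s) s := by
    intro s hs
    rw [uIcc_of_le hd1] at hs
    have hs0 : 0 < s := hd.trans_le hs.1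
    have h1 : HasDerivAt (fun s => Real.log 2 - Real.log s) (-s⁻¹) s :=
      (Real.hasDerivAt_log hs0.ne').const_sub _
    have h2 : HasDerivAt (fun s => Real.log (2 / s)) (-s⁻¹) s := by
      refine h1.congr_of_eventuallyEq ?_
      filter_upwards [lt_mem_nhds hs0] with u hu
      exact Real.log_div two_ne_zero hu.ne'
    have h3 := ((h2.rpow_const (p := l + 1) (Or.inl (hpos s hs).ne')).div_const (l + 1)).neg
    refine h3.congr_deriv ?_
    have : l + 1 ≠ 0 := by linarith
    rw [add_sub_cancel_right]
    field_simp
  have hcont : ContinuousOn (fun s => Real.log (2 / s) ^ l / s) (uIcc d 1) := by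
    intro s hs
    rw [uIcc_of_le hd1] at hs
    have hs0 : 0 < s := hd.trans_le hs.1
    refine ContinuousAt.continuousWithinAt ?_
    refine ContinuousAt.div ?_ continuousAt_id hs0.ne'
    refine ContinuousAt.rpow_const ?_ (Or.inl (hpos s hs).ne')
    exact ContinuousAt.log (continuousAt_const.div continuousAt_id hs0.ne') (by positivity)
  have hint := hcont.intervalIntegrable (μ := volume)
  have hval := intervalIntegral.integral_eq_sub_of_hasDerivAt hder hint
  rw [intervalIntegrable_iff_integrableOn_Ico_of_le hd1] at hint
  rw [← ofReal_integral_eq_lintegral_ofReal hint]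
  · rw [integral_Ico_eq_integral_Ioo, ← integral_Ioc_eq_integral_Ioo,
      ← intervalIntegral.integral_of_le hd1, hval]
    refine ENNReal.ofReal_le_ofReal ?_
    have h4 : 0 ≤ Real.log (2 / 1) ^ (l + 1) / (l + 1) :=
      div_nonneg (Real.rpow_nonneg (hpos 1 ⟨hd1, le_rfl⟩).le _) (by linarith)
    linarith
  · filter_upwards [ae_restrict_mem measurableSet_Ico] with s hs
    exact div_nonneg (Real.rpow_nonneg (hpos s (Ico_subset_Icc_self hs)).le l)
      (hd.le.trans hs.1)

/-- Integrating the weight against the kernel `(s (s + d))^{-1/2}` produces one more logarithm. -/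
theorem exists_lintegral_kernel_le {l : ℝ} (hl : -1 < l) : ∃ C : ℝ, 0 < C ∧
    ∀ d : ℝ, 0 < d → d ≤ 2 →
    ∫⁻ s in Ioo (0 : ℝ) 1, ENNReal.ofReal
      (Real.log (2 / s) ^ l * (s ^ (-(1 / 2) : ℝ) * (s + d) ^ (-(1 / 2) : ℝ))) ≤
    ENNReal.ofReal (C * (1 + |Real.log d| ^ (l + 1))) := by
  obtain ⟨C₂, hC₂, h₂⟩ := exists_log_rpow_comparison l
  have hl1 : 0 < l + 1 := by linarith
  set C : ℝ := 2 ^ (l + 1) * (6 * C₂ + 1 / (l + 1)) with hC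
  have hC0 : 0 < C := by positivity
  have hsmall : ∀ d : ℝ, 0 < d → d ≤ 1 → ∫⁻ s in Ioo (0 : ℝ) 1, ENNReal.ofReal
      (Real.log (2 / s) ^ l * (s ^ (-(1 / 2) : ℝ) * (s + d) ^ (-(1 / 2) : ℝ))) ≤
      ENNReal.ofReal (C * (1 + |Real.log d| ^ (l + 1))) := by
    intro d hd hd1
    set L := Real.log (2 / d) with hL
    have hL0 : 0 < L := log_two_div_pos hd hd1
    have hL2 : 1 / 2 ≤ L := by
      have := log_two_le_log_two_div hd hd1
      linarith [Real.log_two_gt_d9]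
    have hsplit : Ioo (0 : ℝ) 1 = Ioo 0 d ∪ Ico d 1 := (Ioo_union_Ico_eq_Ioo hd hd1).symm
    have hI1 : ∫⁻ s in Ioo (0 : ℝ) d, ENNReal.ofReal
        (Real.log (2 / s) ^ l * (s ^ (-(1 / 2) : ℝ) * (s + d) ^ (-(1 / 2) : ℝ))) ≤
        ENNReal.ofReal (6 * C₂ * L ^ (l + 1)) := by
      calc _ ≤ ∫⁻ s in Ioo (0 : ℝ) d, ENNReal.ofReal (C₂ * L ^ l * d ^ (-(3 / 8) : ℝ)) *
            ENNReal.ofReal (s ^ (-(5 / 8) : ℝ)) := by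
            refine setLIntegral_mono' measurableSet_Ioo fun s hs => ?_
            have hs0 : 0 < s := hs.1
            rw [← ENNReal.ofReal_mul (by positivity)]
            refine ENNReal.ofReal_le_ofReal ?_
            have h3 := (h₂ s d hs0 hs.2.le hd1).1
            have h4 : (s + d) ^ (-(1 / 2) : ℝ) ≤ d ^ (-(1 / 2) : ℝ) :=
              Real.rpow_le_rpow_of_nonpos hd (by linarith) (by norm_num)
            have h5 : (d / s) ^ (1 / 8 : ℝ) = d ^ (1 / 8 : ℝ) * s ^ (-(1 / 8) : ℝ) := by
              rw [Real.div_rpow hd.le hs0.le, Real.rpow_neg hs0.le, div_eq_mul_inv]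
            have h6 : d ^ (-(3 / 8) : ℝ) = d ^ (1 / 8 : ℝ) * d ^ (-(1 / 2) : ℝ) := by
              rw [← Real.rpow_add hd]; norm_num
            have h7 : s ^ (-(5 / 8) : ℝ) = s ^ (-(1 / 8) : ℝ) * s ^ (-(1 / 2) : ℝ) := by
              rw [← Real.rpow_add hs0]; norm_num
            rw [h5] at h3
            calc _ ≤ (C₂ * L ^ l * (d ^ (1 / 8 : ℝ) * s ^ (-(1 / 8) : ℝ))) *
                  (s ^ (-(1 / 2) : ℝ) * d ^ (-(1 / 2) : ℝ)) := by gcongr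
              _ = _ := by rw [h6, h7]; ring
        _ = ENNReal.ofReal (C₂ * L ^ l * d ^ (-(3 / 8) : ℝ)) *
            ENNReal.ofReal (d ^ (3 / 8 : ℝ) / (3 / 8)) := by
            rw [lintegral_const_mul _ (by fun_prop), lintegral_rpow_Ioo (by norm_num) hd.le]
            norm_num
        _ = ENNReal.ofReal (C₂ * L ^ l * (8 / 3)) := by
            rw [← ENNReal.ofReal_mul (by positivity)]
            congr 1
            rw [Real.rpow_neg hd.le]
            field_simp
        _ ≤ _ := by
            refine ENNReal.ofReal_le_ofReal ?_
            rw [Real.rpow_add_one hL0.ne']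
            have : 0 ≤ C₂ * L ^ l := by positivity
            nlinarith
    have hI2 : ∫⁻ s in Ico d 1, ENNReal.ofReal
        (Real.log (2 / s) ^ l * (s ^ (-(1 / 2) : ℝ) * (s + d) ^ (-(1 / 2) : ℝ))) ≤
        ENNReal.ofReal (L ^ (l + 1) / (l + 1)) := by
      refine le_trans (setLIntegral_mono' measurableSet_Ico fun s hs => ?_)
        (lintegral_log_rpow_div_Ico hl hd hd1)
      refine ENNReal.ofReal_le_ofReal ?_
      have hs0 : 0 < s := hd.trans_le hs.1
      have hlog := log_two_div_pos hs0 hs.2.le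
      rw [div_eq_mul_inv (_ ^ l)]
      gcongr
      calc s ^ (-(1 / 2) : ℝ) * (s + d) ^ (-(1 / 2) : ℝ)
          ≤ s ^ (-(1 / 2) : ℝ) * s ^ (-(1 / 2) : ℝ) := by
            refine mul_le_mul_of_nonneg_left ?_ (by positivity)
            exact Real.rpow_le_rpow_of_nonpos hs0 (by linarith) (by norm_num)
        _ = s⁻¹ := by rw [← Real.rpow_add hs0, ← Real.rpow_neg_one]; norm_num
    rw [hsplit]
    refine (lintegral_union_le _ _ _).trans ((add_le_add hI1 hI2).trans ?_)
    rw [← ENNReal.ofReal_add (by positivity) (by positivity)]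
    refine ENNReal.ofReal_le_ofReal ?_
    have hx : L ≤ 1 + |Real.log d| := by
      rw [hL, Real.log_div two_ne_zero hd.ne']
      linarith [Real.log_two_lt_d9, neg_abs_le (Real.log d)]
    have hpow : L ^ (l + 1) ≤ 2 ^ (l + 1) * (1 + |Real.log d| ^ (l + 1)) := by
      set x := |Real.log d| with hxd
      have hx0 : 0 ≤ x := abs_nonneg _
      have h8 : L ^ (l + 1) ≤ (2 * max 1 x) ^ (l + 1) := by
        refine Real.rpow_le_rpow hL0.le ?_ hl1.le
        linarith [le_max_left 1 x, le_max_right 1 x]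
      rw [Real.mul_rpow (by norm_num) (by positivity)] at h8
      refine h8.trans ?_
      gcongr
      rcases max_choice 1 x with h | h
      · rw [h, Real.one_rpow]
        linarith [Real.rpow_nonneg hx0 (l + 1)]
      · rw [h]; linarith
    calc 6 * C₂ * L ^ (l + 1) + L ^ (l + 1) / (l + 1)
        = (6 * C₂ + 1 / (l + 1)) * L ^ (l + 1) := by ring
      _ ≤ (6 * C₂ + 1 / (l + 1)) * (2 ^ (l + 1) * (1 + |Real.log d| ^ (l + 1))) := by gcongr
      _ = _ := by rw [hC]; ring
  refine ⟨C, hC0, fun d hd hd2 => ?_⟩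
  rcases le_or_gt d 1 with hd1 | hd1
  · exact hsmall d hd hd1
  · calc _ ≤ ∫⁻ s in Ioo (0 : ℝ) 1, ENNReal.ofReal
          (Real.log (2 / s) ^ l * (s ^ (-(1 / 2) : ℝ) * (s + 1) ^ (-(1 / 2) : ℝ))) := by
          refine setLIntegral_mono' measurableSet_Ioo fun s hs => ENNReal.ofReal_le_ofReal ?_
          have hs0 : 0 < s := hs.1
          have hlog := log_two_div_pos hs0 hs.2.le
          gcongr _ * (_ * ?_)
          exact Real.rpow_le_rpow_of_nonpos (by linarith) (by linarith) (by norm_num)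
      _ ≤ _ := hsmall 1 one_pos le_rfl
      _ ≤ _ := by
          refine ENNReal.ofReal_le_ofReal ?_
          rw [Real.log_one, abs_zero, Real.zero_rpow hl1.ne', add_zero]
          gcongr
          linarith [Real.rpow_nonneg (abs_nonneg (Real.log d)) (l + 1)]

/-! ### Integrals of radial kernels over the circle -/

theorem lintegral_abs (f : ℝ → ℝ≥0∞) : ∫⁻ t : ℝ, f |t| = 2 * ∫⁻ t in Ioi (0 : ℝ), f t := by
  rw [← lintegral_add_compl _ (measurableSet_Ioi (a := (0 : ℝ))), compl_Ioi, two_mul]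
  congr 1
  · refine setLIntegral_congr_fun measurableSet_Ioi fun t ht => ?_
    rw [abs_of_pos ht]
  · have h := (Measure.measurePreserving_neg (volume : Measure ℝ)).setLIntegral_comp_preimage_emb
      (MeasurableEquiv.neg ℝ).measurableEmbedding f (Ici 0)
    rw [setLIntegral_congr Ioi_ae_eq_Ici, ← h]
    have h2 : Neg.neg ⁻¹' Ici (0 : ℝ) = Iic 0 := by ext; simp
    rw [h2]
    refine setLIntegral_congr_fun measurableSet_Iic fun t ht => ?_
    rw [abs_of_nonpos ht]

/-- A function on the circle bounded by a function of the angular distance to `ζ₀` is integrated in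
the angle, over each of the two half circles. -/
theorem lintegral_arcLength_le_radial {F : Circle → ℝ≥0∞} (hF : Measurable F) {f : ℝ → ℝ≥0∞}
    (ζ₀ : Circle) (h : ∀ t, |t| ≤ Real.pi → F (ζ₀ * Circle.exp t) ≤ f |t|) :
    ∫⁻ ζ, F ζ ∂arcLength ≤ 2 * ∫⁻ t in Ioi (0 : ℝ), f t := by
  have hF' : Measurable fun ζ => F (ζ₀ * ζ) := by fun_prop
  rw [← lintegral_arcLength_mul_left hF ζ₀, lintegral_arcLength hF' (-Real.pi), ← lintegral_abs]
  refine (setLIntegral_mono' measurableSet_Ioc fun t ht => h t ?_).trans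
    (setLIntegral_le_lintegral _ _)
  rw [abs_le]
  exact ⟨ht.1.le, by linarith [ht.2]⟩

theorem lintegral_Ioi_add_rpow {p a s : ℝ} (hp : p < -1) (h : 0 < s + a) :
    ∫⁻ t in Ioi a, ENNReal.ofReal ((s + t) ^ p) =
      ENNReal.ofReal (-(s + a) ^ (p + 1) / (p + 1)) := by
  have h1 := (measurePreserving_add_left (volume : Measure ℝ) s).setLIntegral_comp_preimage_emb
    (measurableEmbedding_addLeft s) (fun t => ENNReal.ofReal (t ^ p)) (Ioi (s + a))
  simp only [preimage_const_add_Ioi, add_sub_cancel_left] at h1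
  rw [h1, ← ofReal_integral_eq_lintegral_ofReal (integrableOn_Ioi_rpow_of_lt hp h),
    integral_Ioi_rpow_of_lt hp h]
  filter_upwards [ae_restrict_mem measurableSet_Ioi] with t ht
  exact Real.rpow_nonneg (h.le.trans (mem_Ioi.1 ht).le) p

theorem le_norm_exp_sub_ofReal {t r : ℝ} (ht : |t| ≤ Real.pi) (hr0 : 0 ≤ r) (hr1 : r ≤ 1) :
    (1 - r + |t|) / 5 ≤ ‖(Circle.exp t : ℂ) - r‖ := by
  have h1 := one_sub_norm_le (r : ℂ) (Circle.exp t)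
  rw [Complex.norm_real, Real.norm_eq_abs, abs_of_nonneg hr0] at h1
  have h2 := le_norm_exp_sub_one ht
  have h3 : ‖(Circle.exp t : ℂ) - 1‖ ≤ ‖(Circle.exp t : ℂ) - r‖ + ‖(r : ℂ) - 1‖ :=
    norm_sub_le_norm_sub_add_norm_sub _ _ _
  have h4 : ‖(r : ℂ) - 1‖ = 1 - r := by
    rw [← Complex.ofReal_one, ← Complex.ofReal_sub, Complex.norm_real, Real.norm_eq_abs,
      abs_of_nonpos (by linarith)]
    ring
  have h5 : 1 / 2 * |t| ≤ 2 / Real.pi * |t| := by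
    gcongr ?_ * _
    rw [div_le_div_iff₀ (by norm_num) Real.pi_pos]
    linarith [Real.pi_le_four]
  linarith

theorem norm_mul_exp_sub (ζ : Circle) (t r : ℝ) :
    ‖((ζ * Circle.exp t : Circle) : ℂ) - r * ζ‖ = ‖(Circle.exp t : ℂ) - r‖ := by
  rw [Circle.coe_mul, mul_comm, ← sub_mul, norm_mul, Circle.norm_coe, mul_one]

theorem norm_sub_mul_exp (ζ : Circle) (t r : ℝ) :
    ‖(ζ : ℂ) - r * (ζ * Circle.exp t : Circle)‖ = ‖(Circle.exp (-t) : ℂ) - r‖ := by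
  have h : (ζ : ℂ) - r * (ζ * Circle.exp t : Circle) =
      (ζ * Circle.exp t : Circle) * ((Circle.exp (-t) : ℂ) - r) := by
    have h1 : (Circle.exp t : ℂ) * Circle.exp (-t) = 1 := by
      rw [← Circle.coe_mul, ← Circle.exp_add]; simp
    rw [Circle.coe_mul]
    linear_combination (-(ζ : ℂ)) * h1
  rw [h, norm_mul, Circle.norm_coe, one_mul]

/-- The kernel `|ζ - r ζ₀|^{-2}` has mass `O((1 - r + ρ)^{-1})` outside the disc of radius `ρ`
around `ζ₀`. -/
theorem lintegral_tail_kernel_le (ζ₀ : Circle) {r ρ : ℝ} (hr0 : 0 ≤ r) (hr1 : r < 1)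
    (hρ : 0 ≤ ρ) :
    ∫⁻ ζ : Circle, {ζ : Circle | ρ ≤ ‖(ζ : ℂ) - ζ₀‖}.indicator
      (fun ζ => ENNReal.ofReal (‖(ζ : ℂ) - r * ζ₀‖ ^ (-2 : ℝ))) ζ ∂arcLength ≤
    ENNReal.ofReal (50 * (1 - r + ρ)⁻¹) := by
  have hs : 0 < 1 - r := by linarith
  have hm : MeasurableSet {ζ : Circle | ρ ≤ ‖(ζ : ℂ) - ζ₀‖} :=
    measurableSet_le (by fun_prop) (by fun_prop)
  have hF : Measurable ({ζ : Circle | ρ ≤ ‖(ζ : ℂ) - ζ₀‖}.indicator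
      (fun ζ => ENNReal.ofReal (‖(ζ : ℂ) - r * ζ₀‖ ^ (-2 : ℝ)))) :=
    Measurable.indicator (by fun_prop) hm
  refine (lintegral_arcLength_le_radial hF (f := (Ici ρ).indicator fun t =>
    ENNReal.ofReal 25 * ENNReal.ofReal ((1 - r + t) ^ (-2 : ℝ))) ζ₀ fun t ht => ?_).trans ?_
  · by_cases hmem : ζ₀ * Circle.exp t ∈ {ζ : Circle | ρ ≤ ‖(ζ : ℂ) - ζ₀‖}
    · have h1 : ρ ≤ |t| := by
        have h2 : ρ ≤ ‖((ζ₀ * Circle.exp t : Circle) : ℂ) - ζ₀‖ := hmem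
        have h3 := norm_mul_exp_sub ζ₀ t 1
        rw [Complex.ofReal_one, one_mul] at h3
        rw [h3] at h2
        exact h2.trans (norm_exp_sub_one_le t)
      rw [indicator_of_mem hmem, indicator_of_mem (mem_Ici.2 h1), norm_mul_exp_sub,
        ← ENNReal.ofReal_mul (by norm_num)]
      refine ENNReal.ofReal_le_ofReal ?_
      have h4 := le_norm_exp_sub_ofReal ht hr0 hr1.le
      have h5 : 0 < (1 - r + |t|) / 5 := by positivity
      refine (Real.rpow_le_rpow_of_nonpos h5 h4 (by norm_num)).trans (le_of_eq ?_)
      rw [Real.div_rpow (by positivity) (by norm_num), Real.rpow_neg (by norm_num : (0 : ℝ) ≤ 5)]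
      norm_num
      ring
    · rw [indicator_of_notMem hmem]; exact zero_le
  · calc 2 * ∫⁻ t in Ioi (0 : ℝ), (Ici ρ).indicator (fun t =>
          ENNReal.ofReal 25 * ENNReal.ofReal ((1 - r + t) ^ (-2 : ℝ))) t
        ≤ 2 * ∫⁻ t in Ici ρ, ENNReal.ofReal 25 * ENNReal.ofReal ((1 - r + t) ^ (-2 : ℝ)) := by
          refine mul_le_mul' le_rfl ?_
          rw [← lintegral_indicator measurableSet_Ici]
          exact setLIntegral_le_lintegral _ _
      _ = 2 * (ENNReal.ofReal 25 * ENNReal.ofReal ((1 - r + ρ)⁻¹)) := by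
          rw [lintegral_const_mul _ (by fun_prop), setLIntegral_congr Ioi_ae_eq_Ici.symm,
            lintegral_Ioi_add_rpow (by norm_num) (by positivity)]
          congr 3
          norm_num
          rw [Real.rpow_neg_one]
      _ = _ := by
          rw [← ENNReal.ofReal_mul (by norm_num), ← ENNReal.ofReal_ofNat,
            ← ENNReal.ofReal_mul (by norm_num)]
          congr 1
          ring

theorem lintegral_three_halves_kernel_le (u : Circle) {r : ℝ} (hr0 : 0 ≤ r) (hr1 : r < 1) :
    ∫⁻ ζ : Circle, ENNReal.ofReal (‖(u : ℂ) - r * ζ‖ ^ (-(3 / 2) : ℝ)) ∂arcLength ≤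
    ENNReal.ofReal (4 * 5 ^ (3 / 2 : ℝ) * (1 - r) ^ (-(1 / 2) : ℝ)) := by
  have hs : 0 < 1 - r := by linarith
  refine (lintegral_arcLength_le_radial (by fun_prop) (f := fun t =>
    ENNReal.ofReal (5 ^ (3 / 2 : ℝ)) * ENNReal.ofReal ((1 - r + t) ^ (-(3 / 2) : ℝ)))
    u fun t ht => ?_).trans ?_
  · rw [norm_sub_mul_exp, ← ENNReal.ofReal_mul (by positivity)]
    refine ENNReal.ofReal_le_ofReal ?_
    have h4 := le_norm_exp_sub_ofReal (t := -t) (by rwa [abs_neg]) hr0 hr1.le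
    rw [abs_neg] at h4
    have h5 : 0 < (1 - r + |t|) / 5 := by positivity
    refine (Real.rpow_le_rpow_of_nonpos h5 h4 (by norm_num)).trans (le_of_eq ?_)
    rw [Real.div_rpow (by positivity) (by norm_num), Real.rpow_neg (by norm_num : (0 : ℝ) ≤ 5),
      div_inv_eq_mul, mul_comm]
  · rw [lintegral_const_mul _ (by fun_prop),
      lintegral_Ioi_add_rpow (by norm_num) (by linarith), ← ENNReal.ofReal_mul (by positivity),
      ← ENNReal.ofReal_ofNat, ← ENNReal.ofReal_mul (by norm_num)]
    refine ENNReal.ofReal_le_ofReal (le_of_eq ?_)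
    norm_num
    ring

/-! ### From the logarithmic energy to the weighted Dirichlet energy -/

variable (φ)

/-- The differential of the Poisson extension is bounded by a Cauchy-type potential of the image
length measure. -/
theorem enorm_fderiv_le_potential (ζ₀ : Circle) {r : ℝ} (hr0 : 0 ≤ r) (hr1 : r < 1) :
    ‖fderiv ℝ (poissonExtension φ) (r * ζ₀)‖ₑ ≤
      ENNReal.ofReal 50 * ∫⁻ u : Circle, ENNReal.ofReal (‖(u : ℂ) - r * ζ₀‖⁻¹) ∂imageMeasure φ := by
  have hz : ‖(r : ℂ) * ζ₀‖ < 1 := by simpa [abs_of_nonneg hr0, Circle.norm_coe] using hr1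
  have hm : MeasurableSet {p : Circle × Circle | ‖(p.2 : ℂ) - ζ₀‖ ≤ ‖(p.1 : ℂ) - ζ₀‖} :=
    measurableSet_le (by fun_prop) (by fun_prop)
  have hjoint : Measurable ({p : Circle × Circle | ‖(p.2 : ℂ) - ζ₀‖ ≤ ‖(p.1 : ℂ) - ζ₀‖}.indicator
      fun p => ENNReal.ofReal (‖(p.1 : ℂ) - r * ζ₀‖ ^ (-2 : ℝ))) :=
    Measurable.indicator (by fun_prop) hm
  calc ‖fderiv ℝ (poissonExtension φ) (r * ζ₀)‖ₑ
      ≤ ∫⁻ ζ : Circle, ENNReal.ofReal (‖(φ ζ : ℂ) - φ ζ₀‖ / ‖(ζ : ℂ) - r * ζ₀‖ ^ 2) ∂arcLength :=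
        enorm_fderiv_poissonExtension_le _ hz
    _ ≤ ∫⁻ ζ : Circle, ∫⁻ u : Circle,
        {p : Circle × Circle | ‖(p.2 : ℂ) - ζ₀‖ ≤ ‖(p.1 : ℂ) - ζ₀‖}.indicator
          (fun p => ENNReal.ofReal (‖(p.1 : ℂ) - r * ζ₀‖ ^ (-2 : ℝ))) (ζ, u)
          ∂imageMeasure φ ∂arcLength := by
        refine lintegral_mono fun ζ => ?_
        have hsec : MeasurableSet {u : Circle | ‖(u : ℂ) - ζ₀‖ ≤ ‖(ζ : ℂ) - ζ₀‖} :=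
          measurableSet_le (by fun_prop) (by fun_prop)
        have h1 : ∀ u : Circle,
            {p : Circle × Circle | ‖(p.2 : ℂ) - ζ₀‖ ≤ ‖(p.1 : ℂ) - ζ₀‖}.indicator
            (fun p => ENNReal.ofReal (‖(p.1 : ℂ) - r * ζ₀‖ ^ (-2 : ℝ))) (ζ, u) =
            {u : Circle | ‖(u : ℂ) - ζ₀‖ ≤ ‖(ζ : ℂ) - ζ₀‖}.indicator
            (fun _ => ENNReal.ofReal (‖(ζ : ℂ) - r * ζ₀‖ ^ (-2 : ℝ))) u := fun u => rfl
        simp only [h1]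
        rw [lintegral_indicator_const hsec, div_eq_mul_inv, mul_comm,
          ENNReal.ofReal_mul (by positivity), Real.rpow_neg (norm_nonneg _), Real.rpow_two]
        gcongr
        exact ofReal_norm_sub_le_imageMeasure_ball φ ζ₀ ζ
    _ = ∫⁻ u : Circle, ∫⁻ ζ : Circle,
        {p : Circle × Circle | ‖(p.2 : ℂ) - ζ₀‖ ≤ ‖(p.1 : ℂ) - ζ₀‖}.indicator
          (fun p => ENNReal.ofReal (‖(p.1 : ℂ) - r * ζ₀‖ ^ (-2 : ℝ))) (ζ, u)
          ∂arcLength ∂imageMeasure φ := lintegral_lintegral_swap hjoint.aemeasurable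
    _ ≤ ∫⁻ u : Circle, ENNReal.ofReal 50 * ENNReal.ofReal (‖(u : ℂ) - r * ζ₀‖⁻¹)
          ∂imageMeasure φ := by
        refine lintegral_mono fun u => ?_
        refine (lintegral_tail_kernel_le ζ₀ (ρ := ‖(u : ℂ) - ζ₀‖) hr0 hr1
          (norm_nonneg _)).trans ?_
        rw [← ENNReal.ofReal_mul (by norm_num)]
        refine ENNReal.ofReal_le_ofReal ?_
        have h2 : 0 < ‖(u : ℂ) - r * ζ₀‖ := norm_pos_iff.2 (coe_sub_ne_zero hz u)
        have h3 : ‖(u : ℂ) - r * ζ₀‖ ≤ ‖(u : ℂ) - ζ₀‖ + ‖(ζ₀ : ℂ) - r * ζ₀‖ :=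
          norm_sub_le_norm_sub_add_norm_sub _ _ _
        have h4 : ‖(ζ₀ : ℂ) - r * ζ₀‖ = 1 - r := by
          rw [← one_sub_mul, norm_mul, Circle.norm_coe, mul_one, ← Complex.ofReal_one,
            ← Complex.ofReal_sub, Complex.norm_real, Real.norm_eq_abs, abs_of_pos (by linarith)]
        gcongr
        linarith
    _ = _ := lintegral_const_mul _ (by fun_prop)

/-- The larger of `a` and `b` is at least `(s + d) / 3`. For `a = |u - z|`, `b = |v - z|` this splits
off a factor that depends on `d = |u - v|` and not on `z`. -/
theorem inv_mul_inv_le {a b s d : ℝ} (hs : 0 < s) (hd : 0 ≤ d) (ha : s ≤ a) (hb : s ≤ b)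
    (hab : d ≤ a + b) : a⁻¹ * b⁻¹ ≤
      3 ^ (1 / 2 : ℝ) * (s + d) ^ (-(1 / 2) : ℝ) * (a ^ (-(3 / 2) : ℝ) + b ^ (-(3 / 2) : ℝ)) := by
  have key : ∀ a b : ℝ, s ≤ a → a ≤ b → d ≤ a + b → a⁻¹ * b⁻¹ ≤
      3 ^ (1 / 2 : ℝ) * (s + d) ^ (-(1 / 2) : ℝ) * a ^ (-(3 / 2) : ℝ) := by
    intro a b ha hab hd
    have ha0 : 0 < a := by linarith
    have hb0 : 0 < b := by linarith
    have h1 : b ^ (-(1 / 2) : ℝ) ≤ 3 ^ (1 / 2 : ℝ) * (s + d) ^ (-(1 / 2) : ℝ) := by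
      have h2 : b ^ (-(1 / 2) : ℝ) ≤ ((s + d) / 3) ^ (-(1 / 2) : ℝ) :=
        Real.rpow_le_rpow_of_nonpos (by positivity) (by linarith) (by norm_num)
      refine h2.trans (le_of_eq ?_)
      rw [Real.div_rpow (by positivity) (by norm_num), Real.rpow_neg (by norm_num : (0 : ℝ) ≤ 3),
        div_inv_eq_mul, mul_comm]
    have h3 : b⁻¹ = b ^ (-(1 / 2) : ℝ) * b ^ (-(1 / 2) : ℝ) := by
      rw [← Real.rpow_add hb0, ← Real.rpow_neg_one]; norm_num
    have h4 : a⁻¹ * a ^ (-(1 / 2) : ℝ) = a ^ (-(3 / 2) : ℝ) := by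
      rw [← Real.rpow_neg_one, ← Real.rpow_add ha0]; norm_num
    have h5 : b ^ (-(1 / 2) : ℝ) ≤ a ^ (-(1 / 2) : ℝ) :=
      Real.rpow_le_rpow_of_nonpos ha0 hab (by norm_num)
    calc a⁻¹ * b⁻¹ = b ^ (-(1 / 2) : ℝ) * (a⁻¹ * b ^ (-(1 / 2) : ℝ)) := by rw [h3]; ring
      _ ≤ 3 ^ (1 / 2 : ℝ) * (s + d) ^ (-(1 / 2) : ℝ) * (a⁻¹ * a ^ (-(1 / 2) : ℝ)) := by gcongr
      _ = _ := by rw [h4]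
  have ha0 : 0 < a := by linarith
  have hb0 : 0 < b := by linarith
  rcases le_total a b with h | h
  · refine (key a b ha h hab).trans ?_
    gcongr
    linarith [Real.rpow_nonneg hb0.le (-(3 / 2))]
  · rw [mul_comm a⁻¹]
    refine (key b a hb h (by linarith)).trans ?_
    gcongr
    linarith [Real.rpow_nonneg ha0.le (-(3 / 2))]

/-- The integral of `|Dh|²` over the circle of radius `1 - s`, for `h` the Poisson extension. -/
noncomputable def circleEnergy (s : ℝ) : ℝ≥0∞ :=
  ∫⁻ ζ : Circle, ‖fderiv ℝ (poissonExtension φ) ((1 - s : ℝ) * ζ)‖ₑ ^ 2 ∂arcLength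

theorem measurable_circleEnergy : Measurable (circleEnergy φ) := by
  have h := measurable_enorm_fderiv φ
  have h2 : Measurable fun p : ℝ × Circle =>
      ‖fderiv ℝ (poissonExtension φ) ((1 - p.1 : ℝ) * p.2)‖ₑ ^ 2 :=
    (h.comp (g := fun z => ‖fderiv ℝ (poissonExtension φ) z‖ₑ)
      (f := fun p : ℝ × Circle => ((1 - p.1 : ℝ) : ℂ) * p.2) (by fun_prop)).pow_const 2
  exact h2.lintegral_prod_right'

/-- The weighted Dirichlet energy in polar coordinates, with `s` the distance to the boundary. -/
theorem weightedEnergy_eq (l : ℝ) : weightedEnergy (poissonExtension φ) l =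
    ∫⁻ s in Ioo (0 : ℝ) 1, ENNReal.ofReal (1 - s) *
      (ENNReal.ofReal (Real.log (2 / s) ^ l) * circleEnergy φ s) := by
  have hmf := measurable_fderiv ℝ (poissonExtension φ)
  have hm : Measurable fun z : ℂ => ENNReal.ofReal
      (‖fderiv ℝ (poissonExtension φ) z‖ ^ 2 * Real.log (2 / (1 - ‖z‖)) ^ l) := by fun_prop
  rw [weightedEnergy, lintegral_ball_eq hm]
  have hsub := (Measure.measurePreserving_sub_left (volume : Measure ℝ) 1)
  have h1 := hsub.setLIntegral_comp_preimage_emb (MeasurableEquiv.subLeft (1 : ℝ)).measurableEmbedding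
    (fun r => ENNReal.ofReal r * ∫⁻ ζ : Circle, ENNReal.ofReal
      (‖fderiv ℝ (poissonExtension φ) (r * ζ)‖ ^ 2 *
        Real.log (2 / (1 - ‖(r : ℂ) * ζ‖)) ^ l) ∂arcLength) (Ioo 0 1)
  rw [← h1]
  simp only [preimage_const_sub_Ioo, sub_zero, sub_self]
  refine setLIntegral_congr_fun measurableSet_Ioo fun s hs => ?_
  congr 1
  rw [circleEnergy, ← lintegral_const_mul' _ _ ENNReal.ofReal_ne_top]
  refine lintegral_congr fun ζ => ?_
  have hlog := log_two_div_pos hs.1 hs.2.le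
  have h2 : 1 - ‖((1 - s : ℝ) : ℂ) * ζ‖ = s := by
    rw [norm_mul, Circle.norm_coe, Complex.norm_real, Real.norm_eq_abs,
      abs_of_pos (by linarith [hs.2])]
    ring
  rw [h2, mul_comm, ENNReal.ofReal_mul (by positivity), ENNReal.ofReal_pow (norm_nonneg _),
    ofReal_norm]

/-- Mean squares of the potential bound: Fubini's theorem reduces the claim to an integral of
`|u - z|⁻¹ |v - z|⁻¹` over the circle `|z| = 1 - s`. -/
theorem circleEnergy_le {s : ℝ} (hs : 0 < s) (hs1 : s ≤ 1) : circleEnergy φ s ≤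
    ENNReal.ofReal (50 ^ 2 * (3 ^ (1 / 2 : ℝ) * (8 * 5 ^ (3 / 2 : ℝ)))) *
      ∫⁻ u, ∫⁻ v, ENNReal.ofReal (s ^ (-(1 / 2) : ℝ) * (s + ‖(v : ℂ) - u‖) ^ (-(1 / 2) : ℝ))
        ∂imageMeasure φ ∂imageMeasure φ := by
  set ν := imageMeasure φ with hν
  set r : ℝ := 1 - s with hr
  have hr0 : 0 ≤ r := by linarith
  have hr1 : r < 1 := by linarith
  have hrs : 1 - r = s := by linarith
  have hz : ∀ ζ : Circle, ‖(r : ℂ) * ζ‖ = r := fun ζ => by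
    simp [abs_of_nonneg hr0, Circle.norm_coe]
  have hfix : ∀ u v : Circle, ∫⁻ ζ : Circle, ENNReal.ofReal (‖(u : ℂ) - r * ζ‖⁻¹) *
      ENNReal.ofReal (‖(v : ℂ) - r * ζ‖⁻¹) ∂arcLength ≤
      ENNReal.ofReal (3 ^ (1 / 2 : ℝ) * (8 * 5 ^ (3 / 2 : ℝ))) *
      ENNReal.ofReal (s ^ (-(1 / 2) : ℝ) * (s + ‖(v : ℂ) - u‖) ^ (-(1 / 2) : ℝ)) := by
    intro u v
    set d := ‖(v : ℂ) - u‖ with hd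
    set A := 3 ^ (1 / 2 : ℝ) * (s + d) ^ (-(1 / 2) : ℝ) with hA
    have hd0 : 0 ≤ d := norm_nonneg _
    have hA0 : 0 ≤ A := by positivity
    calc _ ≤ ∫⁻ ζ : Circle, ENNReal.ofReal A *
          (ENNReal.ofReal (‖(u : ℂ) - r * ζ‖ ^ (-(3 / 2) : ℝ)) +
            ENNReal.ofReal (‖(v : ℂ) - r * ζ‖ ^ (-(3 / 2) : ℝ))) ∂arcLength := by
          refine lintegral_mono fun ζ => ?_
          rw [← ENNReal.ofReal_mul (by positivity), ← ENNReal.ofReal_add (by positivity)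
            (by positivity), ← ENNReal.ofReal_mul hA0]
          refine ENNReal.ofReal_le_ofReal (inv_mul_inv_le hs hd0 ?_ ?_ ?_)
          · have := one_sub_norm_le (r * ζ) u
            rwa [hz, hrs] at this
          · have := one_sub_norm_le (r * ζ) v
            rwa [hz, hrs] at this
          · rw [hd, add_comm, ← norm_sub_rev (r * (ζ : ℂ)) u]
            exact norm_sub_le_norm_sub_add_norm_sub _ _ _
      _ ≤ ENNReal.ofReal A * (ENNReal.ofReal (4 * 5 ^ (3 / 2 : ℝ) * s ^ (-(1 / 2) : ℝ)) +
            ENNReal.ofReal (4 * 5 ^ (3 / 2 : ℝ) * s ^ (-(1 / 2) : ℝ))) := by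
          rw [lintegral_const_mul _ (by fun_prop), lintegral_add_left (by fun_prop)]
          have hu := lintegral_three_halves_kernel_le u hr0 hr1
          have hv := lintegral_three_halves_kernel_le v hr0 hr1
          rw [hrs] at hu hv
          gcongr
      _ = _ := by
          rw [← ENNReal.ofReal_add (by positivity) (by positivity), ← ENNReal.ofReal_mul hA0,
            ← ENNReal.ofReal_mul (by positivity)]
          congr 1
          rw [hA]
          ring
  calc circleEnergy φ s ≤ ∫⁻ ζ : Circle, ENNReal.ofReal (50 ^ 2) * ∫⁻ u, ∫⁻ v,
        ENNReal.ofReal (‖(u : ℂ) - r * ζ‖⁻¹) * ENNReal.ofReal (‖(v : ℂ) - r * ζ‖⁻¹)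
          ∂ν ∂ν ∂arcLength := by
        refine lintegral_mono fun ζ => ?_
        refine (pow_le_pow_left' (enorm_fderiv_le_potential φ ζ hr0 hr1) 2).trans (le_of_eq ?_)
        rw [mul_pow, ← ENNReal.ofReal_pow (by norm_num), lintegral_lintegral_mul (by fun_prop)
          (by fun_prop), sq (lintegral _ _)]
    _ = ENNReal.ofReal (50 ^ 2) * ∫⁻ u, ∫⁻ v, ∫⁻ ζ : Circle,
        ENNReal.ofReal (‖(u : ℂ) - r * ζ‖⁻¹) * ENNReal.ofReal (‖(v : ℂ) - r * ζ‖⁻¹)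
          ∂arcLength ∂ν ∂ν := by
        rw [lintegral_const_mul _ (by fun_prop), lintegral_lintegral_swap (by fun_prop)]
        congr 1
        refine lintegral_congr fun u => ?_
        rw [lintegral_lintegral_swap (by fun_prop)]
    _ ≤ ENNReal.ofReal (50 ^ 2) * ∫⁻ u, ∫⁻ v,
        ENNReal.ofReal (3 ^ (1 / 2 : ℝ) * (8 * 5 ^ (3 / 2 : ℝ))) *
        ENNReal.ofReal (s ^ (-(1 / 2) : ℝ) * (s + ‖(v : ℂ) - u‖) ^ (-(1 / 2) : ℝ)) ∂ν ∂ν := by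
        gcongr with u v
        exact hfix u v
    _ = _ := by
        have : ∀ u : Circle, ∫⁻ v, ENNReal.ofReal (3 ^ (1 / 2 : ℝ) * (8 * 5 ^ (3 / 2 : ℝ))) *
            ENNReal.ofReal (s ^ (-(1 / 2) : ℝ) * (s + ‖(v : ℂ) - u‖) ^ (-(1 / 2) : ℝ)) ∂ν =
            ENNReal.ofReal (3 ^ (1 / 2 : ℝ) * (8 * 5 ^ (3 / 2 : ℝ))) *
            ∫⁻ v, ENNReal.ofReal (s ^ (-(1 / 2) : ℝ) * (s + ‖(v : ℂ) - u‖) ^ (-(1 / 2) : ℝ)) ∂ν :=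
          fun u => lintegral_const_mul _ (by fun_prop)
        simp only [this]
        rw [lintegral_const_mul _ (by fun_prop), ← mul_assoc, ← ENNReal.ofReal_mul (by norm_num)]

theorem norm_circle_sub_le_two (u v : Circle) : ‖(v : ℂ) - u‖ ≤ 2 := by
  refine (norm_sub_le _ _).trans ?_
  rw [Circle.norm_coe, Circle.norm_coe]
  norm_num

/-- The change of variables by `φ` turns arc length into the image length measure. -/
theorem logEnergy_eq (l : ℝ) : logEnergy φ.symm l =
    ∫⁻ u, ∫⁻ v, ENNReal.ofReal (|Real.log ‖(v : ℂ) - u‖| ^ (l + 1))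
      ∂imageMeasure φ ∂imageMeasure φ := by
  rw [lintegral_imageMeasure φ (by fun_prop), logEnergy]
  refine lintegral_congr fun ξ => ?_
  rw [lintegral_imageMeasure φ (by fun_prop)]

/-- Integrate the bound for `circleEnergy` against the weight and exchange the integrals, so that
`exists_lintegral_kernel_le` applies for each pair of points. -/
theorem weightedEnergy_lt_top_of_logEnergy {l : ℝ} (hl : -1 < l)
    (h : logEnergy φ.symm l < ⊤) : weightedEnergy (poissonExtension φ) l < ⊤ := by
  obtain ⟨C, hC, hK⟩ := exists_lintegral_kernel_le hl
  set ν := imageMeasure φ with hν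
  set M : ℝ := 50 ^ 2 * (3 ^ (1 / 2 : ℝ) * (8 * 5 ^ (3 / 2 : ℝ))) with hM
  have hker : ∀ u : Circle, ∀ᵐ v : Circle ∂ν, ∫⁻ s in Ioo (0 : ℝ) 1,
      ENNReal.ofReal (Real.log (2 / s) ^ l) *
      ENNReal.ofReal (s ^ (-(1 / 2) : ℝ) * (s + ‖(v : ℂ) - u‖) ^ (-(1 / 2) : ℝ)) ≤
      ENNReal.ofReal C * (1 + ENNReal.ofReal (|Real.log ‖(v : ℂ) - u‖| ^ (l + 1))) := by
    intro u
    -- the diagonal, where `Real.log 0 = 0` would break the bound, is null as `ν` has no atoms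
    filter_upwards [Measure.ae_ne ν u] with v hv
    have hd : 0 < ‖(v : ℂ) - u‖ :=
      norm_pos_iff.2 (sub_ne_zero.2 fun h => hv (Circle.coe_injective h))
    have := hK _ hd (norm_circle_sub_le_two u v)
    rw [ENNReal.ofReal_mul hC.le, ENNReal.ofReal_add zero_le_one (by positivity),
      ENNReal.ofReal_one] at this
    refine le_trans (le_of_eq ?_) this
    refine setLIntegral_congr_fun measurableSet_Ioo fun s hs => ?_
    have := log_two_div_pos hs.1 hs.2.le
    exact (ENNReal.ofReal_mul (by positivity)).symm
  calc weightedEnergy (poissonExtension φ) l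
      ≤ ∫⁻ s in Ioo (0 : ℝ) 1, ENNReal.ofReal M * ∫⁻ u, ∫⁻ v,
        ENNReal.ofReal (Real.log (2 / s) ^ l) *
        ENNReal.ofReal (s ^ (-(1 / 2) : ℝ) * (s + ‖(v : ℂ) - u‖) ^ (-(1 / 2) : ℝ)) ∂ν ∂ν := by
        rw [weightedEnergy_eq]
        refine setLIntegral_mono' measurableSet_Ioo fun s hs => ?_
        have h1 : ENNReal.ofReal (1 - s) ≤ 1 := by
          rw [ENNReal.ofReal_le_one]; linarith [hs.1]
        have h2 : ∀ u : Circle, ∫⁻ v, ENNReal.ofReal (Real.log (2 / s) ^ l) * ENNReal.ofReal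
            (s ^ (-(1 / 2) : ℝ) * (s + ‖(v : ℂ) - u‖) ^ (-(1 / 2) : ℝ)) ∂ν =
            ENNReal.ofReal (Real.log (2 / s) ^ l) * ∫⁻ v, ENNReal.ofReal
            (s ^ (-(1 / 2) : ℝ) * (s + ‖(v : ℂ) - u‖) ^ (-(1 / 2) : ℝ)) ∂ν :=
          fun u => lintegral_const_mul _ (by fun_prop)
        simp only [h2]
        rw [lintegral_const_mul _ (by fun_prop)]
        calc _ ≤ 1 * (ENNReal.ofReal (Real.log (2 / s) ^ l) * (ENNReal.ofReal M * _)) := by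
              gcongr
              exact circleEnergy_le φ hs.1 hs.2.le
          _ = _ := by ring
    _ = ENNReal.ofReal M * ∫⁻ u, ∫⁻ v, ∫⁻ s in Ioo (0 : ℝ) 1,
        ENNReal.ofReal (Real.log (2 / s) ^ l) *
        ENNReal.ofReal (s ^ (-(1 / 2) : ℝ) * (s + ‖(v : ℂ) - u‖) ^ (-(1 / 2) : ℝ)) ∂volume ∂ν ∂ν := by
        rw [lintegral_const_mul _ (by fun_prop), lintegral_lintegral_swap (by fun_prop)]
        congr 1
        refine lintegral_congr fun u => ?_
        rw [lintegral_lintegral_swap (by fun_prop)]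
    _ ≤ ENNReal.ofReal M * ∫⁻ u, ∫⁻ v, ENNReal.ofReal C *
        (1 + ENNReal.ofReal (|Real.log ‖(v : ℂ) - u‖| ^ (l + 1))) ∂ν ∂ν := by
        exact mul_le_mul' le_rfl (lintegral_mono fun u => lintegral_mono_ae (hker u))
    _ = ENNReal.ofReal M * (ENNReal.ofReal C * (ν univ * ν univ + logEnergy φ.symm l)) := by
        have h3 : ∀ u : Circle, ∫⁻ v, ENNReal.ofReal C *
            (1 + ENNReal.ofReal (|Real.log ‖(v : ℂ) - u‖| ^ (l + 1))) ∂ν =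
            ENNReal.ofReal C * (ν univ +
              ∫⁻ v, ENNReal.ofReal (|Real.log ‖(v : ℂ) - u‖| ^ (l + 1)) ∂ν) := by
          intro u
          rw [lintegral_const_mul _ (by fun_prop), lintegral_add_left measurable_const,
            lintegral_one]
        simp only [h3]
        rw [lintegral_const_mul _ (by fun_prop), lintegral_add_left measurable_const,
          lintegral_const, logEnergy_eq]
    _ < ⊤ := by
        refine ENNReal.mul_lt_top ENNReal.ofReal_lt_top (ENNReal.mul_lt_top ENNReal.ofReal_lt_top ?_)
        exact ENNReal.add_lt_top.2 ⟨ENNReal.mul_lt_top (measure_lt_top _ _) (measure_lt_top _ _), h⟩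

/-! ### Dyadic square sums -/

/-- The sum `∑_k ℓ(φ(Γ_{j,k}))²` over the dyadic arcs of generation `j`. -/
noncomputable def dyadicSquareSum (j : ℕ) : ℝ≥0∞ :=
  ∑ k ∈ Finset.Icc 1 (2 ^ j), imageMeasure φ (dyadicArc j k) ^ 2

theorem imageLength_nonneg (j k : ℕ) : 0 ≤ imageLength φ j k := measureReal_nonneg

theorem ofReal_imageLength (j k : ℕ) :
    ENNReal.ofReal (imageLength φ j k) = imageMeasure φ (dyadicArc j k) := by
  rw [imageLength, ofReal_measureReal, imageMeasure_apply]

theorem dyadicSquareSum_eq (j : ℕ) : dyadicSquareSum φ j =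
    ENNReal.ofReal (∑ k ∈ Finset.Icc 1 (2 ^ j), imageLength φ j k ^ 2) := by
  rw [ENNReal.ofReal_sum_of_nonneg fun k _ => sq_nonneg _]
  refine Finset.sum_congr rfl fun k _ => ?_
  rw [ENNReal.ofReal_pow (imageLength_nonneg φ j k), ofReal_imageLength]

theorem dyadicSquareSum_lt_top (j : ℕ) : dyadicSquareSum φ j < ⊤ := by
  rw [dyadicSquareSum_eq]
  exact ENNReal.ofReal_lt_top

theorem dyadicEnergy_eq (l : ℝ) : dyadicEnergy φ l =
    ∑' j : ℕ+, ENNReal.ofReal (((j : ℕ) : ℝ) ^ l) * dyadicSquareSum φ j := by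
  rw [dyadicEnergy]
  refine tsum_congr fun j => ?_
  rw [dyadicSquareSum_eq, ENNReal.ofReal_mul (by positivity)]

/-! ### The Cauchy–Schwarz inequality -/

theorem sq_lintegral_mul_le {α : Type*} [MeasurableSpace α] (μ : Measure α) {f g : α → ℝ≥0∞}
    (hf : AEMeasurable f μ) (hg : AEMeasurable g μ) :
    (∫⁻ x, f x * g x ∂μ) ^ 2 ≤ (∫⁻ x, f x ^ 2 ∂μ) * ∫⁻ x, g x ^ 2 ∂μ := by
  have h := ENNReal.lintegral_mul_le_Lp_mul_Lq μ Real.HolderConjugate.two_two hf hg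
  have h2 := pow_le_pow_left' h 2
  refine h2.trans (le_of_eq ?_)
  have h3 : ∀ x : ℝ≥0∞, (x ^ (1 / 2 : ℝ)) ^ 2 = x := fun x => by
    rw [← ENNReal.rpow_natCast, ← ENNReal.rpow_mul]; norm_num
  rw [mul_pow, h3, h3]
  simp

theorem sq_lintegral_le {α : Type*} [MeasurableSpace α] (μ : Measure α) {f : α → ℝ≥0∞}
    (hf : AEMeasurable f μ) : (∫⁻ x, f x ∂μ) ^ 2 ≤ μ univ * ∫⁻ x, f x ^ 2 ∂μ := by
  simpa using sq_lintegral_mul_le μ (f := fun _ => 1) aemeasurable_const hf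

/-- The Cauchy–Schwarz inequality with weight `s^{1/2}`: the exponent leaves `s^{-1/2}` integrable at
`0` and still lets the sum over the dyadic scales `S` converge. -/
theorem sq_lintegral_Ioo_le {S : ℝ} (hS : 0 ≤ S) {f : ℝ → ℝ≥0∞} (hf : Measurable f) :
    (∫⁻ s in Ioo 0 S, f s) ^ 2 ≤ ENNReal.ofReal (2 * S ^ (1 / 2 : ℝ)) *
      ∫⁻ s in Ioo 0 S, ENNReal.ofReal (s ^ (1 / 2 : ℝ)) * f s ^ 2 := by
  have h := sq_lintegral_mul_le (volume.restrict (Ioo 0 S))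
    (f := fun s => ENNReal.ofReal (s ^ (-(1 / 4) : ℝ)))
    (g := fun s => ENNReal.ofReal (s ^ (1 / 4 : ℝ)) * f s) (by fun_prop) (by fun_prop)
  have h1 : ∫⁻ s in Ioo 0 S, ENNReal.ofReal (s ^ (-(1 / 4) : ℝ)) *
      (ENNReal.ofReal (s ^ (1 / 4 : ℝ)) * f s) = ∫⁻ s in Ioo 0 S, f s := by
    refine setLIntegral_congr_fun measurableSet_Ioo fun s hs => ?_
    have hs0 : 0 < s := hs.1
    change ENNReal.ofReal (s ^ (-(1 / 4) : ℝ)) * (ENNReal.ofReal (s ^ (1 / 4 : ℝ)) * f s) = f s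
    rw [← mul_assoc, ← ENNReal.ofReal_mul (by positivity), ← Real.rpow_add hs0]
    norm_num
  have h2 : ∫⁻ s in Ioo 0 S, ENNReal.ofReal (s ^ (-(1 / 4) : ℝ)) ^ 2 =
      ENNReal.ofReal (2 * S ^ (1 / 2 : ℝ)) := by
    have h3 : ∫⁻ s in Ioo 0 S, ENNReal.ofReal (s ^ (-(1 / 4) : ℝ)) ^ 2 =
        ∫⁻ s in Ioo 0 S, ENNReal.ofReal (s ^ (-(1 / 2) : ℝ)) := by
      refine setLIntegral_congr_fun measurableSet_Ioo fun s hs => ?_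
      have hs0 : 0 < s := hs.1
      change ENNReal.ofReal (s ^ (-(1 / 4) : ℝ)) ^ 2 = ENNReal.ofReal (s ^ (-(1 / 2) : ℝ))
      rw [← ENNReal.ofReal_pow (by positivity), ← Real.rpow_natCast, ← Real.rpow_mul hs0.le]
      norm_num
    rw [h3, lintegral_rpow_Ioo (by norm_num) hS]
    congr 1
    norm_num
    ring
  have h4 : ∫⁻ s in Ioo 0 S, (ENNReal.ofReal (s ^ (1 / 4 : ℝ)) * f s) ^ 2 =
      ∫⁻ s in Ioo 0 S, ENNReal.ofReal (s ^ (1 / 2 : ℝ)) * f s ^ 2 := by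
    refine setLIntegral_congr_fun measurableSet_Ioo fun s hs => ?_
    have hs0 : 0 < s := hs.1
    change (ENNReal.ofReal (s ^ (1 / 4 : ℝ)) * f s) ^ 2 = ENNReal.ofReal (s ^ (1 / 2 : ℝ)) * f s ^ 2
    rw [mul_pow, ← ENNReal.ofReal_pow (by positivity), ← Real.rpow_natCast, ← Real.rpow_mul hs0.le]
    norm_num
  rwa [h1, h2, h4] at h

theorem sq_add_three_le (x y z : ℝ≥0∞) : (x + y + z) ^ 2 ≤ 9 * (x ^ 2 + y ^ 2 + z ^ 2) := by
  set m := max x (max y z) with hm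
  have h1 : x + y + z ≤ 3 * m := by
    have hx : x ≤ m := le_max_left _ _
    have hy : y ≤ m := (le_max_left _ _).trans (le_max_right _ _)
    have hz : z ≤ m := (le_max_right _ _).trans (le_max_right _ _)
    calc x + y + z ≤ m + m + m := by gcongr
      _ = 3 * m := by ring
  have h2 : m ^ 2 ≤ x ^ 2 + y ^ 2 + z ^ 2 := by
    rcases max_choice x (max y z) with h | h
    · rw [hm, h, add_assoc]; exact le_self_add
    · rcases max_choice y z with h' | h'
      · rw [hm, h, h', add_right_comm]; exact le_add_self
      · rw [hm, h, h']; exact le_add_self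
  calc (x + y + z) ^ 2 ≤ (3 * m) ^ 2 := pow_le_pow_left' h1 2
    _ = 9 * m ^ 2 := by rw [mul_pow]; norm_num
    _ ≤ _ := by gcongr

/-! ### From the weighted Dirichlet energy to the dyadic sums -/

/-- Two boundary values are compared by going down a radius, along an arc of radius `1 - s`, and
up a radius. -/
theorem enorm_homeo_sub_le (ζ : Circle) {s S t : ℝ} (hs : 0 < s) (hsS : s ≤ S) (hS : S ≤ 1)
    (ht : 0 ≤ t) : ‖(φ (Circle.exp t * ζ) : ℂ) - φ ζ‖ₑ ≤
      (∫⁻ r in Ioo 0 S, ‖fderiv ℝ (poissonExtension φ) ((1 - r : ℝ) * ζ)‖ₑ) +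
      (∫⁻ r in Ioo 0 S, ‖fderiv ℝ (poissonExtension φ)
        ((1 - r : ℝ) * (Circle.exp t * ζ : Circle))‖ₑ) +
      ∫⁻ τ in Ioc 0 t, ‖fderiv ℝ (poissonExtension φ)
        ((1 - s : ℝ) * (Circle.exp τ * ζ : Circle))‖ₑ := by
  have hrad : ∀ ζ : Circle, ‖(φ ζ : ℂ) - poissonExtension φ ((1 - s : ℝ) * ζ)‖ₑ ≤
      ∫⁻ r in Ioo 0 S, ‖fderiv ℝ (poissonExtension φ) ((1 - r : ℝ) * ζ)‖ₑ := by
    intro ζ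
    refine (enorm_poissonExtension_radial_le ζ (by linarith) (by linarith)).trans ?_
    have h1 := (Measure.measurePreserving_sub_left (volume : Measure ℝ)
      1).setLIntegral_comp_preimage_emb (MeasurableEquiv.subLeft (1 : ℝ)).measurableEmbedding
      (fun r => ‖fderiv ℝ (poissonExtension φ) (r * ζ)‖ₑ) (Ioo (1 - s) 1)
    rw [← h1]
    simp only [preimage_const_sub_Ioo, sub_self, sub_sub_cancel]
    exact lintegral_mono_set (Ioo_subset_Ioo_right hsS)
  have harc := enorm_poissonExtension_arc_le (φ := φ) ζ (R := 1 - s) (by linarith) (by linarith) ht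
  set A := poissonExtension φ ((1 - s : ℝ) * ζ)
  set B := poissonExtension φ ((1 - s : ℝ) * (Circle.exp t * ζ : Circle))
  have hdecomp : (φ (Circle.exp t * ζ) : ℂ) - φ ζ =
      -((φ ζ : ℂ) - A) + ((φ (Circle.exp t * ζ) : ℂ) - B) + (B - A) := by ring
  rw [hdecomp]
  refine (enorm_add_le _ _).trans (add_le_add ((enorm_add_le _ _).trans (add_le_add ?_ ?_)) harc)
  · rw [enorm_neg]; exact hrad ζ
  · exact hrad _

/-- The mean square increment of `φ` at scale `S` is controlled by the energy of the Poisson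
extension in the annulus `1 - S < |z| < 1`, with a weight vanishing at the boundary. -/
theorem lintegral_sq_increment_le {S : ℝ} (hS : 0 < S) (hS1 : S ≤ 1) :
    ∫⁻ ζ, ‖(φ (Circle.exp (4 * Real.pi * S) * ζ) : ℂ) - φ ζ‖ₑ ^ 2 ∂arcLength ≤
      ENNReal.ofReal ((36 + 576 * Real.pi ^ 2) * S ^ (1 / 2 : ℝ)) *
        ∫⁻ s in Ioo 0 S, ENNReal.ofReal (s ^ (1 / 2 : ℝ)) * circleEnergy φ s := by
  set t := 4 * Real.pi * S with ht
  have ht0 : 0 ≤ t := by positivity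
  set g : ℂ → ℝ≥0∞ := fun z => ‖fderiv ℝ (poissonExtension φ) z‖ₑ with hg
  have hgm : Measurable g := measurable_enorm_fderiv φ
  set G := ∫⁻ s in Ioo 0 S, ENNReal.ofReal (s ^ (1 / 2 : ℝ)) * circleEnergy φ s with hG
  set R : Circle → ℝ≥0∞ := fun ζ => ∫⁻ r in Ioo 0 S, g ((1 - r : ℝ) * ζ) with hR
  have hgrm : Measurable fun p : Circle × ℝ => g ((1 - p.2 : ℝ) * p.1) := hgm.comp (by fun_prop)
  have hRm : Measurable R := hgrm.lintegral_prod_right'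
  set M := ∫⁻ ζ, ‖(φ (Circle.exp t * ζ) : ℂ) - φ ζ‖ₑ ^ 2 ∂arcLength with hM
  have hR2 : ∫⁻ ζ, R ζ ^ 2 ∂arcLength ≤ ENNReal.ofReal (2 * S ^ (1 / 2 : ℝ)) * G := by
    calc ∫⁻ ζ, R ζ ^ 2 ∂arcLength ≤ ∫⁻ ζ : Circle, ENNReal.ofReal (2 * S ^ (1 / 2 : ℝ)) *
          ∫⁻ s in Ioo 0 S, ENNReal.ofReal (s ^ (1 / 2 : ℝ)) * g ((1 - s : ℝ) * ζ) ^ 2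
            ∂volume ∂arcLength := by
          refine lintegral_mono fun ζ => sq_lintegral_Ioo_le hS.le ?_
          exact hgm.comp (by fun_prop)
      _ = ENNReal.ofReal (2 * S ^ (1 / 2 : ℝ)) * ∫⁻ s in Ioo 0 S, ∫⁻ ζ : Circle,
          ENNReal.ofReal (s ^ (1 / 2 : ℝ)) * g ((1 - s : ℝ) * ζ) ^ 2 ∂arcLength := by
          have hjm : Measurable fun p : Circle × ℝ =>
              ENNReal.ofReal (p.2 ^ (1 / 2 : ℝ)) * g ((1 - p.2 : ℝ) * p.1) ^ 2 := by fun_prop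
          rw [lintegral_const_mul _ hjm.lintegral_prod_right',
            lintegral_lintegral_swap hjm.aemeasurable]
      _ = _ := by
          congr 1
          refine lintegral_congr fun s => ?_
          rw [lintegral_const_mul' _ _ ENNReal.ofReal_ne_top, circleEnergy]
  have hrot : ∀ τ : ℝ, ∀ s : ℝ, ∫⁻ ζ : Circle, g ((1 - s : ℝ) * (Circle.exp τ * ζ : Circle)) ^ 2
      ∂arcLength = circleEnergy φ s := by
    intro τ s
    exact lintegral_arcLength_mul_left (f := fun ζ : Circle => g ((1 - s : ℝ) * ζ) ^ 2)
      ((hgm.comp (by fun_prop)).pow_const 2) (Circle.exp τ)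
  have hA2 : ∀ s : ℝ, ∫⁻ ζ : Circle, (∫⁻ τ in Ioc 0 t,
      g ((1 - s : ℝ) * (Circle.exp τ * ζ : Circle))) ^ 2 ∂arcLength ≤
      ENNReal.ofReal (t ^ 2) * circleEnergy φ s := by
    intro s
    have hjm : Measurable fun p : Circle × ℝ =>
        g ((1 - s : ℝ) * (Circle.exp p.2 * p.1 : Circle)) ^ 2 :=
      (hgm.comp (by fun_prop)).pow_const 2
    calc _ ≤ ∫⁻ ζ : Circle, ENNReal.ofReal t * ∫⁻ τ in Ioc 0 t,
          g ((1 - s : ℝ) * (Circle.exp τ * ζ : Circle)) ^ 2 ∂volume ∂arcLength := by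
          refine lintegral_mono fun ζ => ?_
          refine (sq_lintegral_le _ (hgm.comp (by fun_prop)).aemeasurable).trans (le_of_eq ?_)
          simp
      _ = ENNReal.ofReal t * ∫⁻ τ in Ioc 0 t, ∫⁻ ζ : Circle,
          g ((1 - s : ℝ) * (Circle.exp τ * ζ : Circle)) ^ 2 ∂arcLength := by
          rw [lintegral_const_mul _ hjm.lintegral_prod_right',
            lintegral_lintegral_swap hjm.aemeasurable]
      _ = ENNReal.ofReal (t ^ 2) * circleEnergy φ s := by
          simp only [hrot]
          rw [setLIntegral_const, Real.volume_Ioc, sub_zero, sq, ENNReal.ofReal_mul ht0]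
          ring
  have hMs : ∀ s ∈ Ioo (S / 2) S, M ≤ 9 * (ENNReal.ofReal (4 * S ^ (1 / 2 : ℝ)) * G +
      ENNReal.ofReal (t ^ 2) * circleEnergy φ s) := by
    intro s hs
    have hs0 : 0 < s := by linarith [hs.1]
    have hAm : Measurable fun ζ : Circle => ∫⁻ τ in Ioc 0 t,
        g ((1 - s : ℝ) * (Circle.exp τ * ζ : Circle)) := by
      have : Measurable fun p : Circle × ℝ => g ((1 - s : ℝ) * (Circle.exp p.2 * p.1 : Circle)) :=
        hgm.comp (by fun_prop)
      exact this.lintegral_prod_right'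
    have hRm' : Measurable fun ζ => R (Circle.exp t * ζ) := by fun_prop
    calc M ≤ ∫⁻ ζ : Circle, 9 * (R ζ ^ 2 + R (Circle.exp t * ζ) ^ 2 + (∫⁻ τ in Ioc 0 t,
          g ((1 - s : ℝ) * (Circle.exp τ * ζ : Circle))) ^ 2) ∂arcLength := by
          refine lintegral_mono fun ζ => ?_
          exact (pow_le_pow_left' (enorm_homeo_sub_le φ ζ hs0 hs.2.le hS1 ht0) 2).trans
            (sq_add_three_le _ _ _)
      _ = 9 * (∫⁻ ζ, R ζ ^ 2 ∂arcLength + ∫⁻ ζ, R ζ ^ 2 ∂arcLength +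
          ∫⁻ ζ : Circle, (∫⁻ τ in Ioc 0 t,
            g ((1 - s : ℝ) * (Circle.exp τ * ζ : Circle))) ^ 2 ∂arcLength) := by
          rw [lintegral_const_mul _ (by fun_prop), lintegral_add_left (by fun_prop),
            lintegral_add_left (by fun_prop),
            lintegral_arcLength_mul_left (f := fun ζ => R ζ ^ 2) (by fun_prop)]
      _ ≤ 9 * (ENNReal.ofReal (2 * S ^ (1 / 2 : ℝ)) * G + ENNReal.ofReal (2 * S ^ (1 / 2 : ℝ)) * G +
          ENNReal.ofReal (t ^ 2) * circleEnergy φ s) := by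
          gcongr
          exact hA2 s
      _ = _ := by
          rw [← add_mul, ← ENNReal.ofReal_add (by positivity) (by positivity)]
          congr 5
          ring
  -- averaging over the radius of the arc
  have hcE : ∫⁻ s in Ioo (S / 2) S, circleEnergy φ s ≤
      ENNReal.ofReal (2 * S ^ (-(1 / 2) : ℝ)) * G := by
    calc ∫⁻ s in Ioo (S / 2) S, circleEnergy φ s ≤ ∫⁻ s in Ioo (S / 2) S,
          ENNReal.ofReal (2 * S ^ (-(1 / 2) : ℝ)) *
            (ENNReal.ofReal (s ^ (1 / 2 : ℝ)) * circleEnergy φ s) := by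
          refine setLIntegral_mono' measurableSet_Ioo fun s hs => ?_
          have hs0 : 0 < s := by linarith [hs.1]
          rw [← mul_assoc, ← ENNReal.ofReal_mul (by positivity)]
          refine le_mul_of_one_le_left' ?_
          rw [ENNReal.one_le_ofReal]
          have h1 : (S / 2) ^ (1 / 2 : ℝ) ≤ s ^ (1 / 2 : ℝ) := by
            have := hs.1.le
            gcongr
          have h2 : (S / 2) ^ (1 / 2 : ℝ) = S ^ (1 / 2 : ℝ) / 2 ^ (1 / 2 : ℝ) :=
            Real.div_rpow hS.le (by norm_num) _
          have h3 : (2 : ℝ) ^ (1 / 2 : ℝ) ≤ 2 := by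
            calc (2 : ℝ) ^ (1 / 2 : ℝ) ≤ 2 ^ (1 : ℝ) :=
                  Real.rpow_le_rpow_of_exponent_le one_le_two (by norm_num)
              _ = 2 := Real.rpow_one 2
          have h4 : S ^ (-(1 / 2) : ℝ) * S ^ (1 / 2 : ℝ) = 1 := by
            rw [← Real.rpow_add hS]; norm_num
          calc (1 : ℝ) = 2 * S ^ (-(1 / 2) : ℝ) * (S ^ (1 / 2 : ℝ) / 2) := by
                linear_combination -h4
            _ ≤ 2 * S ^ (-(1 / 2) : ℝ) * (S ^ (1 / 2 : ℝ) / 2 ^ (1 / 2 : ℝ)) := by gcongr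
            _ ≤ 2 * S ^ (-(1 / 2) : ℝ) * s ^ (1 / 2 : ℝ) := by rw [← h2]; gcongr
      _ = ENNReal.ofReal (2 * S ^ (-(1 / 2) : ℝ)) * ∫⁻ s in Ioo (S / 2) S,
            ENNReal.ofReal (s ^ (1 / 2 : ℝ)) * circleEnergy φ s :=
          lintegral_const_mul' _ _ ENNReal.ofReal_ne_top
      _ ≤ _ := by
          gcongr
          exact lintegral_mono_set (Ioo_subset_Ioo_left (by positivity))
  have hS2 : S - S / 2 = S / 2 := by ring
  have hmain : ENNReal.ofReal (S / 2) * M ≤ ENNReal.ofReal (S / 2) *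
      (ENNReal.ofReal ((36 + 576 * Real.pi ^ 2) * S ^ (1 / 2 : ℝ)) * G) := by
    calc ENNReal.ofReal (S / 2) * M = ∫⁻ s in Ioo (S / 2) S, M := by
          rw [setLIntegral_const, Real.volume_Ioo, hS2, mul_comm]
      _ ≤ ∫⁻ s in Ioo (S / 2) S, 9 * (ENNReal.ofReal (4 * S ^ (1 / 2 : ℝ)) * G +
          ENNReal.ofReal (t ^ 2) * circleEnergy φ s) := setLIntegral_mono' measurableSet_Ioo hMs
      _ = 9 * (ENNReal.ofReal (4 * S ^ (1 / 2 : ℝ)) * G * ENNReal.ofReal (S / 2) +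
          ENNReal.ofReal (t ^ 2) * ∫⁻ s in Ioo (S / 2) S, circleEnergy φ s) := by
          have := measurable_circleEnergy φ
          rw [lintegral_const_mul _ (by fun_prop), lintegral_add_left (by fun_prop),
            setLIntegral_const, Real.volume_Ioo, hS2, lintegral_const_mul _ (by fun_prop)]
      _ ≤ 9 * (ENNReal.ofReal (4 * S ^ (1 / 2 : ℝ)) * G * ENNReal.ofReal (S / 2) +
          ENNReal.ofReal (t ^ 2) * (ENNReal.ofReal (2 * S ^ (-(1 / 2) : ℝ)) * G)) := by gcongr
      _ = ENNReal.ofReal (9 * (4 * S ^ (1 / 2 : ℝ) * (S / 2) +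
          t ^ 2 * (2 * S ^ (-(1 / 2) : ℝ)))) * G := by
          have hexp : ∀ x y : ℝ, 0 ≤ x → 0 ≤ y → ENNReal.ofReal (9 * (x * (S / 2) + t ^ 2 * y)) =
              9 * (ENNReal.ofReal x * ENNReal.ofReal (S / 2) +
                ENNReal.ofReal (t ^ 2) * ENNReal.ofReal y) := by
            intro x y hx hy
            rw [ENNReal.ofReal_mul (by norm_num), ENNReal.ofReal_add (by positivity)
              (by positivity), ENNReal.ofReal_mul hx, ENNReal.ofReal_mul (by positivity),
              ENNReal.ofReal_ofNat]
          rw [hexp _ _ (by positivity) (by positivity)]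
          ring
      _ = _ := by
          rw [← mul_assoc (ENNReal.ofReal (S / 2)), ← ENNReal.ofReal_mul (by positivity)]
          congr 2
          have h5 : S ^ (1 / 2 : ℝ) = S * S ^ (-(1 / 2) : ℝ) := by
            rw [mul_comm, ← Real.rpow_add_one hS.ne']; norm_num
          rw [ht, h5]
          ring
  exact (ENNReal.mul_le_mul_iff_right (by simpa using hS) ENNReal.ofReal_ne_top).1 hmain

theorem sum_lintegral_Ioc (f : ℝ → ℝ≥0∞) {a : ℝ} (ha : 0 ≤ a) (n : ℕ) :
    ∑ k ∈ Finset.Icc 1 n, ∫⁻ x in Ioc (a * ((k : ℝ) - 1)) (a * k), f x =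
      ∫⁻ x in Ioc 0 (a * n), f x := by
  induction n with
  | zero => simp
  | succ n ih =>
    rw [Finset.sum_Icc_succ_top (by omega), ih, ← lintegral_union measurableSet_Ioc]
    · push_cast
      rw [add_sub_cancel_right, Ioc_union_Ioc_eq_Ioc (by positivity) (by gcongr; linarith)]
    · push_cast
      rw [add_sub_cancel_right]
      exact Ioc_disjoint_Ioc_of_le le_rfl

/-- At fine scales the dyadic square sum is controlled by the energy near the boundary. -/
theorem exists_dyadicSquareSum_le : ∃ C : ℝ, 0 < C ∧ ∃ j₀ : ℕ, ∀ j ≥ j₀, dyadicSquareSum φ j ≤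
    ENNReal.ofReal (C * 2 ^ ((j : ℝ) / 2)) *
      ∫⁻ s in Ioo 0 ((2 : ℝ) ^ j)⁻¹, ENNReal.ofReal (s ^ (1 / 2 : ℝ)) * circleEnergy φ s := by
  obtain ⟨δ, hδ, hν⟩ := exists_imageMeasure_arc_le φ
  obtain ⟨j₀, hj₀⟩ := pow_unbounded_of_one_lt (4 * Real.pi / δ) (one_lt_two (α := ℝ))
  set C : ℝ := (Real.pi / 2) ^ 2 * (36 + 576 * Real.pi ^ 2) / (2 * Real.pi) with hC
  refine ⟨C, by positivity, j₀, fun j hj => ?_⟩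
  set S : ℝ := ((2 : ℝ) ^ j)⁻¹ with hS
  have hS0 : 0 < S := by positivity
  have hS1 : S ≤ 1 := inv_le_one_of_one_le₀ (one_le_pow₀ one_le_two)
  set a : ℝ := 2 * Real.pi * S with ha
  have ha0 : 0 < a := by positivity
  have haδ : 2 * a ≤ δ := by
    have h1 : (2 : ℝ) ^ j₀ ≤ 2 ^ j := pow_le_pow_right₀ one_le_two hj
    have h2 : 4 * Real.pi / δ ≤ 2 ^ j := hj₀.le.trans h1
    rw [div_le_iff₀ hδ] at h2
    rw [ha, hS]
    calc 2 * (2 * Real.pi * ((2 : ℝ) ^ j)⁻¹) = 4 * Real.pi * ((2 : ℝ) ^ j)⁻¹ := by ring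
      _ ≤ (2 ^ j * δ) * ((2 : ℝ) ^ j)⁻¹ := by gcongr
      _ = δ := by field_simp
  set f : ℝ → ℝ≥0∞ := fun x =>
    ‖(φ (Circle.exp a * Circle.exp x) : ℂ) - φ (Circle.exp (-a) * Circle.exp x)‖ₑ ^ 2 with hf
  -- for every `x` in the interval of angles of `Γ_{j,k}`, whose length is `a`, the interval
  -- `[x - a, x + a]` contains it; average over `x`
  have harc : ∀ k : ℕ, ENNReal.ofReal a * imageMeasure φ (dyadicArc j k) ^ 2 ≤
      ENNReal.ofReal ((Real.pi / 2) ^ 2) *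
        ∫⁻ x in Ioc (a * ((k : ℝ) - 1)) (a * k), f x := by
    intro k
    have hvol : a * k - a * ((k : ℝ) - 1) = a := by ring
    rw [← lintegral_const_mul' _ _ ENNReal.ofReal_ne_top]
    calc ENNReal.ofReal a * imageMeasure φ (dyadicArc j k) ^ 2 =
          ∫⁻ x in Ioc (a * ((k : ℝ) - 1)) (a * k), imageMeasure φ (dyadicArc j k) ^ 2 := by
          rw [setLIntegral_const, Real.volume_Ioc, hvol, mul_comm]
      _ ≤ _ := by
          refine setLIntegral_mono' measurableSet_Ioc fun x hx => ?_
          have hsub : dyadicArc j k ⊆ Circle.exp '' Icc (x - a) (x + a) := by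
            refine image_mono (Icc_subset_Icc ?_ ?_)
            · have : 2 * Real.pi * ((k : ℝ) - 1) / 2 ^ j = a * ((k : ℝ) - 1) := by
                rw [ha, hS]; field_simp
              rw [this]
              nlinarith [hx.2]
            · have : 2 * Real.pi * (k : ℝ) / 2 ^ j = a * k := by
                rw [ha, hS]; field_simp
              rw [this]
              nlinarith [hx.1]
          have h1 := (measure_mono hsub).trans (hν (x - a) (x + a) (by linarith) (by linarith))
          rw [ENNReal.ofReal_mul (by positivity), ofReal_norm] at h1
          have h2 := pow_le_pow_left' h1 2
          rw [mul_pow, ← ENNReal.ofReal_pow (by positivity)] at h2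
          rw [hf]
          simp only [← Circle.exp_add]
          rwa [add_comm a x, neg_add_eq_sub]
  have hφc := continuous_coe_homeo φ
  have hFm : Measurable fun ζ : Circle =>
      ‖(φ (Circle.exp a * ζ) : ℂ) - φ (Circle.exp (-a) * ζ)‖ₑ ^ 2 := by
    have : Continuous fun ζ : Circle =>
        (φ (Circle.exp a * ζ) : ℂ) - φ (Circle.exp (-a) * ζ) :=
      (hφc.comp (continuous_const.mul continuous_id)).sub
        (hφc.comp (continuous_const.mul continuous_id))
    exact this.measurable.enorm.pow_const 2
  have htotal : ∫⁻ x in Ioc 0 (a * (2 ^ j : ℕ)), f x =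
      ∫⁻ ζ, ‖(φ (Circle.exp (4 * Real.pi * S) * ζ) : ℂ) - φ ζ‖ₑ ^ 2 ∂arcLength := by
    have h3 : a * (2 ^ j : ℕ) = 0 + 2 * Real.pi := by
      rw [ha, hS]; push_cast; field_simp; ring
    rw [h3, ← lintegral_arcLength hFm 0, ← lintegral_arcLength_mul_left hFm (Circle.exp a)]
    refine lintegral_congr fun ζ => ?_
    rw [← mul_assoc, ← mul_assoc, ← Circle.exp_add, ← Circle.exp_add, neg_add_cancel,
      Circle.exp_zero, one_mul]
    have h6 : a + a = 4 * Real.pi * S := by rw [ha]; ring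
    rw [h6]
  have hsum : ENNReal.ofReal a * dyadicSquareSum φ j ≤ ENNReal.ofReal a *
      (ENNReal.ofReal (C * 2 ^ ((j : ℝ) / 2)) *
        ∫⁻ s in Ioo 0 S, ENNReal.ofReal (s ^ (1 / 2 : ℝ)) * circleEnergy φ s) := by
    calc ENNReal.ofReal a * dyadicSquareSum φ j
        ≤ ENNReal.ofReal ((Real.pi / 2) ^ 2) * ∫⁻ x in Ioc 0 (a * (2 ^ j : ℕ)), f x := by
          rw [dyadicSquareSum, Finset.mul_sum, ← sum_lintegral_Ioc f ha0.le, Finset.mul_sum]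
          exact Finset.sum_le_sum fun k _ => harc k
      _ ≤ ENNReal.ofReal ((Real.pi / 2) ^ 2) *
          (ENNReal.ofReal ((36 + 576 * Real.pi ^ 2) * S ^ (1 / 2 : ℝ)) *
          ∫⁻ s in Ioo 0 S, ENNReal.ofReal (s ^ (1 / 2 : ℝ)) * circleEnergy φ s) := by
          rw [htotal]
          gcongr
          exact lintegral_sq_increment_le φ hS0 hS1
      _ = _ := by
          rw [← mul_assoc, ← mul_assoc, ← ENNReal.ofReal_mul (by positivity),
            ← ENNReal.ofReal_mul (by positivity)]
          congr 2
          have h4 : (2 : ℝ) ^ ((j : ℝ) / 2) = S ^ (-(1 / 2) : ℝ) := by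
            rw [hS, Real.inv_rpow (by positivity), ← Real.rpow_neg (by positivity), neg_neg,
              ← Real.rpow_natCast, ← Real.rpow_mul (by norm_num)]
            congr 1
            ring
          have h5 : S ^ (1 / 2 : ℝ) = S * S ^ (-(1 / 2) : ℝ) := by
            rw [mul_comm, ← Real.rpow_add_one hS0.ne']; norm_num
          rw [h4, h5, hC, ha]
          field_simp
  exact (ENNReal.mul_le_mul_iff_right (by simpa using ha0) ENNReal.ofReal_ne_top).1 hsum

/-- Multiply the bound of `exists_dyadicSquareSum_le` by `j^l` and sum over the generations `j`; the
weight `s^{1/2}` cancels the factor `s^{-1/2}` of `exists_tsum_weight_le`. -/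
theorem dyadicEnergy_lt_top_of_weightedEnergy {l : ℝ}
    (h : weightedEnergy (poissonExtension φ) l < ⊤) : dyadicEnergy φ l < ⊤ := by
  obtain ⟨C, hC, j₀, hT⟩ := exists_dyadicSquareSum_le φ
  obtain ⟨D, hD, hw⟩ := exists_tsum_weight_le l
  have hcm := measurable_circleEnergy φ
  set F : ℝ → ℝ≥0∞ := fun s => ENNReal.ofReal (s ^ (1 / 2 : ℝ)) * circleEnergy φ s with hF
  have hFm : Measurable F := by fun_prop
  set W : ℕ+ → ℝ≥0∞ := fun j =>
    ENNReal.ofReal (((j : ℕ) : ℝ) ^ l * (2 : ℝ) ^ (((j : ℕ) : ℝ) / 2)) with hW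
  have hterm : ∀ j : ℕ+, ENNReal.ofReal (((j : ℕ) : ℝ) ^ l) * dyadicSquareSum φ j ≤
      (if j ∈ Finset.Icc 1 j₀.succPNat then
        ENNReal.ofReal (((j : ℕ) : ℝ) ^ l) * dyadicSquareSum φ j else 0) +
      ENNReal.ofReal C * ∫⁻ s in Ioo 0 (1 / 2 : ℝ),
        (Ioo 0 ((2 : ℝ) ^ (j : ℕ))⁻¹).indicator (fun _ => W j) s * F s := by
    intro j
    -- the finitely many coarse generations contribute a finite amount in any case
    by_cases hj : j ∈ Finset.Icc 1 j₀.succPNat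
    · rw [if_pos hj]; exact le_self_add
    · rw [if_neg hj, zero_add]
      have hjj : j₀ ≤ (j : ℕ) := by
        rw [Finset.mem_Icc, not_and, not_le] at hj
        have := hj one_le
        have h2 : (j₀.succPNat : ℕ) < j := this
        rw [Nat.succPNat_coe] at h2
        omega
      have hsub : Ioo 0 ((2 : ℝ) ^ (j : ℕ))⁻¹ ⊆ Ioo 0 (1 / 2 : ℝ) := by
        refine Ioo_subset_Ioo_right ?_
        rw [one_div]
        refine inv_anti₀ (by norm_num) ?_
        calc (2 : ℝ) = 2 ^ 1 := (pow_one 2).symm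
          _ ≤ 2 ^ (j : ℕ) := pow_le_pow_right₀ one_le_two j.pos
      have hset : ∫⁻ s in Ioo 0 (1 / 2 : ℝ),
          (Ioo 0 ((2 : ℝ) ^ (j : ℕ))⁻¹).indicator (fun _ => W j) s * F s =
          W j * ∫⁻ s in Ioo 0 ((2 : ℝ) ^ (j : ℕ))⁻¹, F s := by
        have h1 : ∀ s, (Ioo 0 ((2 : ℝ) ^ (j : ℕ))⁻¹).indicator (fun _ => W j) s * F s =
            (Ioo 0 ((2 : ℝ) ^ (j : ℕ))⁻¹).indicator (fun s => W j * F s) s := fun s => by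
          by_cases hs : s ∈ Ioo 0 ((2 : ℝ) ^ (j : ℕ))⁻¹
          · rw [indicator_of_mem hs, indicator_of_mem hs]
          · rw [indicator_of_notMem hs, indicator_of_notMem hs, zero_mul]
        simp only [h1]
        rw [setLIntegral_indicator measurableSet_Ioo, inter_eq_left.2 hsub,
          lintegral_const_mul _ hFm]
      rw [hset]
      calc _ ≤ ENNReal.ofReal (((j : ℕ) : ℝ) ^ l) *
            (ENNReal.ofReal (C * 2 ^ (((j : ℕ) : ℝ) / 2)) *
              ∫⁻ s in Ioo 0 ((2 : ℝ) ^ (j : ℕ))⁻¹, F s) := by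
            gcongr
            exact hT j hjj
        _ = _ := by
            have hWj : W j = ENNReal.ofReal (((j : ℕ) : ℝ) ^ l) *
                ENNReal.ofReal ((2 : ℝ) ^ (((j : ℕ) : ℝ) / 2)) := ENNReal.ofReal_mul (by positivity)
            rw [hWj, ENNReal.ofReal_mul hC.le]
            ring
  rw [dyadicEnergy_eq]
  refine (ENNReal.tsum_le_tsum hterm).trans_lt ?_
  rw [ENNReal.tsum_add, ENNReal.tsum_mul_left]
  refine ENNReal.add_lt_top.2 ⟨?_, ENNReal.mul_lt_top ENNReal.ofReal_lt_top ?_⟩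
  · rw [tsum_eq_sum (s := Finset.Icc 1 j₀.succPNat) fun j hj => if_neg hj]
    refine ENNReal.sum_lt_top.2 fun j hj => ?_
    rw [if_pos hj]
    exact ENNReal.mul_lt_top ENNReal.ofReal_lt_top (dyadicSquareSum_lt_top φ j)
  · have hjm : ∀ j : ℕ+, Measurable fun s =>
        (Ioo 0 ((2 : ℝ) ^ (j : ℕ))⁻¹).indicator (fun _ => W j) s * F s := fun j =>
      (measurable_const.indicator measurableSet_Ioo).mul hFm
    rw [← lintegral_tsum fun j => (hjm j).aemeasurable]
    simp only [ENNReal.tsum_mul_right]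
    calc _ ≤ ∫⁻ s in Ioo 0 (1 / 2 : ℝ), ENNReal.ofReal (2 * D) * (ENNReal.ofReal (1 - s) *
          (ENNReal.ofReal (Real.log (2 / s) ^ l) * circleEnergy φ s)) := by
          refine setLIntegral_mono' measurableSet_Ioo fun s hs => ?_
          have hs0 : 0 < s := hs.1
          have hs1 : s < 1 / 2 := hs.2
          have hlog := log_two_div_pos hs0 (by linarith)
          calc _ ≤ ENNReal.ofReal (D * (s ^ (-(1 / 2) : ℝ) * Real.log (2 / s) ^ l)) *
                (ENNReal.ofReal (s ^ (1 / 2 : ℝ)) * circleEnergy φ s) := by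
                gcongr
                exact hw s hs0 (by linarith)
            _ = ENNReal.ofReal (D * Real.log (2 / s) ^ l) * circleEnergy φ s := by
                rw [← mul_assoc, ← ENNReal.ofReal_mul (by positivity)]
                congr 2
                have : s ^ (-(1 / 2) : ℝ) * s ^ (1 / 2 : ℝ) = 1 := by
                  rw [← Real.rpow_add hs0]; norm_num
                linear_combination D * Real.log (2 / s) ^ l * this
            _ ≤ ENNReal.ofReal (2 * D * (1 - s) * Real.log (2 / s) ^ l) * circleEnergy φ s := by
                gcongr
                nlinarith
            _ = _ := by
                rw [← mul_assoc, ← mul_assoc, ← ENNReal.ofReal_mul (by positivity),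
                  ← ENNReal.ofReal_mul (by nlinarith)]
      _ ≤ ENNReal.ofReal (2 * D) * weightedEnergy (poissonExtension φ) l := by
          rw [lintegral_const_mul' _ _ ENNReal.ofReal_ne_top, weightedEnergy_eq]
          refine mul_le_mul' le_rfl (lintegral_mono_set (Ioo_subset_Ioo_right ?_))
          norm_num
      _ < ⊤ := ENNReal.mul_lt_top ENNReal.ofReal_lt_top h

/-! ### From the dyadic sums to the logarithmic energy -/

theorem measurableSet_dyadicArc (j k : ℕ) : MeasurableSet (dyadicArc j k) :=
  measurableSet_exp_image_Icc _ _

theorem dyadicArc_add_two_pow (j k : ℕ) : dyadicArc j (k + 2 ^ j) = dyadicArc j k := by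
  have h : ∀ x : ℝ, Circle.exp (x + 2 * Real.pi) = Circle.exp x := Circle.periodic_exp
  have h1 : 2 * Real.pi * (((k + 2 ^ j : ℕ) : ℝ) - 1) / 2 ^ j =
      2 * Real.pi * ((k : ℝ) - 1) / 2 ^ j + 2 * Real.pi := by
    push_cast; field_simp; ring
  have h2 : 2 * Real.pi * ((k + 2 ^ j : ℕ) : ℝ) / 2 ^ j =
      2 * Real.pi * (k : ℝ) / 2 ^ j + 2 * Real.pi := by
    push_cast; field_simp
  rw [dyadicArc, dyadicArc, h1, h2, ← image_add_const_Icc, image_image]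
  simp only [h]

theorem mul_le_sq_add_sq (x y : ℝ≥0∞) : x * y ≤ x ^ 2 + y ^ 2 := by
  rcases le_total x y with h | h
  · calc x * y ≤ y * y := by gcongr
      _ = y ^ 2 := (sq y).symm
      _ ≤ _ := le_add_self
  · calc x * y ≤ x * x := by gcongr
      _ = x ^ 2 := (sq x).symm
      _ ≤ _ := le_self_add

theorem dyadicSquareSum_eq_sum_range (j : ℕ) : dyadicSquareSum φ j =
    ∑ i ∈ Finset.range (2 ^ j), imageMeasure φ (dyadicArc j (i + 1)) ^ 2 := by
  rw [dyadicSquareSum]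
  generalize 2 ^ j = n
  induction n with
  | zero => simp
  | succ n ih => rw [Finset.sum_Icc_succ_top (by omega), ih, Finset.sum_range_succ]

/-- The sum of a periodic sequence over a period may be shifted. -/
theorem sum_range_shift {f : ℕ → ℝ≥0∞} {n : ℕ} (h : f n = f 0) (h0 : f 0 ≠ ⊤) :
    ∑ i ∈ Finset.range n, f (i + 1) = ∑ i ∈ Finset.range n, f i := by
  have h1 := Finset.sum_range_succ f n
  rw [Finset.sum_range_succ', h] at h1
  exact (ENNReal.add_left_inj h0).1 h1

/-- Pairs of points at distance at most `2^{-j}` lie in equal or adjacent dyadic arcs. -/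
theorem lintegral_imageMeasure_ball_le (j : ℕ) :
    ∫⁻ u, imageMeasure φ {v : Circle | ‖(v : ℂ) - u‖ ≤ ((2 : ℝ) ^ j)⁻¹} ∂imageMeasure φ ≤
      5 * dyadicSquareSum φ j := by
  set ν := imageMeasure φ with hν
  set N : ℕ → ℝ≥0∞ := fun k => ν (dyadicArc j k) with hN
  set a : ℝ := 2 * Real.pi / 2 ^ j with ha
  have ha0 : 0 < a := by positivity
  have harc : ∀ k : ℕ, dyadicArc j k = Circle.exp '' Icc (a * ((k : ℝ) - 1)) (a * k) := by
    intro k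
    rw [dyadicArc, ha]
    congr 2 <;> ring
  have hpt : ∀ u : Circle, ν {v : Circle | ‖(v : ℂ) - u‖ ≤ ((2 : ℝ) ^ j)⁻¹} ≤
      ∑ i ∈ Finset.range (2 ^ j), (dyadicArc j (i + 1)).indicator
        (fun _ => N i + N (i + 1) + N (i + 2)) u := by
    intro u
    obtain ⟨x, hx, hxu⟩ := Circle.periodic_exp.exists_mem_Ioc Real.two_pi_pos (Complex.arg u) 0
    rw [Circle.exp_arg] at hxu
    rw [zero_add] at hx
    obtain ⟨i, hi⟩ : ∃ i : ℕ, ⌈x / a⌉₊ = i + 1 :=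
      Nat.exists_eq_add_one.2 (Nat.ceil_pos.2 (div_pos hx.1 ha0))
    have hxa : x ≤ a * ((i : ℝ) + 1) := by
      have := Nat.le_ceil (x / a)
      rw [hi, div_le_iff₀ ha0] at this
      push_cast at this
      linarith
    have hxa' : a * i ≤ x := by
      have := Nat.ceil_lt_add_one (div_pos hx.1 ha0).le
      rw [hi] at this
      push_cast at this
      have h2 : (i : ℝ) < x / a := by linarith
      rw [lt_div_iff₀ ha0] at h2
      linarith
    have hin : i ∈ Finset.range (2 ^ j) := by
      rw [Finset.mem_range, ← Nat.add_one_le_iff, ← hi, Nat.ceil_le, div_le_iff₀ ha0, ha]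
      push_cast
      field_simp
      exact hx.2
    have hmem : u ∈ dyadicArc j (i + 1) := by
      rw [harc]
      refine ⟨x, ⟨?_, ?_⟩, hxu.symm⟩ <;> push_cast <;> linarith
    have hsub : {v : Circle | ‖(v : ℂ) - u‖ ≤ ((2 : ℝ) ^ j)⁻¹} ⊆
        dyadicArc j i ∪ dyadicArc j (i + 1) ∪ dyadicArc j (i + 2) := by
      intro v hv
      set t := Complex.arg ((v / u : Circle) : ℂ) with ht
      have hexp : Circle.exp t = v / u := Circle.exp_arg _
      have hve : v = Circle.exp (x + t) := by
        rw [Circle.exp_add, hexp, ← hxu]; simp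
      have hta : |t| ≤ a := by
        have h1 := le_norm_exp_sub_one (t := t) (Complex.abs_arg_le_pi _)
        have h2 : ‖(v : ℂ) - u‖ = ‖(Circle.exp t : ℂ) - 1‖ := by
          rw [hve, hxu, norm_exp_sub_exp, add_sub_cancel_left]
        have h3 : ‖(v : ℂ) - u‖ ≤ ((2 : ℝ) ^ j)⁻¹ := hv
        rw [h2] at h3
        have h4 : 2 / Real.pi * |t| ≤ ((2 : ℝ) ^ j)⁻¹ := h1.trans h3
        have h5 : |t| ≤ Real.pi / 2 * ((2 : ℝ) ^ j)⁻¹ := by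
          calc |t| = Real.pi / 2 * (2 / Real.pi * |t|) := by field_simp
            _ ≤ _ := by gcongr
        refine h5.trans ?_
        rw [ha, div_eq_mul_inv (2 * Real.pi)]
        gcongr
        linarith [Real.pi_pos]
      rw [abs_le] at hta
      rw [harc, harc, harc, hve, ← image_union, ← image_union]
      refine mem_image_of_mem _ ?_
      push_cast
      rcases le_total (x + t) (a * i) with h6 | h6
      · exact Or.inl (Or.inl ⟨by linarith, h6⟩)
      rcases le_total (x + t) (a * (i + 1)) with h7 | h7
      · exact Or.inl (Or.inr ⟨by linarith, h7⟩)
      · exact Or.inr ⟨by linarith, by linarith⟩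
    calc ν {v : Circle | ‖(v : ℂ) - u‖ ≤ ((2 : ℝ) ^ j)⁻¹}
        ≤ ν (dyadicArc j i ∪ dyadicArc j (i + 1) ∪ dyadicArc j (i + 2)) := measure_mono hsub
      _ ≤ N i + N (i + 1) + N (i + 2) :=
          (measure_union_le _ _).trans (add_le_add (measure_union_le _ _) le_rfl)
      _ = (dyadicArc j (i + 1)).indicator (fun _ => N i + N (i + 1) + N (i + 2)) u :=
          (indicator_of_mem hmem (fun _ => N i + N (i + 1) + N (i + 2))).symm
      _ ≤ _ := Finset.single_le_sum (f := fun i => (dyadicArc j (i + 1)).indicator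
          (fun _ => N i + N (i + 1) + N (i + 2)) u) (fun _ _ => zero_le) hin
  have hper : ∀ k, N (k + 2 ^ j) = N k := fun k => by
    simp only [hN, dyadicArc_add_two_pow]
  have hfin : ∀ k, N k ^ 2 ≠ ⊤ := fun k => ENNReal.pow_ne_top (measure_ne_top _ _)
  have hT := dyadicSquareSum_eq_sum_range φ j
  have hT0 : ∑ i ∈ Finset.range (2 ^ j), N i ^ 2 = dyadicSquareSum φ j := by
    rw [hT]
    refine (sum_range_shift (f := fun i => N i ^ 2) ?_ (hfin 0)).symm
    have := hper 0
    rw [zero_add] at this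
    simp only [this]
  have hT2 : ∑ i ∈ Finset.range (2 ^ j), N (i + 2) ^ 2 = dyadicSquareSum φ j := by
    rw [hT]
    refine sum_range_shift (f := fun i => N (i + 1) ^ 2) ?_ (hfin _)
    have := hper 1
    rw [add_comm] at this
    simp only [this, zero_add]
  calc _ ≤ ∫⁻ u, ∑ i ∈ Finset.range (2 ^ j), (dyadicArc j (i + 1)).indicator
        (fun _ => N i + N (i + 1) + N (i + 2)) u ∂ν := lintegral_mono hpt
    _ = ∑ i ∈ Finset.range (2 ^ j), (N i + N (i + 1) + N (i + 2)) * N (i + 1) := by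
        rw [lintegral_finsetSum _ fun i _ =>
          measurable_const.indicator (measurableSet_dyadicArc j (i + 1))]
        exact Finset.sum_congr rfl fun i _ =>
          lintegral_indicator_const (measurableSet_dyadicArc j (i + 1)) _
    _ ≤ ∑ i ∈ Finset.range (2 ^ j), (N i ^ 2 + 3 * N (i + 1) ^ 2 + N (i + 2) ^ 2) := by
        refine Finset.sum_le_sum fun i _ => ?_
        calc (N i + N (i + 1) + N (i + 2)) * N (i + 1)
            = N i * N (i + 1) + N (i + 1) ^ 2 + N (i + 2) * N (i + 1) := by ring
          _ ≤ (N i ^ 2 + N (i + 1) ^ 2) + N (i + 1) ^ 2 + (N (i + 2) ^ 2 + N (i + 1) ^ 2) := by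
            gcongr
            · exact mul_le_sq_add_sq _ _
            · exact mul_le_sq_add_sq _ _
          _ = _ := by ring
    _ = 5 * dyadicSquareSum φ j := by
        rw [Finset.sum_add_distrib, Finset.sum_add_distrib, ← Finset.mul_sum, hT0, hT2, ← hT]
        ring

/-- Sum the bound of `lintegral_imageMeasure_ball_le` over all scales `2^{-j}`, with weight `j^l`. -/
theorem logEnergy_lt_top_of_dyadicEnergy {l : ℝ} (hl : -1 < l) (h : dyadicEnergy φ l < ⊤) :
    logEnergy φ.symm l < ⊤ := by
  obtain ⟨C, hC, hlog⟩ := exists_abs_log_rpow_le hl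
  set ν := imageMeasure φ with hν
  set w : ℕ+ → ℝ≥0∞ := fun j => ENNReal.ofReal (((j : ℕ) : ℝ) ^ l) with hw
  have hA : ∀ j : ℕ+, MeasurableSet
      {p : Circle × Circle | ‖(p.2 : ℂ) - p.1‖ ≤ ((2 : ℝ) ^ (j : ℕ))⁻¹} := fun j =>
    measurableSet_le (by fun_prop) (by fun_prop)
  have hAm : ∀ j : ℕ+, Measurable fun p : Circle × Circle =>
      (Iic ((2 : ℝ) ^ (j : ℕ))⁻¹).indicator (fun _ => w j) ‖(p.2 : ℂ) - p.1‖ := fun j =>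
    show Measurable ({p : Circle × Circle | ‖(p.2 : ℂ) - p.1‖ ≤ ((2 : ℝ) ^ (j : ℕ))⁻¹}.indicator
      fun _ => w j) from measurable_const.indicator (hA j)
  have hAs : ∀ (j : ℕ+) (u : Circle), Measurable fun v : Circle =>
      (Iic ((2 : ℝ) ^ (j : ℕ))⁻¹).indicator (fun _ => w j) ‖(v : ℂ) - u‖ := fun j u =>
    (hAm j).comp (measurable_const.prodMk measurable_id)
  have hin : ∀ (j : ℕ+) (u : Circle), ∫⁻ v : Circle,
      (Iic ((2 : ℝ) ^ (j : ℕ))⁻¹).indicator (fun _ => w j) ‖(v : ℂ) - u‖ ∂ν =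
      w j * ν {v : Circle | ‖(v : ℂ) - u‖ ≤ ((2 : ℝ) ^ (j : ℕ))⁻¹} := by
    intro j u
    have hm : MeasurableSet {v : Circle | ‖(v : ℂ) - u‖ ≤ ((2 : ℝ) ^ (j : ℕ))⁻¹} :=
      measurableSet_le (by fun_prop) (by fun_prop)
    exact lintegral_indicator_const hm (w j)
  rw [logEnergy_eq]
  calc _ ≤ ∫⁻ u : Circle, ∫⁻ v : Circle, ENNReal.ofReal C * (1 + ∑' j : ℕ+,
        (Iic ((2 : ℝ) ^ (j : ℕ))⁻¹).indicator (fun _ => w j) ‖(v : ℂ) - u‖) ∂ν ∂ν :=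
        lintegral_mono fun u => lintegral_mono fun v =>
          hlog _ (norm_nonneg _) (norm_circle_sub_le_two u v)
    _ = ∫⁻ u : Circle, ENNReal.ofReal C * (ν univ + ∑' j : ℕ+, ∫⁻ v : Circle,
        (Iic ((2 : ℝ) ^ (j : ℕ))⁻¹).indicator (fun _ => w j) ‖(v : ℂ) - u‖ ∂ν) ∂ν := by
        refine lintegral_congr fun u => ?_
        rw [lintegral_const_mul' _ _ ENNReal.ofReal_ne_top, lintegral_add_left measurable_const,
          lintegral_one, lintegral_tsum fun j => (hAs j u).aemeasurable]
    _ = ENNReal.ofReal C * (ν univ * ν univ + ∑' j : ℕ+, ∫⁻ u : Circle, ∫⁻ v : Circle,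
        (Iic ((2 : ℝ) ^ (j : ℕ))⁻¹).indicator (fun _ => w j) ‖(v : ℂ) - u‖ ∂ν ∂ν) := by
        rw [lintegral_const_mul' _ _ ENNReal.ofReal_ne_top, lintegral_add_left measurable_const,
          lintegral_const, lintegral_tsum fun j => (hAm j).lintegral_prod_right'.aemeasurable]
    _ ≤ ENNReal.ofReal C * (ν univ * ν univ + 5 * dyadicEnergy φ l) := by
        rw [dyadicEnergy_eq, ← ENNReal.tsum_mul_left]
        gcongr with j
        simp only [hin]
        rw [lintegral_const_mul' _ _ ENNReal.ofReal_ne_top]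
        calc w j * _ ≤ w j * (5 * dyadicSquareSum φ j) := by
              gcongr
              exact lintegral_imageMeasure_ball_le φ j
          _ = _ := by ring
    _ < ⊤ := by
        refine ENNReal.mul_lt_top ENNReal.ofReal_lt_top (ENNReal.add_lt_top.2 ⟨?_, ?_⟩)
        · exact ENNReal.mul_lt_top (measure_lt_top _ _) (measure_lt_top _ _)
        · exact ENNReal.mul_lt_top (by simp) h

/-! ### Replacing the geometric weights by Orlicz weights -/

/-- The error term of `exists_sq_mul_log_comparison` is integrable over the disc. -/
theorem lintegral_ball_rpow_lt_top :
    ∫⁻ z in Metric.ball (0 : ℂ) 1, ENNReal.ofReal ((1 - ‖z‖) ^ (-(3 / 4) : ℝ)) < ⊤ := by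
  rw [lintegral_ball_eq (by fun_prop)]
  have h1 := (Measure.measurePreserving_sub_left (volume : Measure ℝ)
    1).setLIntegral_comp_preimage_emb (MeasurableEquiv.subLeft (1 : ℝ)).measurableEmbedding
    (fun s => ENNReal.ofReal (s ^ (-(3 / 4) : ℝ))) (Ioo 0 1)
  simp only [preimage_const_sub_Ioo, sub_zero, sub_self] at h1
  calc _ ≤ ∫⁻ r in Ioo (0 : ℝ) 1, ENNReal.ofReal (2 * Real.pi) *
        ENNReal.ofReal ((1 - r) ^ (-(3 / 4) : ℝ)) := by
        refine setLIntegral_mono' measurableSet_Ioo fun r hr => ?_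
        have h2 : ∀ ζ : Circle, ‖(r : ℂ) * ζ‖ = r := fun ζ => by
          simp [abs_of_pos hr.1, Circle.norm_coe]
        simp only [h2]
        rw [lintegral_const, arcLength_univ]
        calc _ ≤ 1 * (ENNReal.ofReal ((1 - r) ^ (-(3 / 4) : ℝ)) * ENNReal.ofReal (2 * Real.pi)) := by
              gcongr
              rw [ENNReal.ofReal_le_one]
              exact hr.2.le
          _ = _ := by rw [one_mul, mul_comm]
    _ = ENNReal.ofReal (2 * Real.pi) * ∫⁻ s in Ioo (0 : ℝ) 1,
        ENNReal.ofReal (s ^ (-(3 / 4) : ℝ)) := by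
        rw [lintegral_const_mul' _ _ ENNReal.ofReal_ne_top, ← h1]
    _ < ⊤ := by
        rw [lintegral_rpow_Ioo (by norm_num) zero_le_one]
        exact ENNReal.mul_lt_top ENNReal.ofReal_lt_top ENNReal.ofReal_lt_top

/-- The comparison of weights with `s = 1 - |z|` and `x = |Dh(z)|`. -/
theorem orliczEnergy_lt_top_iff (l : ℝ) : orliczEnergy (poissonExtension φ) l < ⊤ ↔
    weightedEnergy (poissonExtension φ) l < ⊤ := by
  obtain ⟨C, hC, h⟩ := exists_sq_mul_log_comparison l Real.two_pi_pos
  have hkey : ∀ f g : ℂ → ℝ, (∀ z, ‖z‖ < 1 → 0 ≤ g z) →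
      (∀ z, ‖z‖ < 1 → f z ≤ C * (g z + (1 - ‖z‖) ^ (-(3 / 4) : ℝ))) →
      ∫⁻ z in Metric.ball (0 : ℂ) 1, ENNReal.ofReal (g z) < ⊤ →
      ∫⁻ z in Metric.ball (0 : ℂ) 1, ENNReal.ofReal (f z) < ⊤ := by
    intro f g hg hfg hfin
    calc _ ≤ ∫⁻ z in Metric.ball (0 : ℂ) 1, ENNReal.ofReal C * (ENNReal.ofReal (g z) +
          ENNReal.ofReal ((1 - ‖z‖) ^ (-(3 / 4) : ℝ))) := by
          refine setLIntegral_mono' Metric.isOpen_ball.measurableSet fun z hz => ?_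
          have hz1 : ‖z‖ < 1 := by simpa using hz
          have hz2 : 0 < 1 - ‖z‖ := by linarith
          rw [← ENNReal.ofReal_add (hg z hz1) (by positivity), ← ENNReal.ofReal_mul hC.le]
          exact ENNReal.ofReal_le_ofReal (hfg z hz1)
      _ = ENNReal.ofReal C * ((∫⁻ z in Metric.ball (0 : ℂ) 1, ENNReal.ofReal (g z)) +
          ∫⁻ z in Metric.ball (0 : ℂ) 1, ENNReal.ofReal ((1 - ‖z‖) ^ (-(3 / 4) : ℝ))) := by
          rw [lintegral_const_mul' _ _ ENNReal.ofReal_ne_top, lintegral_add_right _ (by fun_prop)]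
      _ < ⊤ := ENNReal.mul_lt_top ENNReal.ofReal_lt_top
          (ENNReal.add_lt_top.2 ⟨hfin, lintegral_ball_rpow_lt_top⟩)
  have hcomp : ∀ z : ℂ, ‖z‖ < 1 → _ := fun z hz =>
    h (1 - ‖z‖) ‖fderiv ℝ (poissonExtension φ) z‖ (by linarith) (by linarith [norm_nonneg z])
      (norm_nonneg _) (norm_fderiv_poissonExtension_le hz)
  constructor
  · refine hkey _ _ (fun z hz => ?_) fun z hz => (hcomp z hz).2
    have : 0 ≤ Real.log (Real.exp 1 + ‖fderiv ℝ (poissonExtension φ) z‖) := by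
      refine Real.log_nonneg ?_
      linarith [Real.one_le_exp (show (0 : ℝ) ≤ 1 by norm_num),
        norm_nonneg (fderiv ℝ (poissonExtension φ) z)]
    positivity
  · refine hkey _ _ (fun z hz => ?_) fun z hz => (hcomp z hz).1
    have := log_two_div_pos (s := 1 - ‖z‖) (by linarith) (by linarith [norm_nonneg z])
    positivity

theorem imageLength_le (j k : ℕ) : imageLength φ j k ≤ 2 * Real.pi := by
  have h := measure_mono (μ := imageMeasure φ) (subset_univ (dyadicArc j k))
  rw [← ofReal_imageLength, imageMeasure_univ] at h
  exact (ENNReal.ofReal_le_ofReal_iff Real.two_pi_pos.le).1 h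

/-- The comparison of weights with `s = 2^{-j}` and `x = ℓ(φ(Γ_{j,k})) / s`; `j` is comparable with
`log(2/s)`. -/
theorem dyadicEnergy_lt_top_iff (l : ℝ) :
    dyadicEnergy φ l < ⊤ ↔ dyadicOrliczEnergy φ l < ⊤ := by
  obtain ⟨C, hC, h⟩ := exists_sq_mul_log_comparison l Real.two_pi_pos
  obtain ⟨D, hD, hw⟩ := exists_dyadic_weight_comparison l
  set q : ℝ := 2 ^ (-(1 / 4) : ℝ) with hq
  have hq0 : 0 < q := by positivity
  have hq1 : q < 1 := Real.rpow_lt_one_of_one_lt_of_neg one_lt_two (by norm_num)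
  have hgeom : ∑' j : ℕ+, ENNReal.ofReal (q ^ (j : ℕ)) < ⊤ := by
    refine (ENNReal.tsum_comp_le_tsum_of_injective PNat.coe_injective
      (fun j : ℕ => ENNReal.ofReal (q ^ j))).trans_lt ?_
    exact (summable_geometric_of_lt_one hq0.le hq1).tsum_ofReal_lt_top
  have hkey : ∀ (f g : ℕ → ℝ) (A B : ℝ), 0 ≤ A → 0 ≤ B → (∀ j, 0 ≤ g j) →
      (∀ j : ℕ, 1 ≤ j → f j ≤ A * g j + B * q ^ j) →
      ∑' j : ℕ+, ENNReal.ofReal (g j) < ⊤ → ∑' j : ℕ+, ENNReal.ofReal (f j) < ⊤ := by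
    intro f g A B hA hB hg hfg hfin
    calc ∑' j : ℕ+, ENNReal.ofReal (f j) ≤ ∑' j : ℕ+, (ENNReal.ofReal A *
          ENNReal.ofReal (g j) + ENNReal.ofReal B * ENNReal.ofReal (q ^ (j : ℕ))) := by
          refine ENNReal.tsum_le_tsum fun j => ?_
          have hgj := hg j
          rw [← ENNReal.ofReal_mul hA, ← ENNReal.ofReal_mul hB,
            ← ENNReal.ofReal_add (by positivity) (by positivity)]
          exact ENNReal.ofReal_le_ofReal (hfg j j.pos)
      _ < ⊤ := by
          rw [ENNReal.tsum_add, ENNReal.tsum_mul_left, ENNReal.tsum_mul_left]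
          exact ENNReal.add_lt_top.2 ⟨ENNReal.mul_lt_top ENNReal.ofReal_lt_top hfin,
            ENNReal.mul_lt_top ENNReal.ofReal_lt_top hgeom⟩
  set S : ℕ → ℝ := fun j => ((2 : ℝ) ^ j)⁻¹ with hS
  have hS0 : ∀ j, 0 < S j := fun j => by positivity
  have hS1 : ∀ j, S j ≤ 1 := fun j => inv_le_one_of_one_le₀ (one_le_pow₀ one_le_two)
  set P : ℕ → ℕ → ℝ := fun j k => Real.log (Real.exp 1 + imageLength φ j k / S j) ^ l with hP
  have hP0 : ∀ j k, 0 ≤ P j k := fun j k => by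
    have h1 := imageLength_nonneg φ j k
    have h2 : 0 ≤ imageLength φ j k / S j := div_nonneg h1 (hS0 j).le
    refine Real.rpow_nonneg (Real.log_nonneg ?_) l
    linarith [Real.one_le_exp (show (0 : ℝ) ≤ 1 by norm_num)]
  -- the error terms of one generation add up to `2^j (2^{-j})^{5/4}`
  have herr : ∀ j : ℕ, (2 : ℝ) ^ j * (S j ^ 2 * S j ^ (-(3 / 4) : ℝ)) = q ^ j := by
    intro j
    have h1 : (2 : ℝ) ^ j * S j = 1 := by simp [hS]
    have h2 : q ^ j = S j * S j ^ (-(3 / 4) : ℝ) := by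
      have hSj : S j = (2 : ℝ) ^ (-(j : ℝ)) := by
        rw [Real.rpow_neg (by norm_num), Real.rpow_natCast]
      rw [mul_comm, ← Real.rpow_add_one (hS0 j).ne', hq, hSj, ← Real.rpow_natCast,
        ← Real.rpow_mul (by norm_num), ← Real.rpow_mul (by norm_num)]
      congr 1
      ring
    rw [h2]
    linear_combination S j * S j ^ (-(3 / 4) : ℝ) * h1
  have hterm : ∀ j k : ℕ,
      imageLength φ j k ^ 2 * P j k ≤ C * (imageLength φ j k ^ 2 * Real.log (2 / S j) ^ l +
        S j ^ 2 * S j ^ (-(3 / 4) : ℝ)) ∧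
      imageLength φ j k ^ 2 * Real.log (2 / S j) ^ l ≤ C * (imageLength φ j k ^ 2 * P j k +
        S j ^ 2 * S j ^ (-(3 / 4) : ℝ)) := by
    intro j k
    have h1 := imageLength_nonneg φ j k
    have h2 := h (S j) (imageLength φ j k / S j) (hS0 j) (hS1 j) (div_nonneg h1 (hS0 j).le)
      (by have := (hS0 j).le; gcongr; exact imageLength_le φ j k)
    have h3 : imageLength φ j k ^ 2 = S j ^ 2 * (imageLength φ j k / S j) ^ 2 := by
      rw [← mul_pow, mul_div_cancel₀ _ (hS0 j).ne']
    have hS2 : 0 ≤ S j ^ 2 := sq_nonneg _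
    rw [h3]
    constructor
    · calc _ = S j ^ 2 * ((imageLength φ j k / S j) ^ 2 * P j k) := by ring
        _ ≤ S j ^ 2 * _ := mul_le_mul_of_nonneg_left h2.1 hS2
        _ = _ := by ring
    · calc _ = S j ^ 2 * ((imageLength φ j k / S j) ^ 2 * Real.log (2 / S j) ^ l) := by ring
        _ ≤ S j ^ 2 * _ := mul_le_mul_of_nonneg_left h2.2 hS2
        _ = _ := by ring
  have hcard : ∀ (j : ℕ) (u : ℕ → ℝ), ∑ k ∈ Finset.Icc 1 (2 ^ j), C * (u k +
      S j ^ 2 * S j ^ (-(3 / 4) : ℝ)) = C * ∑ k ∈ Finset.Icc 1 (2 ^ j), u k + C * q ^ j := by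
    intro j u
    rw [← Finset.mul_sum, Finset.sum_add_distrib, Finset.sum_const, Nat.card_Icc,
      Nat.add_sub_cancel, nsmul_eq_mul, ← herr j, mul_add]
    push_cast
    rfl
  have hsq0 : ∀ j, 0 ≤ ∑ k ∈ Finset.Icc 1 (2 ^ j), imageLength φ j k ^ 2 := fun j =>
    Finset.sum_nonneg fun k _ => sq_nonneg _
  constructor
  · refine hkey (fun j => ∑ k ∈ Finset.Icc 1 (2 ^ j), imageLength φ j k ^ 2 * P j k)
      (fun j => (j : ℝ) ^ l * ∑ k ∈ Finset.Icc 1 (2 ^ j), imageLength φ j k ^ 2) (C * D) C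
      (by positivity) hC.le (fun j => mul_nonneg (by positivity) (hsq0 j)) fun j hj => ?_
    calc _ ≤ _ := Finset.sum_le_sum fun k _ => (hterm j k).1
      _ = C * (∑ k ∈ Finset.Icc 1 (2 ^ j), imageLength φ j k ^ 2 * Real.log (2 / S j) ^ l) +
          C * q ^ j := hcard j _
      _ = C * (Real.log (2 / S j) ^ l * ∑ k ∈ Finset.Icc 1 (2 ^ j), imageLength φ j k ^ 2) +
          C * q ^ j := by rw [← Finset.sum_mul, mul_comm (Real.log _ ^ l)]
      _ ≤ C * (D * (j : ℝ) ^ l * ∑ k ∈ Finset.Icc 1 (2 ^ j), imageLength φ j k ^ 2) +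
          C * q ^ j := by
          have := hsq0 j
          gcongr
          exact (hw j hj).2
      _ = _ := by ring
  · refine hkey (fun j => (j : ℝ) ^ l * ∑ k ∈ Finset.Icc 1 (2 ^ j), imageLength φ j k ^ 2)
      (fun j => ∑ k ∈ Finset.Icc 1 (2 ^ j), imageLength φ j k ^ 2 * P j k) (D * C) (D * C)
      (by positivity) (by positivity)
      (fun j => Finset.sum_nonneg fun k _ => mul_nonneg (sq_nonneg _) (hP0 j k)) fun j hj => ?_
    calc (j : ℝ) ^ l * ∑ k ∈ Finset.Icc 1 (2 ^ j), imageLength φ j k ^ 2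
        ≤ D * Real.log (2 / S j) ^ l * ∑ k ∈ Finset.Icc 1 (2 ^ j), imageLength φ j k ^ 2 := by
          have := hsq0 j
          gcongr
          exact (hw j hj).1
      _ = D * ∑ k ∈ Finset.Icc 1 (2 ^ j), imageLength φ j k ^ 2 * Real.log (2 / S j) ^ l := by
          rw [← Finset.sum_mul]; ring
      _ ≤ D * ∑ k ∈ Finset.Icc 1 (2 ^ j), C * (imageLength φ j k ^ 2 * P j k +
          S j ^ 2 * S j ^ (-(3 / 4) : ℝ)) :=
          mul_le_mul_of_nonneg_left (Finset.sum_le_sum fun k _ => (hterm j k).2) hD.le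
      _ = _ := by rw [hcard]; ring

end PoissonEnergy

theorem theorem2 (φ : Circle ≃ₜ Circle) (l : ℝ) (hl : -1 < l) :
    [PoissonEnergy.orliczEnergy (PoissonEnergy.poissonExtension φ) l < ⊤,
     PoissonEnergy.weightedEnergy (PoissonEnergy.poissonExtension φ) l < ⊤,
     PoissonEnergy.logEnergy φ.symm l < ⊤,
     PoissonEnergy.dyadicEnergy φ l < ⊤,
     PoissonEnergy.dyadicOrliczEnergy φ l < ⊤].TFAE := by
  tfae_have 1 ↔ 2 := PoissonEnergy.orliczEnergy_lt_top_iff φ l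
  tfae_have 2 → 4 := PoissonEnergy.dyadicEnergy_lt_top_of_weightedEnergy φ
  tfae_have 4 → 3 := PoissonEnergy.logEnergy_lt_top_of_dyadicEnergy φ hl
  tfae_have 3 → 2 := PoissonEnergy.weightedEnergy_lt_top_of_logEnergy φ hl
  tfae_have 4 ↔ 5 := PoissonEnergy.dyadicEnergy_lt_top_iff φ l
  tfae_finish
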